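/- **Setting.** Let $M$ be a connected smooth manifold of dimension $n\ge 2$, $\alpha=\sqrt{a_{ij}(x)y^iy^j}$ a smooth Riemannian metric and $\beta=b_i(x)y^i$ a smooth $1$-form on $M$; put $b=\|\beta_x\|_\alpha$ and $s=\beta/\alpha$. Let $F=\alpha\,\phi(b^2,s)$ be a general $(\alpha,\beta)$-metric. That is, let either $S=\mathbb R$ (regular case), or $S=(0,\infty)$ with $\beta$ nowhere zero (singular case, where $F$ is defined on the half-spaces $\beta>0$ only); $\phi$ is smooth and positive on the set of all $(b^2(x),s)$ with $x\in M$, $s\in S$, $|s|\le b(x)$, and the fundamental tensor $g_{ij}=\frac12[F^2]_{y^iy^j}$ is positive definite at every nonzero tangent vector with $s\in S$. All statements about $F$ refer to these vectors. With $G^i=\frac14 g^{il}\{[F^2]_{x^ky^l}y^k-[F^2]_{x^l}\}$ and $B_j{}^i{}_{kl}=\partial^3G^i/\partial y^j\partial y^k\partial y^l$, the metric $F$ is a Berwald metric if $B=0$, and has isotropic Berwald curvature with scalar function $\tau:M\to\mathbb R$ if $$B_j{}^i{}_{kl}=\tau(x)\,(F_{y^jy^k}\delta^i{}_l+F_{y^jy^l}\delta^i{}_k+F_{y^ly^k}\delta^i{}_j+F_{y^jy^ky^l}y^i).$$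 **Theorem 1.1.** Suppose that $b_{i|j}=c\,a_{ij}$, where $b_{i|j}$ is the covariant derivative of $\beta$ with respect to $\alpha$ and $c=c(x)$ is a function on $M$ without zeros. If $F$ has isotropic Berwald curvature with scalar function $\tau$, then one of the following holds: 1. $F$ is a Riemannian metric; 2. $F$ is a Randers metric, $F=\bar\alpha+\bar\beta$ with a Riemannian metric $\bar\alpha$ and a $1$-form $\bar\beta$ on $M$; 3. $F$ is a Kropina metric, $F=\bar\alpha^2/\bar\beta$; 4. $b$ has no zeros, and $F$ is a Berwald metric of the form $$F=\alpha\,\varphi\!\left(\frac{s^2}{e^{A(b^2)}+s^2J(b^2)}\right)e^{C(b^2)}\,s\qquad(s>0),$$ where $t_2$ is a smooth function of $u=b^2$; $A=\int(\frac1u-u\,t_2)\,du$, $J=\int t_2e^{A}\,du$, $C=\int(\frac12u\,t_2-\frac1u)\,du$ are antiderivatives for which $e^{A}+s^2J>0$ for $0<s\le b$; and $\varphi$ is a positive continuously differentiable function on the set of values of its argument for $0<s\le b$. In the regular case the same formula holds for $s<0$, with $|s|$ in place of the last factor $s$ and possibly another such function $\varphi$; 5. (gluing of 2 and 3; only in the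 singular case, and only if $\tau$ has a zero but does not vanish identically) there are a Riemannian metric $h$, a $1$-form $\theta$ and a smooth function $m\ge0$ on $M$, with zeros but not identically zero, such that $$F=\frac{h^2}{\theta+\sqrt{\theta^2+m\,h^2}},$$ where $\theta>0$ on the domain over the zeros of $m$; so $F$ is a Randers metric where $m>0$ and a Kropina metric $h^2/(2\theta)$ where $m=0$. In particular, one of 1–4 holds in the regular case, and also whenever $\tau$ vanishes identically or nowhere. Conversely, $\varphi$ and $t_2$ in 4 are arbitrary: every general $(\alpha,\beta)$-metric $F$ as in the setting, with $b_{i|j}=c\,a_{ij}$ and $c\ne0$ everywhere, that has the form in 4 is a Berwald metric. -/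

import Mathlib

open scoped Manifold ContDiff
open Bundle

noncomputable section

namespace GenAB

/-- The model space `ℝⁿ` of the charts. -/
abbrev E (n : ℕ) : Type := EuclideanSpace ℝ (Fin n)

/-- The partial derivative `∂f/∂xⁱ` at the point `p` of `ℝⁿ`. -/
def pd {n : ℕ} (i : Fin n) (f : E n → ℝ) (p : E n) : ℝ :=
  fderiv ℝ f p (EuclideanSpace.single i (1 : ℝ))

section Manifold

variable {n : ℕ} {M : Type*} [TopologicalSpace M] [ChartedSpace (E n) M]

/-- A function `F(x, y)` on tangent vectors `y ∈ T_x M`. -/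
abbrev TangentFun (n : ℕ) (M : Type*) [TopologicalSpace M] [ChartedSpace (E n) M] :=
  ∀ x : M, TangentSpace (𝓡 n) x → ℝ

/-- A set of tangent vectors, given fibrewise. -/
abbrev TangentDom (n : ℕ) (M : Type*) [TopologicalSpace M] [ChartedSpace (E n) M] :=
  ∀ x : M, Set (TangentSpace (𝓡 n) x)

/-- A smooth Riemannian metric on `M`. -/
abbrev RMetric (n : ℕ) (M : Type*) [TopologicalSpace M] [ChartedSpace (E n) M]
    [IsManifold (𝓡 n) ∞ M] :=
  ContMDiffRiemannianMetric (𝓡 n) ∞ (E n) (fun x : M => TangentSpace (𝓡 n) x)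

variable (n M) in
/-- A smooth `1`-form on `M`. -/
structure OneForm [IsManifold (𝓡 n) ∞ M] where
  /-- the linear form on each tangent space -/
  form (x : M) : TangentSpace (𝓡 n) x →L[ℝ] ℝ
  smooth : ContMDiff (𝓡 n) ((𝓡 n).prod 𝓘(ℝ, E n →L[ℝ] ℝ)) ∞
    (fun x => TotalSpace.mk' (E n →L[ℝ] ℝ) (E := fun x => TangentSpace (𝓡 n) x →L[ℝ] ℝ)
      x (form x))

/-! ### Local coordinates

`e` is a chart of `M`, `p : E n` are the coordinates of the point `e.symm p`, and `y : E n` are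
the components of the tangent vector `∑ yⁱ ∂/∂xⁱ` at that point. -/

/-- The tangent vector `∑ yⁱ ∂/∂xⁱ` at the point with coordinates `p`. -/
def vec (e : OpenPartialHomeomorph M (E n)) (p y : E n) : TangentSpace (𝓡 n) (e.symm p) :=
  mfderiv (𝓡 n) (𝓡 n) e.symm p y

/-- The coordinate field `∂/∂xⁱ`. -/
def coordVec (e : OpenPartialHomeomorph M (E n)) (i : Fin n) (p : E n) :
    TangentSpace (𝓡 n) (e.symm p) :=
  vec e p (EuclideanSpace.single i (1 : ℝ))

/-- `F(x, y)` in coordinates. -/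
def loc (F : TangentFun n M) (e : OpenPartialHomeomorph M (E n)) (p y : E n) : ℝ :=
  F (e.symm p) (vec e p y)

/-! ### Finsler geometry -/

/-- The fundamental tensor `g_ij = ½ [F²]_{yⁱyʲ}`. -/
def fund (F : TangentFun n M) (e : OpenPartialHomeomorph M (E n)) (p y : E n) :
    Matrix (Fin n) (Fin n) ℝ :=
  Matrix.of fun i j => (1 / 2) * pd j (pd i (fun v => loc F e p v ^ 2)) y

/-- The geodesic (spray) coefficients `Gⁱ = ¼ gⁱˡ ([F²]_{xᵏyˡ} yᵏ - [F²]_{xˡ})`. -/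
def spray (F : TangentFun n M) (e : OpenPartialHomeomorph M (E n)) (i : Fin n) (p y : E n) : ℝ :=
  (1 / 4) * ∑ l, (fund F e p y)⁻¹ i l *
    ((∑ k, pd k (fun q => pd l (fun v => loc F e q v ^ 2) y) p * y k)
      - pd l (fun q => loc F e q y ^ 2) p)

/-- The Berwald curvature `B_j{}ⁱ{}_{kl} = ∂³Gⁱ / ∂yʲ∂yᵏ∂yˡ`. -/
def berwald (F : TangentFun n M) (e : OpenPartialHomeomorph M (E n)) (j i k l : Fin n)
    (p y : E n) : ℝ :=
  pd l (pd k (pd j (spray F e i p))) y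

/-- The tensor `F_{yʲyᵏ} δⁱ_l + F_{yʲyˡ} δⁱ_k + F_{yˡyᵏ} δⁱ_j + F_{yʲyᵏyˡ} yⁱ`. -/
def isoTensor (F : TangentFun n M) (e : OpenPartialHomeomorph M (E n)) (j i k l : Fin n)
    (p y : E n) : ℝ :=
  pd k (pd j (loc F e p)) y * (if i = l then 1 else 0)
    + pd l (pd j (loc F e p)) y * (if i = k then 1 else 0)
    + pd k (pd l (loc F e p)) y * (if i = j then 1 else 0)
    + pd l (pd k (pd j (loc F e p))) y * y i

variable [IsManifold (𝓡 n) ∞ M]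

/-- The Finsler metric `F`, defined on the tangent vectors in `dom`, has isotropic Berwald
curvature with scalar function `τ`. -/
def IsIsotropicBerwald (dom : TangentDom n M) (F : TangentFun n M) (τ : M → ℝ) : Prop :=
  ∀ e ∈ IsManifold.maximalAtlas (𝓡 n) ∞ M, ∀ p ∈ e.target, ∀ y : E n, vec e p y ∈ dom (e.symm p) →
    ∀ j i k l : Fin n, berwald F e j i k l p y = τ (e.symm p) * isoTensor F e j i k l p y

/-- The Berwald curvature of `F` vanishes on `dom`. -/
def IsBerwald (dom : TangentDom n M) (F : TangentFun n M) : Prop :=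
  ∀ e ∈ IsManifold.maximalAtlas (𝓡 n) ∞ M, ∀ p ∈ e.target, ∀ y : E n, vec e p y ∈ dom (e.symm p) →
    ∀ j i k l : Fin n, berwald F e j i k l p y = 0

/-- The fundamental tensor of `F` is positive definite on `dom`. -/
def IsStronglyConvex (dom : TangentDom n M) (F : TangentFun n M) : Prop :=
  ∀ e ∈ IsManifold.maximalAtlas (𝓡 n) ∞ M, ∀ p ∈ e.target, ∀ y : E n, vec e p y ∈ dom (e.symm p) →
    (fund F e p y).PosDef

/-! ### The covariant derivative of a `1`-form -/

/-- The coefficients `a_ij` of a Riemannian metric. -/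
def coeffA (a : RMetric n M) (e : OpenPartialHomeomorph M (E n)) (p : E n) :
    Matrix (Fin n) (Fin n) ℝ :=
  Matrix.of fun i j => a.inner (e.symm p) (coordVec e i p) (coordVec e j p)

/-- The coefficients `b_i` of a `1`-form. -/
def coeffB (β : OneForm n M) (e : OpenPartialHomeomorph M (E n)) (i : Fin n) (p : E n) : ℝ :=
  β.form (e.symm p) (coordVec e i p)

/-- The Christoffel symbols `Γᵏ_ij` of a Riemannian metric. -/
def christoffel (a : RMetric n M) (e : OpenPartialHomeomorph M (E n)) (k i j : Fin n) (p : E n) :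
    ℝ :=
  (1 / 2) * ∑ l, (coeffA a e p)⁻¹ k l *
    (pd i (fun q => coeffA a e q j l) p + pd j (fun q => coeffA a e q i l) p
      - pd l (fun q => coeffA a e q i j) p)

/-- The covariant derivative `b_{i|j} = ∂_j b_i - Γᵏ_ij b_k`. -/
def covDeriv (a : RMetric n M) (β : OneForm n M) (e : OpenPartialHomeomorph M (E n))
    (i j : Fin n) (p : E n) : ℝ :=
  pd j (coeffB β e i) p - ∑ k, christoffel a e k i j p * coeffB β e k p

/-- The condition `b_{i|j} = c a_ij`. -/
def IsClosedConformal (a : RMetric n M) (β : OneForm n M) (c : M → ℝ) : Prop :=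
  ∀ e ∈ IsManifold.maximalAtlas (𝓡 n) ∞ M, ∀ p ∈ e.target, ∀ i j : Fin n,
    covDeriv a β e i j p = c (e.symm p) * coeffA a e p i j

/-! ### General `(α, β)`-metrics -/

/-- `α(x, y) = √(a_ij yⁱ yʲ)`. -/
def alpha (a : RMetric n M) : TangentFun n M := fun x y => √(a.inner x y y)

/-- `s = β / α`. -/
def ratio (a : RMetric n M) (β : OneForm n M) : TangentFun n M :=
  fun x y => β.form x y / alpha a x y

/-- `b² = ‖β_x‖_α²`, the square of the dual norm of `β_x`. -/
def bsq (a : RMetric n M) (β : OneForm n M) (x : M) : ℝ :=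
  (sSup {t | ∃ v : TangentSpace (𝓡 n) x, alpha a x v ≤ 1 ∧ t = β.form x v}) ^ 2

/-- `F = α φ(b², β / α)`. -/
def genAB (a : RMetric n M) (β : OneForm n M) (φ : ℝ → ℝ → ℝ) : TangentFun n M :=
  fun x y => alpha a x y * φ (bsq a β x) (ratio a β x y)

/-- The nonzero tangent vectors with `β / α ∈ S`. -/
def dom (a : RMetric n M) (β : OneForm n M) (S : Set ℝ) : TangentDom n M :=
  fun x => {y | y ≠ 0 ∧ ratio a β x y ∈ S}

/-- The set of all values `(b², s)` with `s ∈ S` and `|s| ≤ b`, where `b²` is a value on `M`. -/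
def valueSet (a : RMetric n M) (β : OneForm n M) (S : Set ℝ) : Set (ℝ × ℝ) :=
  {q | q.1 ∈ Set.range (bsq a β) ∧ q.2 ∈ S ∧ q.2 ^ 2 ≤ q.1}

/-- `F = α φ(b², β / α)` is a Finsler metric with domain the tangent vectors with `s = β/α ∈ S`,
where either `S = ℝ` (a regular metric, defined on all nonzero tangent vectors), or `S = (0, ∞)`
(a singular metric, defined on the half-spaces `β > 0` only; these are required to be nonempty). -/
structure IsGeneralABMetric (a : RMetric n M) (β : OneForm n M) (φ : ℝ → ℝ → ℝ)
    (S : Set ℝ) : Prop where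
  regular_or_singular : S = Set.univ ∨ (S = Set.Ioi 0 ∧ ∀ x, β.form x ≠ 0)
  smooth : ContDiffOn ℝ ∞ (fun q : ℝ × ℝ => φ q.1 q.2) (valueSet a β S)
  pos : ∀ q ∈ valueSet a β S, 0 < φ q.1 q.2
  convex : IsStronglyConvex (dom a β S) (genAB a β φ)

/-! ### The metrics of the classification -/

/-- `F` is (the norm of) a Riemannian metric. -/
def IsRiemannian (D : TangentDom n M) (F : TangentFun n M) : Prop :=
  ∃ h : RMetric n M, ∀ x, ∀ y ∈ D x, F x y = alpha h x y

/-- `F` is a Randers metric: the sum of a Riemannian metric and a `1`-form. -/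
def IsRanders (D : TangentDom n M) (F : TangentFun n M) : Prop :=
  ∃ (h : RMetric n M) (θ : OneForm n M), ∀ x, ∀ y ∈ D x, F x y = alpha h x y + θ.form x y

/-- `F` is a Kropina metric: the square of a Riemannian metric divided by a `1`-form. -/
def IsKropina (D : TangentDom n M) (F : TangentFun n M) : Prop :=
  ∃ (h : RMetric n M) (θ : OneForm n M), ∀ x, ∀ y ∈ D x,
    θ.form x y ≠ 0 ∧ F x y = alpha h x y ^ 2 / θ.form x y

/-- `F = h² / (θ + √(θ² + m h²))` for a Riemannian metric `h`, a `1`-form `θ` and a smooth function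
`m ≥ 0` on `M` that has zeros but does not vanish identically. Where `m > 0` this is the Randers
metric `√(θ² + m h²) / m - θ / m`, and where `m = 0` it is the Kropina metric `h² / (2 θ)`. -/
def IsRandersKropina (D : TangentDom n M) (F : TangentFun n M) : Prop :=
  ∃ (h : RMetric n M) (θ : OneForm n M) (m : M → ℝ), ContMDiff (𝓡 n) 𝓘(ℝ, ℝ) ∞ m ∧
    (∀ x, 0 ≤ m x) ∧ (∃ x, m x = 0) ∧ (∃ x, m x ≠ 0) ∧
    ∀ x, ∀ y ∈ D x, (m x = 0 → 0 < θ.form x y) ∧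
      F x y = alpha h x y ^ 2 /
        (θ.form x y + √(θ.form x y ^ 2 + m x * alpha h x y ^ 2))

/-- The first integral `ξ = s² / (e^A + s² J)` at `u = b²`. -/
def xi (A J : ℝ → ℝ) (u s : ℝ) : ℝ := s ^ 2 / (Real.exp (A u) + s ^ 2 * J u)

/-- The values of `ξ` for `0 < s ≤ b`, where `b²` is a value on `M`. -/
def xiSet (a : RMetric n M) (β : OneForm n M) (A J : ℝ → ℝ) : Set ℝ :=
  {ξ | ∃ q ∈ valueSet a β (Set.Ioi 0), ξ = xi A J q.1 q.2}

/-- The explicit form `F = α ϕ(ξ) e^C s`, where `u = b²`, `A = ∫ (1/u - u t₂) du`,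
`J = ∫ t₂ e^A du`, `C = ∫ (u t₂ / 2 - 1/u) du`, `t₂` is a smooth function of `u`,
and `ϕ` is a positive continuously differentiable function. The constants of integration are such
that the denominator of `ξ` is positive. If vectors with `s < 0` belong to the domain, then `F` has
the form `α ψ(ξ) e^C |s|` there, with another such function `ψ`. -/
def HasExplicitForm (a : RMetric n M) (β : OneForm n M) (D : TangentDom n M)
    (F : TangentFun n M) : Prop :=
  (∀ x, bsq a β x ≠ 0) ∧
  ∃ t₂ A J C ϕ ψ : ℝ → ℝ,
    ContDiffOn ℝ ∞ t₂ (Set.range (bsq a β)) ∧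
    (∀ u ∈ Set.range (bsq a β), HasDerivAt A (1 / u - u * t₂ u) u ∧
      HasDerivAt J (t₂ u * Real.exp (A u)) u ∧
      HasDerivAt C (u * t₂ u / 2 - 1 / u) u) ∧
    (∀ q ∈ valueSet a β (Set.Ioi 0), 0 < Real.exp (A q.1) + q.2 ^ 2 * J q.1) ∧
    ContDiffOn ℝ 1 ϕ (xiSet a β A J) ∧ (∀ ξ ∈ xiSet a β A J, 0 < ϕ ξ) ∧
    ContDiffOn ℝ 1 ψ (xiSet a β A J) ∧ (∀ ξ ∈ xiSet a β A J, 0 < ψ ξ) ∧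
    ∀ x, ∀ y ∈ D x,
      (0 < ratio a β x y → F x y = alpha a x y * ϕ (xi A J (bsq a β x) (ratio a β x y)) *
        Real.exp (C (bsq a β x)) * ratio a β x y) ∧
      (ratio a β x y < 0 → F x y = alpha a x y * ψ (xi A J (bsq a β x) (ratio a β x y)) *
        Real.exp (C (bsq a β x)) * |ratio a β x y|)

end Manifold

end GenAB

end

/-!
The proof computes the geodesic coefficients of `F` and reads off ordinary differential equations
for `φ(u, s)`, `u = b²`. Since `b_{i|j} = c a_ij`, the differential of `b²` is `2 c β`, and the
geodesic coefficients of `F` are those of `α` plus `c α P yⁱ + c α² R bⁱ`, where `P` and `R` are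
explicit expressions in `φ` (`spray_eq`, `spray_genAB`). Strong convexity makes the denominators
nonzero (`cvx_pos`).

Isotropic Berwald curvature says that the third fibre derivatives of `Gⁱ - τ F yⁱ` vanish, so these
functions are quadratic on lines. Restricting to the lines `b + r v` and `v + r b` with `v`
orthogonal to `b` gives `P = σ φ + D s` and `R = k₀ + k₂ s²`, with `σ = τ / c` and coefficients
depending on `u` only (`exists_spray_coeff`). In particular
`(1 - 2 k₀ u) φ_s = (2 σ φ + (D + 2 k₀) s) (φ - s φ_s)`, and there is an equation for `φ_u`
(`Reduced.mul_d2_eq`, `Reduced.two_mul_d1`).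

Where `1 - 2 k₀ u ≠ 0`, the first equation integrates to a quadratic relation
`m φ² + 2 C s φ = A + B s²`. Where `1 - 2 k₀ u = 0`, also `σ` vanishes and `φ` solves a linear
transport equation, whose characteristics carry such relations along. Hence either `1 - 2 k₀ u`
vanishes identically, or a relation holds for every `u` (`Reduced.coeff_zero_or_relAt`).

* In the first case the first integral of the transport equation is a function of the
  characteristic, which is the explicit form (`hasExplicitForm_of_coeff_zero`); here `τ = 0`.
* In the second case `A` can be normalized to `1`, and solving the relation for `φ` gives a Randers
  metric where `m > 0` and a Kropina metric where `m = 0`. In the regular case `m > 0` follows from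
  `s = 0`. In the singular case `m ≥ 0`. At a zero of `m` also `m' = 2 σ C - D m` vanishes, so
  `σ = 0`; and `σ` cannot vanish identically unless `m` does or has no zeros. This yields the gluing
  (`singular_cases`).

Conversely, differentiating the explicit form along the curves of constant `ξ` gives the transport
equation, without a derivative of the arbitrary function. Then `P = -s / u` and
`R = 1 / (2 u) + t₂ s² / 2`, so the geodesic coefficients are quadratic forms
(`isBerwald_of_explicitForm`).
-/

noncomputable section

namespace GenAB

/-! ### Smooth tensors -/

section
variable {n : ℕ} {M : Type*} [TopologicalSpace M] [ChartedSpace (E n) M]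
  {e : OpenPartialHomeomorph M (E n)}

theorem vec_bijective [IsManifold (𝓡 n) ∞ M] (he : e ∈ IsManifold.maximalAtlas (𝓡 n) ∞ M)
    {p : E n} (hp : p ∈ e.target) : Function.Bijective (vec e p) := by
  have h1 := (contMDiffOn_symm_of_mem_maximalAtlas he).mdifferentiableOn (by simp)
  have h2 := (contMDiffOn_of_mem_maximalAtlas he).mdifferentiableOn (by simp)
  have h3 : OpenPartialHomeomorph.MDifferentiable (𝓡 n) (𝓡 n) e := ⟨h2, h1⟩
  exact ⟨h3.symm.mfderiv_injective hp, h3.symm.mfderiv_surjective hp⟩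

theorem vec_eq_sum (p y : E n) : vec e p y = ∑ i, y i • coordVec e i p := by
  have hy : y = ∑ i, y i • EuclideanSpace.single i (1 : ℝ) := by
    ext j; simp [Finset.sum_apply, Pi.single_apply]
  let A : E n →ₗ[ℝ] TangentSpace (𝓡 n) (e.symm p) :=
    (mfderiv (𝓡 n) (𝓡 n) e.symm p).toLinearMap
  have h := congrArg A hy
  rw [map_sum] at h
  simp only [map_smul] at h
  exact h

variable [IsManifold (𝓡 n) ∞ M]

theorem contMDiffOn_coordVec (he : e ∈ IsManifold.maximalAtlas (𝓡 n) ∞ M) (i : Fin n) :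
    ContMDiffOn (𝓡 n) (𝓡 n).tangent ∞
      (fun p => (⟨e.symm p, coordVec e i p⟩ : TangentBundle (𝓡 n) M)) e.target := by
  have h1 : ContMDiffOn (𝓡 n) (𝓡 n) ∞ e.symm e.target := contMDiffOn_symm_of_mem_maximalAtlas he
  have h2 := h1.contMDiffOn_tangentMapWithin (m := ∞) (n := ∞) (by simp)
      (e.open_target.uniqueMDiffOn)
  have h3 : ContMDiffOn (𝓡 n) (𝓡 n).tangent ∞
      (fun p => (⟨p, EuclideanSpace.single i (1 : ℝ)⟩ : TangentBundle (𝓡 n) (E n))) e.target := by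
    apply ContMDiff.contMDiffOn
    intro x
    rw [Bundle.contMDiffAt_totalSpace]
    refine ⟨contMDiffAt_id, ?_⟩
    simpa using contMDiffAt_const
  have h4 := h2.comp h3 (by intro p hp; exact hp)
  refine h4.congr ?_
  intro p hp
  simp only [Function.comp, tangentMapWithin]
  rw [mfderivWithin_of_isOpen e.open_target hp]
  rfl

theorem contDiffOn_coeffA (a : RMetric n M) (he : e ∈ IsManifold.maximalAtlas (𝓡 n) ∞ M)
    (i j : Fin n) : ContDiffOn ℝ ∞ (fun p => coeffA a e p i j) e.target := by
  rw [← contMDiffOn_iff_contDiffOn]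
  have h1 : ContMDiffOn (𝓡 n) ((𝓡 n).prod 𝓘(ℝ, E n →L[ℝ] E n →L[ℝ] ℝ)) ∞
    (fun p => TotalSpace.mk' (E n →L[ℝ] E n →L[ℝ] ℝ)
      (E := fun x => TangentSpace (𝓡 n) x →L[ℝ] TangentSpace (𝓡 n) x →L[ℝ] ℝ) (e.symm p)
          (a.inner (e.symm p))) e.target :=
    a.contMDiff.comp_contMDiffOn (contMDiffOn_symm_of_mem_maximalAtlas he)
  have h2 : ContMDiffOn (𝓡 n) ((𝓡 n).prod 𝓘(ℝ, ℝ)) ∞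
     (fun p => TotalSpace.mk' ℝ (E := Bundle.Trivial M ℝ) (e.symm p)
         (a.inner (e.symm p) (coordVec e i p) (coordVec e j p))) e.target := by
    apply ContMDiffOn.clm_bundle_apply₂ (F₁ := E n) (F₂ := E n)
    · exact h1
    · exact contMDiffOn_coordVec he i
    · exact contMDiffOn_coordVec he j
  intro p hp
  have := h2 p hp
  rw [Bundle.contMDiffWithinAt_totalSpace] at this
  exact this.2

theorem contDiffOn_coeffB (β : OneForm n M) (he : e ∈ IsManifold.maximalAtlas (𝓡 n) ∞ M)
    (i : Fin n) : ContDiffOn ℝ ∞ (coeffB β e i) e.target := by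
  rw [← contMDiffOn_iff_contDiffOn]
  have h1 : ContMDiffOn (𝓡 n) ((𝓡 n).prod 𝓘(ℝ, E n →L[ℝ] ℝ)) ∞
    (fun p => TotalSpace.mk' (E n →L[ℝ] ℝ)
      (E := fun x => TangentSpace (𝓡 n) x →L[ℝ] ℝ) (e.symm p) (β.form (e.symm p))) e.target :=
    β.smooth.comp_contMDiffOn (contMDiffOn_symm_of_mem_maximalAtlas he)
  have h2 : ContMDiffOn (𝓡 n) ((𝓡 n).prod 𝓘(ℝ, ℝ)) ∞
     (fun p => TotalSpace.mk' ℝ (E := Bundle.Trivial M ℝ) (e.symm p)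
         (β.form (e.symm p) (coordVec e i p))) e.target := by
    apply ContMDiffOn.clm_bundle_apply (F₁ := E n)
    · exact h1
    · exact contMDiffOn_coordVec he i
  intro p hp
  have := h2 p hp
  rw [Bundle.contMDiffWithinAt_totalSpace] at this
  exact this.2

theorem contMDiff_of_charts {f : M → ℝ}
    (h : ∀ e ∈ IsManifold.maximalAtlas (𝓡 n) ∞ M, ContDiffOn ℝ ∞ (fun p => f (e.symm p)) e.target) :
    ContMDiff (𝓡 n) 𝓘(ℝ, ℝ) ∞ f := by
  intro x
  have hc := IsManifold.chart_mem_maximalAtlas (I := 𝓡 n) (n := ∞) x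
  have h1 := (contMDiffOn_iff_contDiffOn.2 (h _ hc)).comp
    (contMDiffOn_of_mem_maximalAtlas hc) (fun y hy => (chartAt (E n) x).map_source hy)
  have h2 := h1.contMDiffAt ((chartAt (E n) x).open_source.mem_nhds (mem_chart_source _ x))
  refine h2.congr_of_eventuallyEq ?_
  filter_upwards [(chartAt (E n) x).open_source.mem_nhds (mem_chart_source _ x)] with y hy
  simp [(chartAt (E n) x).left_inv hy]

theorem inner_vec (a : RMetric n M) (p y z : E n) :
    a.inner (e.symm p) (vec e p y) (vec e p z) = ∑ i, ∑ j, coeffA a e p i j * y i * z j := by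
  rw [vec_eq_sum, vec_eq_sum]
  simp only [map_sum, map_smul, sum_apply, smul_apply, smul_eq_mul, coeffA, Matrix.of_apply]
  rw [Finset.sum_comm]
  refine Finset.sum_congr rfl fun i _ => ?_
  simp only [Finset.mul_sum]
  refine Finset.sum_congr rfl fun j _ => ?_
  ring

theorem form_vec (β : OneForm n M) (p y : E n) :
    β.form (e.symm p) (vec e p y) = ∑ i, coeffB β e i p * y i := by
  rw [vec_eq_sum]
  simp only [map_sum, map_smul, smul_eq_mul, coeffB]
  refine Finset.sum_congr rfl fun i _ => ?_
  ring

/-- The section `β ⊗ β` is smooth, being the square of `β` in every trivialization. -/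
theorem contMDiff_tensorSquare (β : OneForm n M) :
    ContMDiff (𝓡 n) ((𝓡 n).prod 𝓘(ℝ, E n →L[ℝ] E n →L[ℝ] ℝ)) ∞
    (fun x => TotalSpace.mk' (E n →L[ℝ] E n →L[ℝ] ℝ)
      (E := fun x => TangentSpace (𝓡 n) x →L[ℝ] TangentSpace (𝓡 n) x →L[ℝ] ℝ) x
      ((β.form x).smulRight (β.form x))) := by
  intro x
  have h := β.smooth x
  rw [contMDiffAt_hom_bundle] at h ⊢
  refine ⟨contMDiffAt_id, ?_⟩
  have h2 : ContMDiffAt (𝓡 n) 𝓘(ℝ, E n →L[ℝ] E n →L[ℝ] ℝ) ∞ (fun y =>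
      (ContinuousLinearMap.inCoordinates (E n) (fun x : M => TangentSpace (𝓡 n) x) ℝ
        (Bundle.Trivial M ℝ) x y x y (β.form y)).smulRight
      (ContinuousLinearMap.inCoordinates (E n) (fun x : M => TangentSpace (𝓡 n) x) ℝ
        (Bundle.Trivial M ℝ) x y x y (β.form y))) x := by
    have hb : ContDiff ℝ ∞ (fun ψ : E n →L[ℝ] ℝ => ψ.smulRight ψ) := by fun_prop
    exact hb.contDiffAt.comp_contMDiffAt h.2
  refine h2.congr_of_eventuallyEq ?_
  have hx' : x ∈ (trivializationAt (E n) (fun x : M => TangentSpace (𝓡 n) x) x).baseSet :=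
    FiberBundle.mem_baseSet_trivializationAt' x
  filter_upwards [(trivializationAt (E n) (fun x : M =>
      TangentSpace (𝓡 n) x) x).open_baseSet.mem_nhds hx'] with y hy
  ext v w
  have hy2 : y ∈ (trivializationAt (E n →L[ℝ] ℝ)
      (fun b : M => TangentSpace (𝓡 n) b →L[ℝ] (Bundle.Trivial M ℝ) b) x).baseSet := by
    rw [hom_trivializationAt_baseSet]
    exact ⟨hy, by simp⟩
  simp only [ContinuousLinearMap.inCoordinates, ContinuousLinearMap.comp_apply,
    ContinuousLinearMap.smulRight_apply, smul_apply, map_smul, smul_eq_mul]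
  simp only [Trivialization.continuousLinearMapAt_apply]
  have h5 : (Trivialization.linearMapAt ℝ (trivializationAt (E n →L[ℝ] ℝ)
      (fun b : M => TangentSpace (𝓡 n) b →L[ℝ] (Bundle.Trivial M ℝ) b) x) y) (β.form y) =
      ContinuousLinearMap.inCoordinates (E n) (fun x : M => TangentSpace (𝓡 n) x) ℝ
        (Bundle.Trivial M ℝ) x y x y (β.form y) := by
    rw [Trivialization.coe_linearMapAt_of_mem _ hy2]
    exact congrArg Prod.snd (hom_trivializationAt_apply (E₁ := fun x : M => TangentSpace (𝓡 n) x)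
        (E₂ := Bundle.Trivial M ℝ) (σ := RingHom.id ℝ) (F₁ := E n) (F₂ := ℝ) x ⟨y, β.form y⟩)
  erw [h5]
  simp [ContinuousLinearMap.inCoordinates]

/-- The `1`-form `f β`. -/
def OneForm.smulFun (β : OneForm n M) (f : M → ℝ) (hf : ContMDiff (𝓡 n) 𝓘(ℝ, ℝ) ∞ f) :
    OneForm n M where
  form x := f x • β.form x
  smooth := hf.smul_section β.smooth

/-- The unit ball of a positive definite form is bounded: this is the condition on the topology of
the fibre in the definition of a Riemannian metric. -/
theorem isVonNBounded_of_pos (B : E n →L[ℝ] E n →L[ℝ] ℝ) (hB : ∀ v, v ≠ 0 → 0 < B v v) :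
    Bornology.IsVonNBounded ℝ {v : E n | B v v < 1} := by
  rw [NormedSpace.isVonNBounded_iff]
  by_cases hS : (Metric.sphere (0 : E n) 1).Nonempty
  · obtain ⟨w, hw, hmin⟩ := (isCompact_sphere (0 : E n) 1).exists_isMinOn hS
      (f := fun v => B v v) (B.continuous.clm_apply continuous_id).continuousOn
    have hw0 : w ≠ 0 := by
      rintro rfl; simp at hw
    have hδ := hB w hw0
    rw [isBounded_iff_forall_norm_le]
    refine ⟨1 + 1 / B w w, fun v hv => ?_⟩
    by_cases hv0 : v = 0
    · rw [hv0, norm_zero]; positivity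
    have hnv : 0 < ‖v‖ := norm_pos_iff.2 hv0
    have h1 : B w w ≤ B (‖v‖⁻¹ • v) (‖v‖⁻¹ • v) :=
      hmin (by simp [norm_smul, hnv.ne'])
    simp only [map_smul, smul_apply, smul_eq_mul] at h1
    have hv' : B v v < 1 := hv
    have h2 : B w w * ‖v‖ ^ 2 ≤ B v v := by
      have h4 := mul_le_mul_of_nonneg_right h1 (sq_nonneg ‖v‖)
      calc _ ≤ _ := h4
        _ = B v v := by field_simp
    have h3 : ‖v‖ ^ 2 ≤ 1 / B w w := by
      rw [le_div_iff₀ hδ]; nlinarith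
    nlinarith [sq_nonneg (‖v‖ - 1)]
  · refine (Bornology.isBounded_singleton (x := (0 : E n))).subset fun v _ => ?_
    by_contra hv
    refine hS ⟨‖v‖⁻¹ • v, ?_⟩
    have hnv : ‖v‖ ≠ 0 := norm_ne_zero_iff.2 hv
    simp [norm_smul, hnv]

set_option synthInstance.maxHeartbeats 400000 in
theorem contMDiff_add_tensorSquare (a : RMetric n M) (β : OneForm n M) {f g : M → ℝ}
    (hf : ContMDiff (𝓡 n) 𝓘(ℝ, ℝ) ∞ f) (hg : ContMDiff (𝓡 n) 𝓘(ℝ, ℝ) ∞ g) :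
    ContMDiff (𝓡 n) ((𝓡 n).prod 𝓘(ℝ, E n →L[ℝ] E n →L[ℝ] ℝ)) ∞
    (fun x => TotalSpace.mk' (E n →L[ℝ] E n →L[ℝ] ℝ)
      (E := fun x => TangentSpace (𝓡 n) x →L[ℝ] TangentSpace (𝓡 n) x →L[ℝ] ℝ) x
      (f x • a.inner x + g x • (β.form x).smulRight (β.form x))) := by
  have h1 := hf.smul_section a.contMDiff
  have h2 := hg.smul_section (contMDiff_tensorSquare β)
  exact h1.add_section h2

theorem add_tensorSquare_apply (a : RMetric n M) (β : OneForm n M) (f g : M → ℝ) (x : M)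
    (v w : TangentSpace (𝓡 n) x) :
    (f x • a.inner x + g x • (β.form x).smulRight (β.form x)) v w
      = f x * a.inner x v w + g x * (β.form x v * β.form x w) := by
  rfl

/-- The Riemannian metric `f α² + g β²`, where this form is positive definite. -/
theorem exists_rmetric_add_tensorSquare (a : RMetric n M) (β : OneForm n M) {f g : M → ℝ}
    (hf : ContMDiff (𝓡 n) 𝓘(ℝ, ℝ) ∞ f) (hg : ContMDiff (𝓡 n) 𝓘(ℝ, ℝ) ∞ g)
    (hpos : ∀ x, ∀ v : TangentSpace (𝓡 n) x, v ≠ 0 →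
      0 < f x * a.inner x v v + g x * β.form x v ^ 2) :
    ∃ h : RMetric n M, ∀ x, ∀ v : TangentSpace (𝓡 n) x,
      h.inner x v v = f x * a.inner x v v + g x * β.form x v ^ 2 := by
  have hpos' : ∀ x, ∀ v : TangentSpace (𝓡 n) x, v ≠ 0 →
      0 < (f x • a.inner x + g x • (β.form x).smulRight (β.form x)) v v := by
    intro x v hv
    rw [add_tensorSquare_apply]
    have := hpos x v hv
    nlinarith
  refine ⟨
    { inner := fun x => f x • a.inner x + g x • (β.form x).smulRight (β.form x)
      symm := by
        intro x v w
        rw [add_tensorSquare_apply, add_tensorSquare_apply, a.symm x v w]; ring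
      pos := hpos'
      isVonNBounded := fun x => isVonNBounded_of_pos _ (hpos' x)
      contMDiff := contMDiff_add_tensorSquare a β hf hg }, fun x v => ?_⟩
  rw [sq]
  exact add_tensorSquare_apply a β f g x v v
end

/-! ### Partial derivatives and smooth matrices -/

section Partial

/-- The partial derivative of a function of two real variables in the first variable. -/
def d1 (f : ℝ → ℝ → ℝ) (u s : ℝ) : ℝ := deriv (fun r => f r s) u

/-- The partial derivative of a function of two real variables in the second variable. -/
def d2 (f : ℝ → ℝ → ℝ) (u s : ℝ) : ℝ := deriv (f u) s

/-- `f(u, s)` is smooth at `q = (u, s)`. -/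
abbrev SmoothAt (f : ℝ → ℝ → ℝ) (q : ℝ × ℝ) : Prop :=
  ContDiffAt ℝ ∞ (fun q : ℝ × ℝ => f q.1 q.2) q

variable {f g : ℝ → ℝ → ℝ} {q : ℝ × ℝ}

theorem SmoothAt.hasFDerivAt (h : SmoothAt f q) :
    HasFDerivAt (fun q : ℝ × ℝ => f q.1 q.2) (fderiv ℝ (fun q : ℝ × ℝ => f q.1 q.2) q) q :=
  (h.differentiableAt (by simp)).hasFDerivAt

theorem SmoothAt.d1_eq (h : SmoothAt f q) :
    d1 f q.1 q.2 = fderiv ℝ (fun q : ℝ × ℝ => f q.1 q.2) q (1, 0) := by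
  have h1 : HasDerivAt (fun r : ℝ => (r, q.2)) ((1 : ℝ), (0 : ℝ)) q.1 :=
    (hasDerivAt_id q.1).prodMk (hasDerivAt_const q.1 q.2)
  exact (h.hasFDerivAt.comp_hasDerivAt q.1 h1).deriv

theorem SmoothAt.d2_eq (h : SmoothAt f q) :
    d2 f q.1 q.2 = fderiv ℝ (fun q : ℝ × ℝ => f q.1 q.2) q (0, 1) := by
  have h1 : HasDerivAt (fun r : ℝ => (q.1, r)) ((0 : ℝ), (1 : ℝ)) q.2 :=
    (hasDerivAt_const q.2 q.1).prodMk (hasDerivAt_id q.2)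
  exact (h.hasFDerivAt.comp_hasDerivAt q.2 h1).deriv

/-- The chain rule along a curve. -/
theorem SmoothAt.hasDerivAt_comp {x y : ℝ → ℝ} {x' y' r : ℝ} (h : SmoothAt f (x r, y r))
    (hx : HasDerivAt x x' r) (hy : HasDerivAt y y' r) :
    HasDerivAt (fun r => f (x r) (y r)) (d1 f (x r) (y r) * x' + d2 f (x r) (y r) * y') r := by
  have h1 := h.hasFDerivAt.comp_hasDerivAt r (hx.prodMk hy)
  have h2 : (x', y') = x' • ((1 : ℝ), (0 : ℝ)) + y' • ((0 : ℝ), (1 : ℝ)) := by simp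
  have e1 := h.d1_eq
  have e2 := h.d2_eq
  simp only at e1 e2
  rw [h2, map_add, map_smul, map_smul, ← e1, ← e2, smul_eq_mul, smul_eq_mul, mul_comm x',
    mul_comm y'] at h1
  exact h1

theorem SmoothAt.hasDerivAt_left {u s : ℝ} (h : SmoothAt f (u, s)) :
    HasDerivAt (fun r => f r s) (d1 f u s) u := by
  simpa using h.hasDerivAt_comp (x := fun r => r) (y := fun _ => s) (hasDerivAt_id u)
      (hasDerivAt_const u s)

theorem SmoothAt.hasDerivAt_right {u s : ℝ} (h : SmoothAt f (u, s)) :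
    HasDerivAt (f u) (d2 f u s) s := by
  simpa using h.hasDerivAt_comp (x := fun _ => u) (y := fun r => r) (hasDerivAt_const s u)
      (hasDerivAt_id s)

/-- Smoothness on an open set. -/
abbrev SmoothOn (f : ℝ → ℝ → ℝ) (O : Set (ℝ × ℝ)) : Prop :=
  ContDiffOn ℝ ∞ (fun q : ℝ × ℝ => f q.1 q.2) O

variable {O : Set (ℝ × ℝ)}

theorem SmoothOn.smoothAt (h : SmoothOn f O) (hO : IsOpen O) (hq : q ∈ O) : SmoothAt f q :=
  h.contDiffAt (hO.mem_nhds hq)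

theorem SmoothOn.d1 (h : SmoothOn f O) (hO : IsOpen O) : SmoothOn (d1 f) O := by
  have h1 : ContDiffOn ℝ ∞ (fderiv ℝ (fun q : ℝ × ℝ => f q.1 q.2)) O :=
    h.fderiv_of_isOpen hO (by simp)
  have h2 : ContDiffOn ℝ ∞ (fun q => fderiv ℝ (fun q : ℝ × ℝ => f q.1 q.2) q (1, 0)) O :=
    h1.clm_apply contDiffOn_const
  exact h2.congr fun q hq => (h.smoothAt hO hq).d1_eq

theorem SmoothOn.d2 (h : SmoothOn f O) (hO : IsOpen O) : SmoothOn (d2 f) O := by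
  have h1 : ContDiffOn ℝ ∞ (fderiv ℝ (fun q : ℝ × ℝ => f q.1 q.2)) O :=
    h.fderiv_of_isOpen hO (by simp)
  have h2 : ContDiffOn ℝ ∞ (fun q => fderiv ℝ (fun q : ℝ × ℝ => f q.1 q.2) q (0, 1)) O :=
    h1.clm_apply contDiffOn_const
  exact h2.congr fun q hq => (h.smoothAt hO hq).d2_eq

theorem SmoothOn.d1_d2_comm (h : SmoothOn f O) (hO : IsOpen O) (hq : q ∈ O) :
    GenAB.d1 (GenAB.d2 f) q.1 q.2 = GenAB.d2 (GenAB.d1 f) q.1 q.2 := by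
  set F := fun q : ℝ × ℝ => f q.1 q.2 with hF
  have h1 : ContDiffOn ℝ ∞ (fderiv ℝ F) O := h.fderiv_of_isOpen hO (by simp)
  have h1' : DifferentiableAt ℝ (fderiv ℝ F) q :=
    (h1.contDiffAt (hO.mem_nhds hq)).differentiableAt (by simp)
  have key : ∀ v : ℝ × ℝ, fderiv ℝ (fun q => fderiv ℝ F q v) q
      = (fderiv ℝ (fderiv ℝ F) q).flip v := by
    intro v
    rw [fderiv_clm_apply h1' (by fun_prop)]
    simp
  rw [((h.d2 hO).smoothAt hO hq).d1_eq, ((h.d1 hO).smoothAt hO hq).d2_eq]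
  have e1 : (fun q : ℝ × ℝ => GenAB.d2 f q.1 q.2) =ᶠ[nhds q] fun q => fderiv ℝ F q (0, 1) := by
    filter_upwards [hO.mem_nhds hq] with x hx using (h.smoothAt hO hx).d2_eq
  have e2 : (fun q : ℝ × ℝ => GenAB.d1 f q.1 q.2) =ᶠ[nhds q] fun q => fderiv ℝ F q (1, 0) := by
    filter_upwards [hO.mem_nhds hq] with x hx using (h.smoothAt hO hx).d1_eq
  rw [e1.fderiv_eq, e2.fderiv_eq, key, key]
  have hs : IsSymmSndFDerivAt ℝ F q := (h.smoothAt hO hq).isSymmSndFDerivAt (by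
    simp only [minSmoothness_of_isRCLikeNormedField]; exact WithTop.coe_le_coe.2 le_top)
  exact hs.eq _ _

end Partial

section Coordinates

variable {n : ℕ}

theorem pd_congr {f g : E n → ℝ} {p : E n} (h : f =ᶠ[nhds p] g) (i : Fin n) :
    pd i f p = pd i g p := by
  rw [pd, pd, h.fderiv_eq]

theorem contDiffOn_det {X : Type*} [NormedAddCommGroup X] [NormedSpace ℝ X] {s : Set X}
    {A : X → Matrix (Fin n) (Fin n) ℝ} (hA : ∀ i j, ContDiffOn ℝ ∞ (fun x => A x i j) s) :
    ContDiffOn ℝ ∞ (fun x => (A x).det) s := by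
  simp only [Matrix.det_apply]
  refine ContDiffOn.sum fun σ _ => ?_
  refine ContDiffOn.const_smul _ ?_
  exact contDiffOn_prod fun i _ => hA _ _

theorem contDiffOn_matrix_inv {X : Type*} [NormedAddCommGroup X] [NormedSpace ℝ X] {s : Set X}
    {A : X → Matrix (Fin n) (Fin n) ℝ} (hA : ∀ i j, ContDiffOn ℝ ∞ (fun x => A x i j) s)
    (hdet : ∀ x ∈ s, (A x).det ≠ 0) (i j : Fin n) :
    ContDiffOn ℝ ∞ (fun x => (A x)⁻¹ i j) s := by
  simp only [Matrix.inv_def, Ring.inverse_eq_inv', Matrix.smul_apply, smul_eq_mul,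
      Matrix.adjugate_apply]
  refine ((contDiffOn_det hA).inv hdet).mul (contDiffOn_det fun k l => ?_)
  by_cases hk : k = j
  · subst hk; simp only [Matrix.updateRow_self]; exact contDiffOn_const
  · simp only [Matrix.updateRow_ne hk]; exact hA k l

end Coordinates

/-! ### The metric and the form in a chart -/

section
variable {n : ℕ} {M : Type*} [TopologicalSpace M] [ChartedSpace (E n) M] [IsManifold (𝓡 n) ∞ M]

section Fibre
variable (a : RMetric n M) (β : OneForm n M) {x : M}

theorem RMetric.inner_self_nonneg (v : TangentSpace (𝓡 n) x) : 0 ≤ a.inner x v v := by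
  by_cases hv : v = 0
  · simp [hv]
  · exact (a.pos x v hv).le

theorem RMetric.inner_comb (v w : TangentSpace (𝓡 n) x) (r t : ℝ) :
    a.inner x (r • v + t • w) (r • v + t • w) =
      r ^ 2 * a.inner x v v + 2 * r * t * a.inner x v w + t ^ 2 * a.inner x w w := by
  simp only [map_add, map_smul, add_apply, smul_apply, smul_eq_mul]
  rw [a.symm x w v]; ring

theorem alpha_sq (v : TangentSpace (𝓡 n) x) : alpha a x v ^ 2 = a.inner x v v :=
  Real.sq_sqrt (a.inner_self_nonneg v)

theorem alpha_pos {v : TangentSpace (𝓡 n) x} (hv : v ≠ 0) : 0 < alpha a x v :=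
  Real.sqrt_pos.2 (a.pos x v hv)

theorem RMetric.cauchySchwarz (v w : TangentSpace (𝓡 n) x) :
    a.inner x v w ^ 2 ≤ a.inner x v v * a.inner x w w := by
  have h := a.inner_comb v w (a.inner x w w) (-a.inner x v w)
  have h0 := a.inner_self_nonneg (a.inner x w w • v + (-a.inner x v w) • w)
  rw [h] at h0
  by_cases hw : w = 0
  · simp [hw]
  · have := a.pos x w hw
    by_contra hc
    push Not at hc
    nlinarith

variable {a β}

/-- `b²` is the squared length of the vector dual to `β`. -/
theorem bsq_eq_of_dual {w : TangentSpace (𝓡 n) x} (hw : ∀ v, a.inner x w v = β.form x v) :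
    bsq a β x = a.inner x w w := by
  have h : sSup {t | ∃ v : TangentSpace (𝓡 n) x, alpha a x v ≤ 1 ∧ t = β.form x v}
      = alpha a x w := by
    apply IsGreatest.csSup_eq
    constructor
    · by_cases h0 : w = 0
      · refine ⟨0, ?_, ?_⟩ <;> simp [alpha, h0]
      · have hp := alpha_pos a h0
        refine ⟨(alpha a x w)⁻¹ • w, ?_, ?_⟩
        · have : alpha a x ((alpha a x w)⁻¹ • w) ^ 2 = 1 := by
            rw [alpha_sq, map_smul, map_smul, smul_apply, smul_eq_mul, smul_eq_mul, ← alpha_sq]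
            field_simp
          have h2 : 0 ≤ alpha a x ((alpha a x w)⁻¹ • w) := Real.sqrt_nonneg _
          nlinarith
        · rw [map_smul, ← hw, ← alpha_sq, smul_eq_mul]; field_simp
    · rintro t ⟨v, hv, rfl⟩
      rw [← hw]
      have h1 := a.cauchySchwarz w v
      rw [← alpha_sq, ← alpha_sq] at h1
      have h2 : 0 ≤ alpha a x v := Real.sqrt_nonneg _
      have h3 : 0 ≤ alpha a x w := Real.sqrt_nonneg _
      have h4 := abs_le_of_sq_le_sq (a := a.inner x w v) (b := alpha a x w * alpha a x v)
          (by nlinarith) (by positivity)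
      nlinarith [le_abs_self (a.inner x w v)]
  rw [bsq, h, alpha_sq]

end Fibre

section Chart
variable (a : RMetric n M) (β : OneForm n M) (e : OpenPartialHomeomorph M (E n))

/-- The inner product of the tangent vectors with components `y` and `z`. -/
def ip (p y z : E n) : ℝ := ∑ i, ∑ j, coeffA a e p i j * y i * z j

/-- The value of `β` on the tangent vector with components `y`. -/
def lin (p y : E n) : ℝ := ∑ i, coeffB β e i p * y i

/-- The components `y_i = a_ij yʲ`. -/
def low (p y : E n) (i : Fin n) : ℝ := ∑ j, coeffA a e p i j * y j

/-- The components `bⁱ` of the vector dual to `β`. -/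
def sharp (p : E n) : E n := WithLp.toLp 2 ((coeffA a e p)⁻¹.mulVec fun i => coeffB β e i p)

variable {a β e}

theorem coeffA_symm (p : E n) (i j : Fin n) : coeffA a e p i j = coeffA a e p j i := a.symm _ _ _

theorem inner_vec_eq (p y z : E n) : a.inner (e.symm p) (vec e p y) (vec e p z) = ip a e p y z :=
  inner_vec a p y z

theorem form_vec_eq (p y : E n) : β.form (e.symm p) (vec e p y) = lin β e p y := form_vec β p y

theorem ip_eq_low (p y z : E n) : ip a e p y z = ∑ i, low a e p y i * z i := by
  simp only [ip, low, Finset.sum_mul]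
  rw [Finset.sum_comm]
  refine Finset.sum_congr rfl fun i _ => Finset.sum_congr rfl fun j _ => ?_
  rw [coeffA_symm]

theorem ip_comm (p y z : E n) : ip a e p y z = ip a e p z y := by
  rw [← inner_vec_eq, ← inner_vec_eq, a.symm]

variable (he : e ∈ IsManifold.maximalAtlas (𝓡 n) ∞ M) {p : E n} (hp : p ∈ e.target)
include he hp

theorem vec_eq_zero_iff {y : E n} : vec e p y = 0 ↔ y = 0 := by
  have h0 : vec e p 0 = 0 := by rw [vec_eq_sum]; simp
  rw [← h0]; exact (vec_bijective he hp).1.eq_iff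

theorem ip_self_pos {y : E n} (hy : y ≠ 0) : 0 < ip a e p y y := by
  rw [← inner_vec_eq]
  exact a.pos _ _ (fun h => hy ((vec_eq_zero_iff he hp).1 h))

theorem coeffA_posDef : (coeffA a e p).PosDef := by
  refine Matrix.PosDef.of_dotProduct_mulVec_pos ?_ ?_
  · ext i j; simp [Matrix.conjTranspose_apply]; exact coeffA_symm p j i
  · intro y hy
    have h := ip_self_pos (a := a) he hp (y := WithLp.toLp 2 y) (by simpa using hy)
    have h2 : star y ⬝ᵥ (coeffA a e p).mulVec y = ip a e p (WithLp.toLp 2 y) (WithLp.toLp 2 y) := by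
      simp only [ip, dotProduct, Matrix.mulVec, Finset.mul_sum]
      refine Finset.sum_congr rfl fun i _ => Finset.sum_congr rfl fun j _ => ?_
      simp; ring
    rw [h2]; exact h

theorem coeffA_det_ne : (coeffA a e p).det ≠ 0 := (coeffA_posDef he hp).det_pos.ne'

theorem low_sharp (i : Fin n) : low a e p (sharp a β e p) i = coeffB β e i p := by
  have h : (coeffA a e p).mulVec ((coeffA a e p)⁻¹.mulVec fun i => coeffB β e i p) = fun i =>
      coeffB β e i p := by
    rw [Matrix.mulVec_mulVec, Matrix.mul_nonsing_inv _ (coeffA_det_ne he hp).isUnit,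
        Matrix.one_mulVec]
  exact congrFun h i

theorem ip_sharp (y : E n) : ip a e p (sharp a β e p) y = lin β e p y := by
  rw [ip_eq_low]; simp only [low_sharp he hp, lin]

theorem bsq_eq_ip : bsq a β (e.symm p) = ip a e p (sharp a β e p) (sharp a β e p) := by
  rw [← inner_vec_eq]
  refine bsq_eq_of_dual fun v => ?_
  obtain ⟨y, rfl⟩ := (vec_bijective he hp).2 v
  rw [inner_vec_eq, form_vec_eq, ip_sharp he hp]

theorem bsq_eq_lin : bsq a β (e.symm p) = lin β e p (sharp a β e p) := by
  rw [bsq_eq_ip he hp, ip_sharp he hp]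

omit hp in
theorem contDiffOn_sharp (i : Fin n) : ContDiffOn ℝ ∞ (fun p => sharp a β e p i) e.target := by
  have h : ∀ p, sharp a β e p i = ∑ j, (coeffA a e p)⁻¹ i j * coeffB β e j p := fun p => rfl
  simp only [h]
  refine ContDiffOn.sum fun j _ => ?_
  exact (contDiffOn_matrix_inv (contDiffOn_coeffA a he) (fun q hq => coeffA_det_ne he hq) i j).mul
    (contDiffOn_coeffB β he j)

omit hp in
theorem contDiffOn_bsq : ContDiffOn ℝ ∞ (fun p => bsq a β (e.symm p)) e.target := by
  have h : ∀ p ∈ e.target, bsq a β (e.symm p) = ∑ j, coeffB β e j p * sharp a β e p j :=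
    fun p hp => bsq_eq_lin he hp
  refine ContDiffOn.congr ?_ h
  exact ContDiffOn.sum fun j _ => (contDiffOn_coeffB β he j).mul (contDiffOn_sharp he j)

/-- Lowering the upper index of the Christoffel symbols against `β`. -/
theorem sum_christoffel_coeffB (i j : Fin n) :
    ∑ k, christoffel a e k i j p * coeffB β e k p = (1 / 2) * ∑ l, sharp a β e p l *
      (pd i (fun q => coeffA a e q j l) p + pd j (fun q => coeffA a e q i l) p
        - pd l (fun q => coeffA a e q i j) p) := by
  have hs : ∀ l, sharp a β e p l = ∑ k, (coeffA a e p)⁻¹ k l * coeffB β e k p := by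
    intro l
    have : ∀ k, (coeffA a e p)⁻¹ k l = (coeffA a e p)⁻¹ l k := by
      intro k
      have h1 : (coeffA a e p).IsHermitian := (coeffA_posDef he hp).1
      have := h1.inv.apply l k
      simpa using this
    simp only [this]; rfl
  simp only [christoffel, hs, Finset.sum_mul, Finset.mul_sum]
  rw [Finset.sum_comm]
  refine Finset.sum_congr rfl fun l _ => Finset.sum_congr rfl fun k _ => ?_
  ring

variable {c : M → ℝ} (hβ : IsClosedConformal a β c)
include hβ

theorem pd_coeffB (i j : Fin n) :
    pd j (coeffB β e i) p = c (e.symm p) * coeffA a e p i j + (1 / 2) * ∑ l, sharp a β e p l *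
      (pd i (fun q => coeffA a e q j l) p + pd j (fun q => coeffA a e q i l) p
        - pd l (fun q => coeffA a e q i j) p) := by
  have h := hβ e he p hp i j
  rw [covDeriv, sum_christoffel_coeffB he hp] at h
  linarith

theorem pd_coeffB_symm (i j : Fin n) : pd j (coeffB β e i) p = pd i (coeffB β e j) p := by
  rw [pd_coeffB he hp hβ, pd_coeffB he hp hβ, coeffA_symm]
  have : (fun q => coeffA a e q i j) = fun q => coeffA a e q j i := by
    funext q; exact coeffA_symm q i j
  rw [this]
  congr 2
  refine Finset.sum_congr rfl fun l _ => ?_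
  ring

/-- `d(b²) = 2 c β`. -/
theorem pd_bsq (k : Fin n) :
    pd k (fun q => bsq a β (e.symm q)) p = 2 * c (e.symm p) * coeffB β e k p := by
  set w := sharp a β e p with hw
  -- `b²` is the maximum of `2 β(w) - α(w)²` over all vectors `w`, attained at the dual vector.
  let f : E n → ℝ := fun q => 2 * lin β e q w - ip a e q w w
  have hT := e.open_target.mem_nhds hp
  have hB : ∀ i, DifferentiableAt ℝ (coeffB β e i) p := fun i =>
    ((contDiffOn_coeffB β he i).contDiffAt hT).differentiableAt (by simp)
  have hA : ∀ i j, DifferentiableAt ℝ (fun q => coeffA a e q i j) p := fun i j =>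
    ((contDiffOn_coeffA a he i j).contDiffAt hT).differentiableAt (by simp)
  have hu : DifferentiableAt ℝ (fun q => bsq a β (e.symm q)) p :=
    ((contDiffOn_bsq he).contDiffAt hT).differentiableAt (by simp)
  have hf : DifferentiableAt ℝ f p := by
    simp only [f, lin, ip]
    fun_prop
  have hmin : IsLocalMin (fun q => bsq a β (e.symm q) - f q) p := by
    filter_upwards [hT] with q hq
    have h0 : f p = bsq a β (e.symm p) := by
      simp only [f]; rw [bsq_eq_lin he hp, ← ip_sharp he hp w, hw, ip_sharp he hp]; ring
    rw [h0, sub_self]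
    have h1 := a.inner_self_nonneg (vec e q (sharp a β e q) - vec e q w)
    simp only [map_sub, sub_apply] at h1
    rw [a.symm _ (vec e q w) (vec e q (sharp a β e q))] at h1
    simp only [inner_vec_eq] at h1
    rw [ip_sharp he hq w, ← bsq_eq_ip he hq] at h1
    simp only [f]; linarith
  have h0 := hmin.fderiv_eq_zero
  have h1 : pd k (fun q => bsq a β (e.symm q)) p = pd k f p := by
    have h2 := congrArg (fun A : E n →L[ℝ] ℝ => A (EuclideanSpace.single k 1)) h0
    rw [fderiv_fun_sub hu hf] at h2
    simp only [sub_apply, zero_apply] at h2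
    simp only [pd]; linarith
  have h3 : pd k f p = 2 * ∑ i, pd k (coeffB β e i) p * w i
      - ∑ i, ∑ j, pd k (fun q => coeffA a e q i j) p * w i * w j := by
    simp only [f, lin, ip, pd]
    rw [fderiv_fun_sub (by fun_prop) (by fun_prop), fderiv_const_mul (by fun_prop),
        fderiv_fun_sum (by fun_prop),
      fderiv_fun_sum (by fun_prop)]
    simp only [sub_apply, smul_apply, sum_apply, smul_eq_mul]
    congr 1
    · congr 1
      refine Finset.sum_congr rfl fun i _ => ?_
      rw [fderiv_mul_const (by fun_prop)]
      simp [mul_comm]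
    · refine Finset.sum_congr rfl fun i _ => ?_
      rw [fderiv_fun_sum (by fun_prop)]
      simp only [sum_apply]
      refine Finset.sum_congr rfl fun j _ => ?_
      rw [fderiv_mul_const (by fun_prop), fderiv_mul_const (by fun_prop)]
      simp [mul_comm]
  rw [h1, h3]
  simp only [pd_coeffB he hp hβ, ← hw]
  have h4 : ∑ i, c (e.symm p) * coeffA a e p i k * w i = c (e.symm p) * coeffB β e k p := by
    rw [← low_sharp (a := a) he hp, low, Finset.mul_sum]
    refine Finset.sum_congr rfl fun i _ => ?_
    rw [coeffA_symm]; ring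
  have h5 : ∑ i, (∑ l, w l * (pd i (fun q => coeffA a e q k l) p +
      pd k (fun q => coeffA a e q i l) p
        - pd l (fun q => coeffA a e q i k) p)) * w i =
      ∑ i, ∑ j, pd k (fun q => coeffA a e q i j) p * w i * w j := by
    have h6 : ∑ i, ∑ l, pd i (fun q => coeffA a e q k l) p * w i * w l =
       ∑ i, ∑ l, pd l (fun q => coeffA a e q i k) p * w i * w l := by
      rw [Finset.sum_comm]
      refine Finset.sum_congr rfl fun i _ => Finset.sum_congr rfl fun j _ => ?_
      have : (fun q => coeffA a e q i k) = fun q => coeffA a e q k i := by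
        funext q; exact coeffA_symm q i k
      rw [this]; ring
    have h7 : ∀ i, (∑ l, w l * (pd i (fun q => coeffA a e q k l) p +
        pd k (fun q => coeffA a e q i l) p
        - pd l (fun q => coeffA a e q i k) p)) * w i =
        (∑ l, pd i (fun q => coeffA a e q k l) p * w i * w l) +
        (∑ l, pd k (fun q => coeffA a e q i l) p * w i * w l) -
        (∑ l, pd l (fun q => coeffA a e q i k) p * w i * w l) := by
      intro i
      rw [← Finset.sum_add_distrib, ← Finset.sum_sub_distrib, Finset.sum_mul]
      refine Finset.sum_congr rfl fun l _ => ?_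
      ring
    simp only [h7, Finset.sum_add_distrib, Finset.sum_sub_distrib]
    rw [h6]; ring
  have h8 : ∀ i, (c (e.symm p) * coeffA a e p i k + 1 / 2 * ∑ l, w l *
      (pd i (fun q => coeffA a e q k l) p + pd k (fun q => coeffA a e q i l) p
        - pd l (fun q => coeffA a e q i k) p)) * w i = c (e.symm p) * coeffA a e p i k * w i +
      1 / 2 * ((∑ l, w l * (pd i (fun q => coeffA a e q k l) p + pd k (fun q => coeffA a e q i l) p
        - pd l (fun q => coeffA a e q i k) p)) * w i) := fun i => by ring
  simp only [h8, Finset.sum_add_distrib, ← Finset.mul_sum]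
  rw [h4, h5]; ring

end Chart
end

/-! ### Rules for partial derivatives -/

section Rules
variable {n : ℕ} {f g : E n → ℝ} {p : E n}

theorem pd_const (k : Fin n) (r : ℝ) : pd k (fun _ : E n => r) p = 0 := by
  simp [pd]

theorem pd_mul (hf : DifferentiableAt ℝ f p) (hg : DifferentiableAt ℝ g p) (k : Fin n) :
    pd k (fun q => f q * g q) p = pd k f p * g p + f p * pd k g p := by
  simp only [pd]
  rw [fderiv_fun_mul hf hg]
  simp; ring

theorem pd_const_mul (hf : DifferentiableAt ℝ f p) (r : ℝ) (k : Fin n) :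
    pd k (fun q => r * f q) p = r * pd k f p := by
  rw [pd_mul (by fun_prop) hf, pd_const]; ring

theorem pd_mul_const (hf : DifferentiableAt ℝ f p) (r : ℝ) (k : Fin n) :
    pd k (fun q => f q * r) p = pd k f p * r := by
  rw [pd_mul hf (by fun_prop), pd_const]; ring

theorem pd_add (hf : DifferentiableAt ℝ f p) (hg : DifferentiableAt ℝ g p) (k : Fin n) :
    pd k (fun q => f q + g q) p = pd k f p + pd k g p := by
  simp only [pd]
  rw [fderiv_fun_add hf hg]
  simp

theorem pd_sum {ι : Type*} {s : Finset ι} {f : ι → E n → ℝ}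
    (hf : ∀ i ∈ s, DifferentiableAt ℝ (f i) p) (k : Fin n) :
    pd k (fun q => ∑ i ∈ s, f i q) p = ∑ i ∈ s, pd k (f i) p := by
  simp only [pd]
  rw [fderiv_fun_sum hf]
  simp

theorem pd_coord (i k : Fin n) : pd k (fun v : E n => v i) p = if i = k then 1 else 0 := by
  have h : (fun v : E n => v i) = (EuclideanSpace.proj i : E n →L[ℝ] ℝ) := rfl
  rw [pd, h, ContinuousLinearMap.fderiv]
  simp

theorem differentiableAt_coord (i : Fin n) : DifferentiableAt ℝ (fun v : E n => v i) p :=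
  (EuclideanSpace.proj i : E n →L[ℝ] ℝ).differentiableAt

theorem pd_sqrt (hf : DifferentiableAt ℝ f p) (h0 : 0 < f p) (k : Fin n) :
    pd k (fun q => √(f q)) p = pd k f p / (2 * √(f p)) := by
  simp only [pd]
  rw [fderiv_sqrt hf h0.ne']
  simp; ring

/-- The derivative of `s = t / √N`. -/
theorem pd_div_sqrt (hf : DifferentiableAt ℝ f p) (hg : DifferentiableAt ℝ g p) (h0 : 0 < g p)
    (k : Fin n) : pd k (fun q => f q / √(g q)) p =
      pd k f p / √(g p) - f p / √(g p) * pd k g p / (2 * g p) := by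
  have hs : √(g p) ≠ 0 := (Real.sqrt_pos.2 h0).ne'
  have hd : DifferentiableAt ℝ (fun q => √(g q)) p := hg.sqrt h0.ne'
  have hq : DifferentiableAt ℝ (fun q => f q / √(g q)) p := by
    simp only [div_eq_mul_inv]; exact hf.mul (hd.inv hs)
  have h1 := pd_mul hq hd k
  have h2 : (fun q => f q / √(g q) * √(g q)) =ᶠ[nhds p] f := by
    filter_upwards [hg.continuousAt.eventually (lt_mem_nhds h0)] with q hq
    have : √(g q) ≠ 0 := (Real.sqrt_pos.2 hq).ne'
    field_simp
  rw [pd_congr h2, pd_sqrt hg h0] at h1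
  rw [h1]
  have : g p = √(g p) ^ 2 := (Real.sq_sqrt h0.le).symm
  rw [this]
  simp only [Real.sqrt_sq (Real.sqrt_nonneg _)]
  field_simp
  ring

/-- The chain rule for a function of two variables. -/
theorem pd_comp₂ {h : ℝ → ℝ → ℝ} (hh : SmoothAt h (f p, g p)) (hf : DifferentiableAt ℝ f p)
    (hg : DifferentiableAt ℝ g p) (k : Fin n) :
    pd k (fun q => h (f q) (g q)) p = d1 h (f p) (g p) * pd k f p + d2 h (f p) (g p) *
        pd k g p := by
  have e1 := hh.d1_eq
  have e2 := hh.d2_eq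
  simp only at e1 e2
  have h1 := (hh.hasFDerivAt.comp p (hf.hasFDerivAt.prodMk hg.hasFDerivAt)).fderiv
  have h2 : pd k (fun q => h (f q) (g q)) p = fderiv ℝ (fun q : ℝ × ℝ => h q.1 q.2) (f p, g p)
      (pd k f p, pd k g p) := by
    simp only [pd]
    exact congrArg (fun A : E n →L[ℝ] ℝ => A (EuclideanSpace.single k 1)) h1
  have h3 : (pd k f p, pd k g p) = pd k f p • ((1 : ℝ), (0 : ℝ)) +
      pd k g p • ((0 : ℝ), (1 : ℝ)) := by simp
  rw [h2, h3, map_add, map_smul, map_smul, ← e1, ← e2]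
  simp only [smul_eq_mul]; ring

theorem SmoothAt.differentiableAt_comp {h : ℝ → ℝ → ℝ} (hh : SmoothAt h (f p, g p))
    (hf : DifferentiableAt ℝ f p) (hg : DifferentiableAt ℝ g p) :
    DifferentiableAt ℝ (fun q => h (f q) (g q)) p :=
  (HasFDerivAt.comp (f := fun q => (f q, g q)) p hh.hasFDerivAt
    (hf.hasFDerivAt.prodMk hg.hasFDerivAt)).differentiableAt

theorem contDiffOn_pd_right {G : E n → E n → ℝ} {O : Set (E n × E n)} (hO : IsOpen O)
    (hG : ContDiffOn ℝ ∞ (fun q : E n × E n => G q.1 q.2) O) (l : Fin n) :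
    ContDiffOn ℝ ∞ (fun q : E n × E n => pd l (G q.1) q.2) O := by
  have h1 : ContDiffOn ℝ ∞ (fderiv ℝ (fun q : E n × E n => G q.1 q.2)) O :=
    hG.fderiv_of_isOpen hO (by simp)
  refine (h1.clm_apply (contDiffOn_const (c :=
      ((0 : E n), EuclideanSpace.single l (1 : ℝ))))).congr ?_
  intro q hq
  have h2 := ((hG.contDiffAt (hO.mem_nhds hq)).differentiableAt (by simp)).hasFDerivAt
  have h3 : HasFDerivAt (fun v : E n => (q.1, v)) _ q.2 :=
      (hasFDerivAt_const (𝕜 := ℝ) q.1 q.2).prodMk (hasFDerivAt_id (𝕜 := ℝ) q.2)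
  have h4 := (HasFDerivAt.comp q.2 (f := fun v : E n => (q.1, v)) h2 h3).fderiv
  exact congrArg (fun A : E n →L[ℝ] ℝ => A (EuclideanSpace.single l 1)) h4

theorem contDiffOn_pd_left {G : E n → E n → ℝ} {O : Set (E n × E n)} (hO : IsOpen O)
    (hG : ContDiffOn ℝ ∞ (fun q : E n × E n => G q.1 q.2) O) (l : Fin n) :
    ContDiffOn ℝ ∞ (fun q : E n × E n => pd l (fun x => G x q.2) q.1) O := by
  have h1 : ContDiffOn ℝ ∞ (fderiv ℝ (fun q : E n × E n => G q.1 q.2)) O :=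
    hG.fderiv_of_isOpen hO (by simp)
  refine (h1.clm_apply (contDiffOn_const (c :=
      (EuclideanSpace.single l (1 : ℝ), (0 : E n))))).congr ?_
  intro q hq
  have h2 := ((hG.contDiffAt (hO.mem_nhds hq)).differentiableAt (by simp)).hasFDerivAt
  have h3 : HasFDerivAt (fun v : E n => (v, q.2)) _ q.1 :=
      (hasFDerivAt_id (𝕜 := ℝ) q.1).prodMk (hasFDerivAt_const (𝕜 := ℝ) q.2 q.1)
  have h4 := (HasFDerivAt.comp q.1 (f := fun v : E n => (v, q.2)) h2 h3).fderiv
  exact congrArg (fun A : E n →L[ℝ] ℝ => A (EuclideanSpace.single l 1)) h4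

end Rules

section
variable {n : ℕ} {M : Type*} [TopologicalSpace M] [ChartedSpace (E n) M] [IsManifold (𝓡 n) ∞ M]
variable {a : RMetric n M} {β : OneForm n M} {e : OpenPartialHomeomorph M (E n)}

section Derivatives

theorem pd_lin_right (p y : E n) (k : Fin n) : pd k (lin β e p) y = coeffB β e k p := by
  have : lin β e p = fun v => ∑ i, coeffB β e i p * v i := rfl
  rw [this, pd_sum (fun i _ => (differentiableAt_coord i).const_mul _)]
  simp [pd_const_mul (differentiableAt_coord _), pd_coord]

theorem pd_low_right (p y : E n) (k l : Fin n) :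
    pd k (fun v => low a e p v l) y = coeffA a e p l k := by
  simp only [low]
  rw [pd_sum (fun i _ => (differentiableAt_coord i).const_mul _)]
  simp [pd_const_mul (differentiableAt_coord _), pd_coord]

theorem differentiableAt_low (p y : E n) (l : Fin n) :
    DifferentiableAt ℝ (fun v => low a e p v l) y := by
  simp only [low]
  exact DifferentiableAt.fun_sum fun i _ => (differentiableAt_coord i).const_mul _

theorem differentiableAt_lin (p y : E n) : DifferentiableAt ℝ (lin β e p) y :=
  DifferentiableAt.fun_sum fun i _ => (differentiableAt_coord i).const_mul _

theorem differentiableAt_ip (p y : E n) : DifferentiableAt ℝ (fun v => ip a e p v v) y := by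
  simp only [ip_eq_low]
  exact DifferentiableAt.fun_sum fun i _ => (differentiableAt_low p y i).mul
      (differentiableAt_coord i)

theorem pd_ip_right (p y : E n) (k : Fin n) :
    pd k (fun v => ip a e p v v) y = 2 * low a e p y k := by
  simp only [ip_eq_low]
  rw [pd_sum (fun i _ => (differentiableAt_low p y i).fun_mul (differentiableAt_coord i))]
  simp only [pd_mul (differentiableAt_low p y _) (differentiableAt_coord _), pd_low_right, pd_coord]
  rw [Finset.sum_add_distrib]
  simp only [mul_ite, mul_one, mul_zero, Finset.sum_ite_eq', Finset.mem_univ, if_true]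
  have : ∑ x, coeffA a e p x k * y.ofLp x = low a e p y k := by
    simp only [low]
    exact Finset.sum_congr rfl fun i _ => by rw [coeffA_symm]
  rw [this]; ring

variable (he : e ∈ IsManifold.maximalAtlas (𝓡 n) ∞ M) {p : E n} (hp : p ∈ e.target)
include he hp

theorem differentiableAt_coeffA (i j : Fin n) : DifferentiableAt ℝ (fun q => coeffA a e q i j) p :=
  ((contDiffOn_coeffA a he i j).contDiffAt (e.open_target.mem_nhds hp)).differentiableAt (by simp)

theorem differentiableAt_coeffB (i : Fin n) : DifferentiableAt ℝ (fun q => coeffB β e i q) p :=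
  ((contDiffOn_coeffB β he i).contDiffAt (e.open_target.mem_nhds hp)).differentiableAt (by simp)

theorem pd_lin_left (y : E n) (k : Fin n) :
    pd k (fun q => lin β e q y) p = ∑ i, pd k (coeffB β e i) p * y i := by
  have hd := differentiableAt_coeffB (β := β) he hp
  simp only [lin]
  rw [pd_sum (fun i _ => by fun_prop)]
  exact Finset.sum_congr rfl fun i _ => pd_mul_const (hd i) _ _

theorem pd_low_left (y : E n) (k l : Fin n) :
    pd k (fun q => low a e q y l) p = ∑ j, pd k (fun q => coeffA a e q l j) p * y j := by
  have hd := differentiableAt_coeffA (a := a) he hp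
  simp only [low]
  rw [pd_sum (fun i _ => by fun_prop)]
  exact Finset.sum_congr rfl fun i _ => pd_mul_const (hd _ i) _ _

theorem pd_ip_left (y : E n) (k : Fin n) :
    pd k (fun q => ip a e q y y) p =
      ∑ i, ∑ j, pd k (fun q => coeffA a e q i j) p * y i * y j := by
  have hd := differentiableAt_coeffA (a := a) he hp
  simp only [ip]
  rw [pd_sum (fun i _ => by fun_prop)]
  refine Finset.sum_congr rfl fun i _ => ?_
  rw [pd_sum (fun i _ => by fun_prop)]
  refine Finset.sum_congr rfl fun j _ => ?_
  rw [pd_mul_const (by fun_prop), pd_mul_const (by fun_prop)]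

end Derivatives
end

/-! ### Derivatives of `α² g(b², s)` -/

section
variable {n : ℕ} {M : Type*} [TopologicalSpace M] [ChartedSpace (E n) M] [IsManifold (𝓡 n) ∞ M]
variable {a : RMetric n M} {β : OneForm n M} {e : OpenPartialHomeomorph M (E n)} {φ : ℝ → ℝ → ℝ}

/-- The function `s = β / α` in coordinates. -/
def sv (a : RMetric n M) (β : OneForm n M) (e : OpenPartialHomeomorph M (E n)) (p y : E n) : ℝ :=
  lin β e p y / √(ip a e p y y)

theorem ratio_vec (p y : E n) : ratio a β (e.symm p) (vec e p y) = sv a β e p y := by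
  rw [ratio, alpha, inner_vec_eq, form_vec_eq, sv]

theorem loc_genAB (p y : E n) : loc (genAB a β φ) e p y =
    √(ip a e p y y) * φ (bsq a β (e.symm p)) (sv a β e p y) := by
  rw [loc, genAB, ratio_vec, alpha, inner_vec_eq]

theorem ip_self_nonneg (p y : E n) : 0 ≤ ip a e p y y := by
  rw [← inner_vec_eq]; exact a.inner_self_nonneg _

theorem loc_genAB_sq (p y : E n) : loc (genAB a β φ) e p y ^ 2 =
    ip a e p y y * (fun u s => φ u s ^ 2) (bsq a β (e.symm p)) (sv a β e p y) := by
  rw [loc_genAB, mul_pow, Real.sq_sqrt (ip_self_nonneg p y)]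

/-- For `L = N g(u, t / √N)` this is the derivative `∂L/∂N`, as a function of `u` and
`s = t / √N`. -/
def dN (g : ℝ → ℝ → ℝ) (u s : ℝ) : ℝ := g u s - s / 2 * d2 g u s

section
variable {g : ℝ → ℝ → ℝ} {O : Set (ℝ × ℝ)}

theorem SmoothOn.dN (hg : SmoothOn g O) (hO : IsOpen O) : SmoothOn (dN g) O :=
  hg.sub ((contDiffOn_snd.div_const 2).mul (hg.d2 hO))

theorem d1_dN (hg : SmoothOn g O) (hO : IsOpen O) {u s : ℝ} (h : (u, s) ∈ O) :
    d1 (GenAB.dN g) u s = d1 g u s - s / 2 * d1 (d2 g) u s :=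
  ((hg.smoothAt hO h).hasDerivAt_left.sub
    ((((hg.d2 hO).smoothAt hO h).hasDerivAt_left).const_mul (s / 2))).deriv

theorem d2_dN (hg : SmoothOn g O) (hO : IsOpen O) {u s : ℝ} (h : (u, s) ∈ O) :
    d2 (GenAB.dN g) u s = (d2 g u s - s * d2 (d2 g) u s) / 2 := by
  have h1 := ((hg.smoothAt hO h).hasDerivAt_right.sub
    ((((hasDerivAt_id s).div_const 2)).mul (((hg.d2 hO).smoothAt hO h).hasDerivAt_right))).deriv
  refine h1.trans ?_
  simp; ring
end

variable (he : e ∈ IsManifold.maximalAtlas (𝓡 n) ∞ M) {p : E n} (hp : p ∈ e.target) {y : E n}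
  {O : Set (ℝ × ℝ)} (hO : IsOpen O)
include he hp

theorem differentiableAt_bsq : DifferentiableAt ℝ (fun q => bsq a β (e.symm q)) p :=
  ((contDiffOn_bsq he).contDiffAt (e.open_target.mem_nhds hp)).differentiableAt (by simp)

theorem differentiableAt_lin_left : DifferentiableAt ℝ (fun q => lin β e q y) p :=
  DifferentiableAt.fun_sum fun i _ => (differentiableAt_coeffB he hp i).mul_const _

theorem differentiableAt_low_left (l : Fin n) : DifferentiableAt ℝ (fun q => low a e q y l) p :=
  DifferentiableAt.fun_sum fun i _ => (differentiableAt_coeffA he hp l i).mul_const _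

theorem differentiableAt_ip_left : DifferentiableAt ℝ (fun q => ip a e q y y) p :=
  DifferentiableAt.fun_sum fun i _ => DifferentiableAt.fun_sum fun j _ =>
    ((differentiableAt_coeffA he hp i j).mul_const _).mul_const _

variable (hy : y ≠ 0)
include hy

theorem differentiableAt_sv_right : DifferentiableAt ℝ (fun v => sv a β e p v) y := by
  have h0 := ip_self_pos (a := a) he hp hy
  simp only [sv, div_eq_mul_inv]
  exact (differentiableAt_lin p y).mul (((differentiableAt_ip p y).sqrt h0.ne').inv
      (Real.sqrt_pos.2 h0).ne')

theorem differentiableAt_sv_left : DifferentiableAt ℝ (fun q => sv a β e q y) p := by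
  have h0 := ip_self_pos (a := a) he hp hy
  simp only [sv, div_eq_mul_inv]
  exact (differentiableAt_lin_left he hp).mul
    (((differentiableAt_ip_left he hp).sqrt h0.ne').inv (Real.sqrt_pos.2 h0).ne')

theorem pd_sv_right (k : Fin n) : pd k (fun v => sv a β e p v) y =
    coeffB β e k p / √(ip a e p y y) - sv a β e p y * low a e p y k / ip a e p y y := by
  have h0 := ip_self_pos (a := a) he hp hy
  have h := pd_div_sqrt (differentiableAt_lin (β := β) (e := e) p y)
      (differentiableAt_ip (a := a) p y) h0 k
  rw [pd_lin_right, pd_ip_right] at h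
  simp only [sv]; rw [h]
  field_simp

theorem pd_sv_left (k : Fin n) : pd k (fun q => sv a β e q y) p =
    pd k (fun q => lin β e q y) p / √(ip a e p y y)
      - sv a β e p y * pd k (fun q => ip a e q y y) p / (2 * ip a e p y y) := by
  have h0 := ip_self_pos (a := a) he hp hy
  exact pd_div_sqrt (differentiableAt_lin_left he hp) (differentiableAt_ip_left he hp) h0 k

include hO
variable (hmem : (bsq a β (e.symm p), sv a β e p y) ∈ O)
include hmem

theorem eventually_mem_right : ∀ᶠ v in nhds y, v ≠ 0 ∧ (bsq a β (e.symm p), sv a β e p v) ∈ O := by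
  have h1 : ContinuousAt (fun v => (bsq a β (e.symm p), sv a β e p v)) y :=
    continuousAt_const.prodMk (differentiableAt_sv_right he hp hy).continuousAt
  exact Filter.Eventually.and (isOpen_ne.mem_nhds hy) (h1.eventually (hO.mem_nhds hmem))

theorem eventually_mem_left : ∀ᶠ q in nhds p,
    q ∈ e.target ∧ (bsq a β (e.symm q), sv a β e q y) ∈ O := by
  have h1 : ContinuousAt (fun q => (bsq a β (e.symm q), sv a β e q y)) p :=
    (differentiableAt_bsq he hp).continuousAt.prodMk
        (differentiableAt_sv_left he hp hy).continuousAt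
  exact Filter.Eventually.and (e.open_target.mem_nhds hp) (h1.eventually (hO.mem_nhds hmem))

variable {g : ℝ → ℝ → ℝ} (hg : SmoothOn g O)
include hg

/-- The first derivatives of `L = N g(u, t / √N)` in the direction of the fibre. -/
theorem pd_lagr_right (l : Fin n) :
    pd l (fun v => ip a e p v v * g (bsq a β (e.symm p)) (sv a β e p v)) y =
      dN g (bsq a β (e.symm p)) (sv a β e p y) * (2 * low a e p y l) +
      √(ip a e p y y) * d2 g (bsq a β (e.symm p)) (sv a β e p y) * coeffB β e l p := by
  have h0 := ip_self_pos (a := a) he hp hy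
  have hs := differentiableAt_sv_right (β := β) (a := a) he hp hy
  have hG := hg.smoothAt hO hmem
  rw [pd_mul (differentiableAt_ip p y) (hG.differentiableAt_comp (f := fun _ => bsq a β (e.symm p))
      (by fun_prop) hs),
    pd_comp₂ (f := fun _ => bsq a β (e.symm p)) hG (by fun_prop) hs, pd_const, pd_ip_right,
        pd_sv_right he hp hy]
  have h2 : ip a e p y y = √(ip a e p y y) ^ 2 := (Real.sq_sqrt h0.le).symm
  have hr := Real.sqrt_pos.2 h0
  generalize √(ip a e p y y) = r at *
  rw [h2, dN]
  field_simp
  ring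

/-- The first derivatives of `L = N g(u, t / √N)` in the direction of the base. -/
theorem pd_lagr_left (l : Fin n) :
    pd l (fun q => ip a e q y y * g (bsq a β (e.symm q)) (sv a β e q y)) p =
      dN g (bsq a β (e.symm p)) (sv a β e p y) * pd l (fun q => ip a e q y y) p +
      √(ip a e p y y) * d2 g (bsq a β (e.symm p)) (sv a β e p y) * pd l (fun q => lin β e q y) p +
      ip a e p y y * d1 g (bsq a β (e.symm p)) (sv a β e p y) *
          pd l (fun q => bsq a β (e.symm q)) p := by
  have h0 := ip_self_pos (a := a) he hp hy
  have hs := differentiableAt_sv_left (β := β) (a := a) he hp hy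
  have hG := hg.smoothAt hO hmem
  rw [pd_mul (differentiableAt_ip_left he hp)
      (hG.differentiableAt_comp (differentiableAt_bsq he hp) hs),
    pd_comp₂ hG (differentiableAt_bsq he hp) hs, pd_sv_left he hp hy]
  have h2 : ip a e p y y = √(ip a e p y y) ^ 2 := (Real.sq_sqrt h0.le).symm
  have hr := Real.sqrt_pos.2 h0
  generalize √(ip a e p y y) = r at *
  rw [h2, dN]
  field_simp
  ring

theorem pd_pd_lagr_right (i j : Fin n) :
    pd j (pd i (fun v => ip a e p v v * g (bsq a β (e.symm p)) (sv a β e p v))) y =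
      d2 (dN g) (bsq a β (e.symm p)) (sv a β e p y) * (coeffB β e j p / √(ip a e p y y)
        - sv a β e p y * low a e p y j / ip a e p y y) * (2 * low a e p y i) +
      dN g (bsq a β (e.symm p)) (sv a β e p y) * (2 * coeffA a e p i j) +
      (low a e p y j / √(ip a e p y y) * d2 g (bsq a β (e.symm p)) (sv a β e p y) +
        √(ip a e p y y) * (d2 (d2 g) (bsq a β (e.symm p)) (sv a β e p y) *
        (coeffB β e j p / √(ip a e p y y) - sv a β e p y * low a e p y j / ip a e p y y))) *
            coeffB β e i p := by
  have h0 := ip_self_pos (a := a) he hp hy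
  have hr := Real.sqrt_pos.2 h0
  have hs := differentiableAt_sv_right (β := β) (a := a) he hp hy
  have hG1 := (hg.dN hO).smoothAt hO hmem
  have hG2 := (hg.d2 hO).smoothAt hO hmem
  have hev : pd i (fun v => ip a e p v v * g (bsq a β (e.symm p)) (sv a β e p v)) =ᶠ[nhds y]
      fun v => dN g (bsq a β (e.symm p)) (sv a β e p v) * (2 * low a e p v i) +
      √(ip a e p v v) * d2 g (bsq a β (e.symm p)) (sv a β e p v) * coeffB β e i p := by
    filter_upwards [eventually_mem_right he hp hO hy hmem] with v hv
    exact pd_lagr_right he hp hO hv.1 hv.2 hg i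
  have hd1 := hG1.differentiableAt_comp (f := fun _ => bsq a β (e.symm p)) (p := y) (by fun_prop) hs
  have hd2 := hG2.differentiableAt_comp (f := fun _ => bsq a β (e.symm p)) (p := y) (by fun_prop) hs
  have hl := differentiableAt_low (a := a) (e := e) p y i
  have hq := (differentiableAt_ip (a := a) (e := e) p y).sqrt h0.ne'
  rw [pd_congr hev, pd_add (hd1.fun_mul (hl.const_mul 2)) ((hq.fun_mul hd2).mul_const _),
    pd_mul hd1 (hl.const_mul 2), pd_mul_const (hq.fun_mul hd2), pd_mul hq hd2, pd_const_mul hl,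
    pd_comp₂ (f := fun _ => bsq a β (e.symm p)) hG1 (by fun_prop) hs,
    pd_comp₂ (f := fun _ => bsq a β (e.symm p)) hG2 (by fun_prop) hs,
    pd_const, pd_sqrt (differentiableAt_ip p y) h0, pd_ip_right, pd_sv_right he hp hy, pd_low_right]
  field_simp
  ring

/-- The mixed derivatives `∂²L / ∂xᵏ∂yˡ`, obtained from the formula for `∂L / ∂yˡ`. -/
theorem pd_left_pd_right_lagr (k l : Fin n) :
    pd k (fun q => pd l (fun v => ip a e q v v * g (bsq a β (e.symm q)) (sv a β e q v)) y) p =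
      (d1 (dN g) (bsq a β (e.symm p)) (sv a β e p y) * pd k (fun q => bsq a β (e.symm q)) p +
       d2 (dN g) (bsq a β (e.symm p)) (sv a β e p y) *
           (pd k (fun q => lin β e q y) p / √(ip a e p y y)
      - sv a β e p y * pd k (fun q => ip a e q y y) p / (2 * ip a e p y y))) * (2 * low a e p y l) +
      dN g (bsq a β (e.symm p)) (sv a β e p y) * (2 * pd k (fun q => low a e q y l) p) +
      (pd k (fun q => ip a e q y y) p / (2 * √(ip a e p y y)) *
          d2 g (bsq a β (e.symm p)) (sv a β e p y) +
        √(ip a e p y y) * (d1 (d2 g) (bsq a β (e.symm p)) (sv a β e p y) *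
            pd k (fun q => bsq a β (e.symm q)) p +
        d2 (d2 g) (bsq a β (e.symm p)) (sv a β e p y) *
            (pd k (fun q => lin β e q y) p / √(ip a e p y y)
      - sv a β e p y * pd k (fun q => ip a e q y y) p / (2 * ip a e p y y)))) * coeffB β e l p +
      √(ip a e p y y) * d2 g (bsq a β (e.symm p)) (sv a β e p y) * pd k (coeffB β e l) p := by
  have h0 := ip_self_pos (a := a) he hp hy
  have hr := Real.sqrt_pos.2 h0
  have hs := differentiableAt_sv_left (β := β) (a := a) he hp hy
  have hu := differentiableAt_bsq (β := β) (a := a) he hp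
  have hG1 := (hg.dN hO).smoothAt hO hmem
  have hG2 := (hg.d2 hO).smoothAt hO hmem
  have hev : (fun q => pd l (fun v => ip a e q v v * g (bsq a β (e.symm q)) (sv a β e q v)) y)
      =ᶠ[nhds p]
      fun q => dN g (bsq a β (e.symm q)) (sv a β e q y) * (2 * low a e q y l) +
      √(ip a e q y y) * d2 g (bsq a β (e.symm q)) (sv a β e q y) * coeffB β e l q := by
    filter_upwards [eventually_mem_left he hp hO hy hmem] with v hv
    exact pd_lagr_right he hv.1 hO hy hv.2 hg l
  have hd1 := hG1.differentiableAt_comp hu hs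
  have hd2 := hG2.differentiableAt_comp hu hs
  have hl := differentiableAt_low_left (a := a) he hp (y := y) l
  have hb := differentiableAt_coeffB (β := β) he hp l
  have hN := differentiableAt_ip_left (a := a) he hp (y := y)
  have hq := hN.sqrt h0.ne'
  rw [pd_congr hev, pd_add (hd1.fun_mul (hl.const_mul 2)) ((hq.fun_mul hd2).fun_mul hb),
    pd_mul hd1 (hl.const_mul 2), pd_mul (hq.fun_mul hd2) hb, pd_mul hq hd2, pd_const_mul hl,
    pd_comp₂ hG1 hu hs, pd_comp₂ hG2 hu hs, pd_sqrt hN h0, pd_sv_left he hp hy]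
  ring

end

/-! ### Geodesic coefficients -/

section
variable {n : ℕ} {M : Type*} [TopologicalSpace M] [ChartedSpace (E n) M] [IsManifold (𝓡 n) ∞ M]
variable (a : RMetric n M) (β : OneForm n M) (e : OpenPartialHomeomorph M (E n)) {φ : ℝ → ℝ → ℝ}

/-- The geodesic coefficients of `α` with lowered index. -/
def alphaSprayLow (p y : E n) (l : Fin n) : ℝ :=
  (1 / 4) * ∑ i, ∑ j, (2 * pd i (fun q => coeffA a e q l j) p - pd l (fun q => coeffA a e q i j) p)
    * y i * y j

/-- The geodesic coefficients of `α`. -/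
def alphaSpray (p y : E n) (m : Fin n) : ℝ := ∑ l, (coeffA a e p)⁻¹ m l * alphaSprayLow a e p y l

variable {a β e}
variable (he : e ∈ IsManifold.maximalAtlas (𝓡 n) ∞ M) {p : E n} (hp : p ∈ e.target) (y : E n)
include he hp

theorem sum_coeffA_alphaSpray (l : Fin n) :
    ∑ m, coeffA a e p l m * alphaSpray a e p y m = alphaSprayLow a e p y l := by
  have h : (coeffA a e p).mulVec ((coeffA a e p)⁻¹.mulVec (alphaSprayLow a e p y))
      = alphaSprayLow a e p y := by
    rw [Matrix.mulVec_mulVec, Matrix.mul_nonsing_inv _ (coeffA_det_ne he hp).isUnit,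
        Matrix.one_mulVec]
  exact congrFun h l

theorem sum_mul_alphaSpray {v w : E n} (hw : ∀ i, low a e p v i = w i) :
    ∑ m, w m * alphaSpray a e p y m = ∑ l, v l * alphaSprayLow a e p y l := by
  simp only [← sum_coeffA_alphaSpray he hp, ← hw, low, Finset.mul_sum, Finset.sum_mul]
  rw [Finset.sum_comm]
  refine Finset.sum_congr rfl fun i _ => Finset.sum_congr rfl fun j _ => ?_
  rw [coeffA_symm]; ring

theorem alphaSprayLow_eq (l : Fin n) : alphaSprayLow a e p y l =
    (1 / 4) * (2 * (∑ k, pd k (fun q => low a e q y l) p * y k) -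
        pd l (fun q => ip a e q y y) p) := by
  simp only [pd_low_left he hp, pd_ip_left he hp, alphaSprayLow, Finset.sum_mul, Finset.mul_sum,
    ← Finset.sum_sub_distrib]
  refine Finset.sum_congr rfl fun i _ => Finset.sum_congr rfl fun j _ => ?_
  ring

theorem sum_alphaSprayLow : ∑ l, y l * alphaSprayLow a e p y l =
    (1 / 4) * ∑ k, pd k (fun q => ip a e q y y) p * y k := by
  have h1 : ∑ l, y l * (∑ k, pd k (fun q => low a e q y l) p * y k)
      = ∑ k, pd k (fun q => ip a e q y y) p * y k := by
    simp only [pd_low_left he hp, pd_ip_left he hp, Finset.sum_mul, Finset.mul_sum]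
    rw [Finset.sum_comm]
    refine Finset.sum_congr rfl fun i _ => Finset.sum_congr rfl fun j _ =>
        Finset.sum_congr rfl fun k _ => ?_
    ring
  have h2 : ∀ l, y l * alphaSprayLow a e p y l
      = (1 / 2) * (y l * (∑ k, pd k (fun q => low a e q y l) p * y k))
      - (1 / 4) * (pd l (fun q => ip a e q y y) p * y l) := by
    intro l; rw [alphaSprayLow_eq he hp]; ring
  simp only [h2, Finset.sum_sub_distrib, ← Finset.mul_sum]
  rw [h1]; ring

variable {c : M → ℝ} (hβ : IsClosedConformal a β c)
include hβ

/-- The geodesic coefficients of `α` contracted with `β`: the equation `b_{i|j} = c a_ij` turns the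
Christoffel symbols into derivatives of `β`. -/
theorem sum_coeffB_alphaSpray : ∑ m, coeffB β e m p * alphaSpray a e p y m =
    (1 / 2) * ((∑ k, pd k (fun q => lin β e q y) p * y k) - c (e.symm p) * ip a e p y y) := by
  rw [sum_mul_alphaSpray he hp y (w := WithLp.toLp 2 fun m => coeffB β e m p)
      (low_sharp (β := β) he hp)]
  have h1 : ∑ k, pd k (fun q => lin β e q y) p * y k = c (e.symm p) * ip a e p y y +
      (1 / 2) * ∑ l, ∑ k, ∑ i, sharp a β e p l *
      (pd i (fun q => coeffA a e q k l) p + pd k (fun q => coeffA a e q i l) p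
        - pd l (fun q => coeffA a e q i k) p) * y i * y k := by
    have h0 : ∑ l, ∑ k, ∑ i, sharp a β e p l *
      (pd i (fun q => coeffA a e q k l) p + pd k (fun q => coeffA a e q i l) p
        - pd l (fun q => coeffA a e q i k) p) * y i * y k = ∑ k, ∑ i, ∑ l, sharp a β e p l *
      (pd i (fun q => coeffA a e q k l) p + pd k (fun q => coeffA a e q i l) p
        - pd l (fun q => coeffA a e q i k) p) * y i * y k := by
      rw [Finset.sum_comm]
      exact Finset.sum_congr rfl fun k _ => Finset.sum_comm
    rw [h0, ip_comm]
    simp only [pd_lin_left he hp, pd_coeffB he hp hβ, ip, Finset.sum_mul, Finset.mul_sum, add_mul,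
      Finset.sum_add_distrib]
    congr 1
    · refine Finset.sum_congr rfl fun i _ => Finset.sum_congr rfl fun j _ => ?_
      rw [coeffA_symm]; ring
    · refine Finset.sum_congr rfl fun i _ => Finset.sum_congr rfl fun j _ =>
        Finset.sum_congr rfl fun k _ => ?_
      ring
  rw [h1]
  have h2 : ∀ l, ∑ k, ∑ i, sharp a β e p l *
      (pd i (fun q => coeffA a e q k l) p + pd k (fun q => coeffA a e q i l) p
        - pd l (fun q => coeffA a e q i k) p) * y i * y k
            = 4 * (sharp a β e p l * alphaSprayLow a e p y l) := by
    intro l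
    have hs : ∀ i j, (fun q => coeffA a e q i j) = fun q => coeffA a e q j i := fun i j => by
      funext q; exact coeffA_symm q i j
    have h3 : ∑ k, ∑ i, pd i (fun q => coeffA a e q k l) p * y i * y k =
       ∑ i, ∑ j, pd i (fun q => coeffA a e q l j) p * y i * y j := by
      rw [Finset.sum_comm]; simp only [hs _ l]
    have h4 : ∑ k, ∑ i, pd k (fun q => coeffA a e q i l) p * y i * y k =
       ∑ i, ∑ j, pd i (fun q => coeffA a e q l j) p * y i * y j := by
      simp only [hs _ l]
      refine Finset.sum_congr rfl fun i _ => Finset.sum_congr rfl fun j _ => ?_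
      ring
    have h5 : ∑ k, ∑ i, pd l (fun q => coeffA a e q i k) p * y i * y k =
       ∑ i, ∑ j, pd l (fun q => coeffA a e q i j) p * y i * y j := Finset.sum_comm
    have h6 : 4 * (sharp a β e p l * alphaSprayLow a e p y l)
        = sharp a β e p l * (2 * ∑ i, ∑ j, pd i (fun q => coeffA a e q l j) p * y i * y j - ∑ i,
            ∑ j, pd l (fun q => coeffA a e q i j) p * y i * y j) := by
      simp only [alphaSprayLow, Finset.mul_sum, ← Finset.sum_sub_distrib]
      refine Finset.sum_congr rfl fun i _ => Finset.sum_congr rfl fun j _ => ?_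
      ring
    rw [h6, two_mul]
    nth_rw 1 [← h3]
    rw [← h4, ← h5]
    simp only [Finset.mul_sum, ← Finset.sum_sub_distrib, ← Finset.sum_add_distrib]
    refine Finset.sum_congr rfl fun i _ => Finset.sum_congr rfl fun j _ => ?_
    ring
  simp only [h2]
  rw [← Finset.mul_sum]; ring

theorem sum_pd_coeffB (l : Fin n) : ∑ k, pd k (coeffB β e l) p * y k
    = pd l (fun q => lin β e q y) p := by
  rw [pd_lin_left he hp]
  exact Finset.sum_congr rfl fun k _ => by rw [pd_coeffB_symm he hp hβ]

theorem sum_pd_bsq : ∑ k, pd k (fun q => bsq a β (e.symm q)) p * y k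
    = 2 * c (e.symm p) * lin β e p y := by
  simp only [pd_bsq he hp hβ, lin, Finset.mul_sum]
  exact Finset.sum_congr rfl fun k _ => by ring

omit hβ hp he in
theorem fund_genAB (i j : Fin n) : fund (genAB a β φ) e p y i j =
    (1 / 2) * pd j (pd i (fun v => ip a e p v v *
        (fun u s => φ u s ^ 2) (bsq a β (e.symm p)) (sv a β e p v))) y := by
  simp only [fund, Matrix.of_apply, loc_genAB_sq]

variable {O : Set (ℝ × ℝ)} (hO : IsOpen O) (hφ : SmoothOn φ O) (hy : y ≠ 0)
  (hmem : (bsq a β (e.symm p), sv a β e p y) ∈ O)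
include hO hφ hy hmem

omit hβ in
/-- The fundamental tensor applied to a vector. -/
theorem fund_mulVec (v : Fin n → ℝ) (i : Fin n) :
    ((fund (genAB a β φ) e p y).mulVec v) i =
      d2 (dN fun u s => φ u s ^ 2) (bsq a β (e.symm p)) (sv a β e p y) *
        ((∑ j, coeffB β e j p * v j) / √(ip a e p y y)
        - sv a β e p y * (∑ j, low a e p y j * v j) / ip a e p y y) * low a e p y i +
      dN (fun u s => φ u s ^ 2) (bsq a β (e.symm p)) (sv a β e p y) * ∑ j, coeffA a e p i j * v j +
      (1 / 2) * ((∑ j, low a e p y j * v j) / √(ip a e p y y) *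
          d2 (fun u s => φ u s ^ 2) (bsq a β (e.symm p)) (sv a β e p y) +
        √(ip a e p y y) * (d2 (d2 fun u s => φ u s ^ 2) (bsq a β (e.symm p)) (sv a β e p y) *
        ((∑ j, coeffB β e j p * v j) / √(ip a e p y y)
          - sv a β e p y * (∑ j, low a e p y j * v j) / ip a e p y y))) * coeffB β e i p := by
  have hg : SmoothOn (fun u s => φ u s ^ 2) O := hφ.pow 2
  simp only [Matrix.mulVec, dotProduct, fund_genAB]
  have h := pd_pd_lagr_right he hp hO hy hmem hg i
  simp only [h]
  generalize d2 (dN fun u s => φ u s ^ 2) (bsq a β (e.symm p)) (sv a β e p y) = k1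
  generalize dN (fun u s => φ u s ^ 2) (bsq a β (e.symm p)) (sv a β e p y) = k2
  generalize d2 (fun u s => φ u s ^ 2) (bsq a β (e.symm p)) (sv a β e p y) = k3
  generalize d2 (d2 fun u s => φ u s ^ 2) (bsq a β (e.symm p)) (sv a β e p y) = k4
  generalize √(ip a e p y y) = r
  simp only [div_eq_mul_inv, Finset.mul_sum, Finset.sum_mul, ← Finset.sum_sub_distrib,
      ← Finset.sum_add_distrib]
  refine Finset.sum_congr rfl fun j _ => ?_
  ring

/-- The geodesic coefficients of a general `(α, β)`-metric with `b_{i|j} = c a_ij`. The two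
hypotheses on `P` and `R` are the coefficients of `y_i` and `b_i` in the Euler-Lagrange equation. -/
theorem spray_eq {g : ℝ → ℝ → ℝ} (hg : g = fun u s => φ u s ^ 2) {u s : ℝ}
    (hu : u = bsq a β (e.symm p)) (hs : s = sv a β e p y)
    (hdet : (fund (genAB a β φ) e p y).det ≠ 0) {P R : ℝ}
    (hY : 2 * s * d1 g u s - s ^ 2 * d1 (d2 g) u s + (d2 g u s - s * d2 (d2 g) u s) / 2 =
      P * (2 * g u s - s * d2 g u s) + 2 * R * (u - s ^ 2) * ((d2 g u s - s * d2 (d2 g) u s) / 2))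
    (hB : 2 * s * d1 (d2 g) u s + d2 (d2 g) u s - 2 * d1 g u s =
      2 * P * d2 g u s + 2 * R * (2 * g u s + (u - s ^ 2) * d2 (d2 g) u s)) (i : Fin n) :
    spray (genAB a β φ) e i p y = alphaSpray a e p y i +
      c (e.symm p) * √(ip a e p y y) * P * y i + c (e.symm p) * ip a e p y y * R *
          sharp a β e p i := by
  have hgs : SmoothOn g O := by rw [hg]; exact hφ.pow 2
  have hmem' : (u, s) ∈ O := by rw [hu, hs]; exact hmem
  -- The Euler-Lagrange equation is a linear system for the geodesic coefficients, with matrix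
  -- `fund`; the claimed `G` solves it.
  set G : Fin n → ℝ := fun i => alphaSpray a e p y i +
      c (e.symm p) * √(ip a e p y y) * P * y i + c (e.symm p) * ip a e p y y * R *
          sharp a β e p i with hG
  set rhs : Fin n → ℝ := fun l => (∑ k, pd k (fun q =>
      pd l (fun v => loc (genAB a β φ) e q v ^ 2) y) p * y k)
      - pd l (fun q => loc (genAB a β φ) e q y ^ 2) p with hrhs
  have h0 := ip_self_pos (a := a) he hp hy
  have hr := Real.sqrt_pos.2 h0
  have key : (fund (genAB a β φ) e p y).mulVec G = (1 / 4 : ℝ) • rhs := by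
    funext l
    rw [fund_mulVec he hp y hO hφ hy hmem, ← hg, ← hu, ← hs, Pi.smul_apply, smul_eq_mul]
    have s0 : ∀ z : Fin n → ℝ, ∑ j, z j * G j = ∑ j, z j * alphaSpray a e p y j
        + c (e.symm p) * √(ip a e p y y) * P * ∑ j, z j * y j
        + c (e.symm p) * ip a e p y y * R * ∑ j, z j * sharp a β e p j := by
      intro z
      simp only [hG]
      generalize c (e.symm p) * √(ip a e p y y) * P = k1
      generalize c (e.symm p) * ip a e p y y * R = k2
      simp only [Finset.mul_sum, ← Finset.sum_add_distrib]
      refine Finset.sum_congr rfl fun j _ => ?_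
      ring
    have s1 : ∑ j, coeffB β e j p * sharp a β e p j = u := by rw [hu, bsq_eq_lin he hp, lin]
    have s2 : ∑ j, low a e p y j * sharp a β e p j = lin β e p y := by
      rw [← ip_eq_low, ip_comm, ip_sharp he hp]
    have s3 : ∑ j, coeffA a e p l j * sharp a β e p j = coeffB β e l p := low_sharp he hp l
    have s4 : ∑ j, low a e p y j * alphaSpray a e p y j =
        (1 / 4) * ∑ k, pd k (fun q => ip a e q y y) p * y k := by
      rw [← sum_alphaSprayLow he hp y,
        ← sum_mul_alphaSpray he hp y (v := y) (w := WithLp.toLp 2 (low a e p y)) (fun i => rfl)]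
    rw [s0, s0, s0, s1, s2, s3, s4, sum_coeffB_alphaSpray he hp y hβ, sum_coeffA_alphaSpray he hp y,
      ← ip_eq_low, show ∑ j, coeffB β e j p * y j = lin β e p y from rfl,
      show ∑ j, coeffA a e p l j * y j = low a e p y l from rfl, alphaSprayLow_eq he hp]
    have hloc : ∀ q v, loc (genAB a β φ) e q v ^ 2
        = ip a e q v v * g (bsq a β (e.symm q)) (sv a β e q v) := by
      intro q v; rw [loc_genAB_sq, hg]
    simp only [hrhs, hloc]
    simp only [pd_left_pd_right_lagr he hp hO hy hmem hgs, pd_lagr_left he hp hO hy hmem hgs, ← hu,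
        ← hs]
    rw [d1_dN hgs hO hmem', d2_dN hgs hO hmem', ← sum_pd_coeffB he hp y hβ l, pd_bsq he hp hβ]
    have e1 := sum_pd_bsq he hp y hβ
    rw [dN] at *
    generalize d1 (d2 g) u s = gus at *
    generalize d2 (d2 g) u s = gss at *
    generalize d2 g u s = gs at *
    generalize d1 g u s = gu at *
    generalize g u s = g0 at *
    have ht : lin β e p y = s * √(ip a e p y y) := by
      rw [hs, sv]; field_simp
    rw [ht] at e1 ⊢
    clear ht
    have hN : ip a e p y y = √(ip a e p y y) ^ 2 := (Real.sq_sqrt h0.le).symm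
    generalize √(ip a e p y y) = r at *
    rw [hN]
    have expand : ∀ k, (((gu - s / 2 * gus) * pd k (fun q => bsq a β (e.symm q)) p +
       (gs - s * gss) / 2 * (pd k (fun q => lin β e q y) p / r
      - s * pd k (fun q => ip a e q y y) p / (2 * r ^ 2))) * (2 * low a e p y l) +
      (g0 - s / 2 * gs) * (2 * pd k (fun q => low a e q y l) p) +
      (pd k (fun q => ip a e q y y) p / (2 * r) * gs +
        r * (gus * pd k (fun q => bsq a β (e.symm q)) p +
        gss * (pd k (fun q => lin β e q y) p / r
      - s * pd k (fun q => ip a e q y y) p / (2 * r ^ 2)))) * coeffB β e l p +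
      r * gs * pd k (coeffB β e l) p) * y k =
      ((gu - s / 2 * gus) * (2 * low a e p y l) + r * gus * coeffB β e l p) *
        (pd k (fun q => bsq a β (e.symm q)) p * y k) +
      ((gs - s * gss) / 2 / r * (2 * low a e p y l) + r * gss / r * coeffB β e l p) *
        (pd k (fun q => lin β e q y) p * y k) +
      (-((gs - s * gss) / 2 * s / (2 * r ^ 2) * (2 * low a e p y l)) + (gs / (2 * r) -
        r * gss * s / (2 * r ^ 2)) * coeffB β e l p) * (pd k (fun q => ip a e q y y) p * y k) +
      (g0 - s / 2 * gs) * 2 * (pd k (fun q => low a e q y l) p * y k) +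
      r * gs * (pd k (coeffB β e l) p * y k) := by
      intro k; ring
    simp only [expand, Finset.sum_add_distrib, ← Finset.mul_sum]
    rw [e1]
    generalize ∑ k, pd k (fun q => lin β e q y) p * y k = t2
    generalize ∑ k, pd k (fun q => ip a e q y y) p * y k = N3
    generalize ∑ k, pd k (fun q => low a e q y l) p * y k = Xl
    generalize ∑ k, pd k (coeffB β e l) p * y k = bl
    generalize pd l (fun q => ip a e q y y) p = Nl
    field_simp
    linear_combination (-8 * c (e.symm p) * r ^ 3 * low a e p y l) * hY
      - (4 * c (e.symm p) * r ^ 4 * coeffB β e l p) * hB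
  have h5 := congrArg (fun v => (fund (genAB a β φ) e p y)⁻¹.mulVec v) key
  simp only [Matrix.mulVec_mulVec] at h5
  rw [Matrix.nonsing_inv_mul _ hdet.isUnit, Matrix.one_mulVec, Matrix.mulVec_smul] at h5
  have h6 := congrFun h5 i
  rw [show alphaSpray a e p y i + c (e.symm p) * √(ip a e p y y) * P * y i + c (e.symm p) *
      ip a e p y y * R * sharp a β e p i = G i from rfl, h6]
  rfl

end

/-! ### Strong convexity and the coefficients `P` and `R` -/

section Square
variable {φ : ℝ → ℝ → ℝ} {O : Set (ℝ × ℝ)} {u s : ℝ}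

theorem d1_sq (hO : IsOpen O) (hφ : SmoothOn φ O) (h : (u, s) ∈ O) :
    d1 (fun u s => φ u s ^ 2) u s = 2 * φ u s * d1 φ u s := by
  have h1 := ((hφ.smoothAt hO h).hasDerivAt_left.pow 2).deriv
  refine h1.trans ?_
  simp

theorem d2_sq (hO : IsOpen O) (hφ : SmoothOn φ O) (h : (u, s) ∈ O) :
    d2 (fun u s => φ u s ^ 2) u s = 2 * φ u s * d2 φ u s := by
  have h1 := ((hφ.smoothAt hO h).hasDerivAt_right.pow 2).deriv
  refine h1.trans ?_
  simp

theorem d2_congr {f g : ℝ → ℝ → ℝ} (hO : IsOpen O) (hfg : ∀ q ∈ O, f q.1 q.2 = g q.1 q.2)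
    (h : (u, s) ∈ O) : d2 f u s = d2 g u s := by
  refine Filter.EventuallyEq.deriv_eq ?_
  have hc : Continuous fun r : ℝ => (u, r) := by fun_prop
  filter_upwards [(hO.preimage hc).mem_nhds h] with r hr using hfg _ hr

theorem d1_congr {f g : ℝ → ℝ → ℝ} (hO : IsOpen O) (hfg : ∀ q ∈ O, f q.1 q.2 = g q.1 q.2)
    (h : (u, s) ∈ O) : d1 f u s = d1 g u s := by
  refine Filter.EventuallyEq.deriv_eq ?_
  have hc : Continuous fun r : ℝ => (r, s) := by fun_prop
  filter_upwards [(hO.preimage hc).mem_nhds h] with r hr using hfg _ hr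

theorem d2_d2_sq (hO : IsOpen O) (hφ : SmoothOn φ O) (h : (u, s) ∈ O) :
    d2 (d2 fun u s => φ u s ^ 2) u s = 2 * d2 φ u s ^ 2 + 2 * φ u s * d2 (d2 φ) u s := by
  rw [d2_congr (g := fun u s => 2 * φ u s * d2 φ u s) hO (fun q hq => d2_sq hO hφ hq) h]
  have h1 := ((((hφ.smoothAt hO h).hasDerivAt_right.const_mul 2)).mul
    ((hφ.d2 hO).smoothAt hO h).hasDerivAt_right).deriv
  refine h1.trans ?_
  ring

theorem d1_d2_sq (hO : IsOpen O) (hφ : SmoothOn φ O) (h : (u, s) ∈ O) :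
    d1 (d2 fun u s => φ u s ^ 2) u s = 2 * d1 φ u s * d2 φ u s + 2 * φ u s * d1 (d2 φ) u s := by
  rw [d1_congr (g := fun u s => 2 * φ u s * d2 φ u s) hO (fun q hq => d2_sq hO hφ hq) h]
  have h1 := ((((hφ.smoothAt hO h).hasDerivAt_left.const_mul 2)).mul
    ((hφ.d2 hO).smoothAt hO h).hasDerivAt_left).deriv
  refine h1.trans ?_
  ring

end Square

/-- The quantity `φ - s φ_s + (u - s²) φ_ss`, whose positivity is strong convexity of `F` in the
plane spanned by `y` and the dual of `β`. -/
def cvx (φ : ℝ → ℝ → ℝ) (u s : ℝ) : ℝ := φ u s - s * d2 φ u s + (u - s ^ 2) * d2 (d2 φ) u s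

/-- The geodesic coefficients of `F` are `Gᵢ(α) + c α P yⁱ + c α² R bⁱ`; this is `R`. -/
def Rf (φ : ℝ → ℝ → ℝ) (u s : ℝ) : ℝ :=
  (d2 (d2 φ) u s - 2 * d1 φ u s + 2 * s * d1 (d2 φ) u s) / (2 * cvx φ u s)

/-- The geodesic coefficients of `F` are `Gᵢ(α) + c α P yⁱ + c α² R bⁱ`; this is `P`. -/
def Pf (φ : ℝ → ℝ → ℝ) (u s : ℝ) : ℝ :=
  (d2 φ u s + 2 * s * d1 φ u s - 2 * Rf φ u s * (s * φ u s + (u - s ^ 2) * d2 φ u s)) / (2 * φ u s)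

section
variable {n : ℕ} {M : Type*} [TopologicalSpace M] [ChartedSpace (E n) M] [IsManifold (𝓡 n) ∞ M]
variable (a : RMetric n M) (β : OneForm n M)

/-- The pairs `(b², s)` with `s ∈ S` and `|s| < b`, attained at the vectors of the domain that are
not multiples of the dual of `β`. -/
def innerSet (S : Set ℝ) : Set (ℝ × ℝ) :=
  {q | q.1 ∈ Set.range (bsq a β) ∧ q.2 ∈ S ∧ q.2 ^ 2 < q.1}

variable {a β} {e : OpenPartialHomeomorph M (E n)} {φ : ℝ → ℝ → ℝ}

theorem innerSet_subset_valueSet (S : Set ℝ) : innerSet a β S ⊆ valueSet a β S :=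
  fun _ hq => ⟨hq.1, hq.2.1, hq.2.2.le⟩

theorem bsq_nonneg (x : M) : 0 ≤ bsq a β x := sq_nonneg _

section
variable (he : e ∈ IsManifold.maximalAtlas (𝓡 n) ∞ M) {p : E n} (hp : p ∈ e.target) {y : E n}
include he hp

omit he hp in
theorem ip_comb (v w : E n) (r t : ℝ) : ip a e p (r • v + t • w) (r • v + t • w) =
    r ^ 2 * ip a e p v v + 2 * r * t * ip a e p v w + t ^ 2 * ip a e p w w := by
  simp only [← inner_vec_eq]
  have : vec e p (r • v + t • w) = r • vec e p v + t • vec e p w := by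
    simp only [vec_eq_sum, PiLp.add_apply, PiLp.smul_apply, smul_eq_mul, add_smul, mul_smul,
      Finset.sum_add_distrib, Finset.smul_sum]
  rw [this, a.inner_comb]

omit he hp in
theorem lin_comb (v w : E n) (r t : ℝ) : lin β e p (r • v + t • w)
    = r * lin β e p v + t * lin β e p w := by
  simp only [lin, PiLp.add_apply, PiLp.smul_apply, smul_eq_mul, mul_add, Finset.sum_add_distrib,
    Finset.mul_sum]
  congr 1 <;> exact Finset.sum_congr rfl fun i _ => by ring

omit he hp in
theorem ip_comb_left (v w z : E n) (r t : ℝ) :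
    ip a e p (r • v + t • w) z = r * ip a e p v z + t * ip a e p w z := by
  rw [ip_comm p (r • v + t • w), ip_comm p v, ip_comm p w]
  simp only [ip_eq_low, PiLp.add_apply, PiLp.smul_apply, smul_eq_mul, mul_add,
    Finset.sum_add_distrib, Finset.mul_sum]
  congr 1 <;> exact Finset.sum_congr rfl fun i _ => by ring

theorem lin_sq_le : lin β e p y ^ 2 ≤ bsq a β (e.symm p) * ip a e p y y := by
  rw [← ip_sharp (a := a) he hp, bsq_eq_ip he hp]
  simp only [← inner_vec_eq]
  exact a.cauchySchwarz _ _

theorem sv_sq_le (hy : y ≠ 0) : sv a β e p y ^ 2 ≤ bsq a β (e.symm p) := by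
  have h0 := ip_self_pos (a := a) he hp hy
  rw [sv, div_pow, Real.sq_sqrt h0.le, div_le_iff₀ h0]
  exact lin_sq_le he hp

theorem exists_unit_orthogonal (hn : 2 ≤ n) : ∃ v : E n, lin β e p v = 0 ∧ ip a e p v v = 1 := by
  let f : E n →ₗ[ℝ] ℝ :=
    { toFun := lin β e p
      map_add' := fun v w => by simpa using lin_comb (β := β) (e := e) (p := p) v w 1 1
      map_smul' := fun r v => by simpa using lin_comb (β := β) (e := e) (p := p) v 0 r 0 }
  have hker : LinearMap.ker f ≠ ⊥ := LinearMap.ker_ne_bot_of_finrank_lt (by simp; omega)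
  obtain ⟨v, hv, hv0⟩ := Submodule.exists_mem_ne_zero_of_ne_bot hker
  have hv' : lin β e p v = 0 := hv
  have h0 := ip_self_pos (a := a) he hp hv0
  refine ⟨(√(ip a e p v v))⁻¹ • v, ?_, ?_⟩
  · simpa [hv'] using lin_comb (β := β) (e := e) (p := p) v 0 (√(ip a e p v v))⁻¹ 0
  · have h := ip_comb (a := a) (e := e) (p := p) v 0 (√(ip a e p v v))⁻¹ 0
    simp only [zero_smul, add_zero] at h
    rw [h, inv_pow, Real.sq_sqrt h0.le]
    field_simp; ring

/-- Every pair `(b², s)` with `|s| < b` is attained. -/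
theorem exists_sv_eq (hn : 2 ≤ n) {s : ℝ} (hs : s ^ 2 < bsq a β (e.symm p)) :
    ∃ y : E n, y ≠ 0 ∧ sv a β e p y = s := by
  obtain ⟨v, hv0, hv1⟩ := exists_unit_orthogonal (a := a) (β := β) he hp hn
  set u := bsq a β (e.symm p) with hu
  have hupos : 0 < u := lt_of_le_of_lt (sq_nonneg s) hs
  set z := s • sharp a β e p + √(u * (u - s ^ 2)) • v with hz
  have hN : ip a e p z z = u ^ 2 := by
    rw [hz, ip_comb, ← bsq_eq_ip he hp, ip_sharp he hp, hv0, hv1, ← hu,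
      Real.sq_sqrt (mul_nonneg hupos.le (by linarith))]
    ring
  have ht : lin β e p z = s * u := by
    rw [hz, lin_comb, ← bsq_eq_lin he hp, hv0, ← hu]; ring
  refine ⟨z, ?_, ?_⟩
  · intro h0
    rw [h0] at hN
    simp [ip] at hN
    exact hupos.ne' (by simpa using hN.symm)
  · rw [sv, hN, ht, Real.sqrt_sq hupos.le]; field_simp

theorem vec_mem_dom_iff (S : Set ℝ) : vec e p y ∈ dom a β S (e.symm p) ↔ y ≠ 0 ∧ sv a β e p y
    ∈ S := by
  simp only [dom, Set.mem_ofPred_eq, ratio_vec, ne_eq, vec_eq_zero_iff he hp]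

end

variable {c : M → ℝ}

/-- Where `β ≠ 0`, the function `b²` is a submersion because `d(b²) = 2 c β`. -/
theorem isOpen_range_bsq_pos (hc : ∀ x, c x ≠ 0) (hβ : IsClosedConformal a β c) :
    IsOpen (Set.range (bsq a β) ∩ Set.Ioi 0) := by
  rw [isOpen_iff_mem_nhds]
  rintro _ ⟨⟨x, rfl⟩, hx⟩
  refine Filter.inter_mem ?_ (isOpen_Ioi.mem_nhds hx)
  set e := chartAt (E n) x
  have he : e ∈ IsManifold.maximalAtlas (𝓡 n) ∞ M := IsManifold.chart_mem_maximalAtlas x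
  set p := e x with hpdef
  have hxs : x ∈ e.source := mem_chart_source _ x
  have hp : p ∈ e.target := e.map_source hxs
  have hxp : e.symm p = x := e.left_inv hxs
  have hsm : ContDiffAt ℝ ∞ (fun q => bsq a β (e.symm q)) p :=
    (contDiffOn_bsq he).contDiffAt (e.open_target.mem_nhds hp)
  have hstrict := hsm.hasStrictFDerivAt (by simp)
  have hex : ∃ k, coeffB β e k p ≠ 0 := by
    by_contra hno
    push Not at hno
    have h1 := bsq_eq_lin (a := a) (β := β) he hp
    rw [lin, Finset.sum_eq_zero (fun i _ => by rw [hno i, zero_mul]), hxp] at h1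
    exact (ne_of_gt hx) h1
  obtain ⟨k, hk⟩ := hex
  have hne : fderiv ℝ (fun q => bsq a β (e.symm q)) p (EuclideanSpace.single k 1) ≠ 0 := by
    have := pd_bsq he hp hβ k
    rw [pd] at this
    rw [this]
    exact mul_ne_zero (mul_ne_zero two_ne_zero (hc _)) hk
  have hsurj : LinearMap.range (fderiv ℝ (fun q => bsq a β (e.symm q)) p).toLinearMap = ⊤ := by
    refine LinearMap.range_eq_top.2 fun r => ?_
    refine ⟨(r / (fderiv ℝ (fun q => bsq a β (e.symm q)) p
        (EuclideanSpace.single k 1))) • EuclideanSpace.single k 1, ?_⟩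
    simp only [ContinuousLinearMap.coe_coe, map_smul, smul_eq_mul]
    field_simp
  have hmap := hstrict.map_nhds_eq_of_surj hsurj
  rw [hxp] at hmap
  rw [← hmap]
  exact Filter.mem_map.2 (Filter.univ_mem' fun q => ⟨_, rfl⟩)

theorem isOpen_innerSet (hc : ∀ x, c x ≠ 0) (hβ : IsClosedConformal a β c) {S : Set ℝ}
    (hS : IsOpen S) : IsOpen (innerSet a β S) := by
  have h : innerSet a β S = (Prod.fst ⁻¹' (Set.range (bsq a β) ∩ Set.Ioi 0)) ∩
      (Prod.snd ⁻¹' S) ∩ {q | q.2 ^ 2 < q.1} := by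
    ext q
    simp only [innerSet, Set.mem_ofPred_eq, Set.mem_inter_iff, Set.mem_preimage, Set.mem_Ioi]
    constructor
    · rintro ⟨h1, h2, h3⟩
      exact ⟨⟨⟨h1, lt_of_le_of_lt (sq_nonneg _) h3⟩, h2⟩, h3⟩
    · rintro ⟨⟨⟨h1, _⟩, h2⟩, h3⟩
      exact ⟨h1, h2, h3⟩
  rw [h]
  exact (((isOpen_range_bsq_pos hc hβ).preimage continuous_fst).inter
      (hS.preimage continuous_snd)).inter
    (isOpen_lt (by fun_prop) (by fun_prop))

theorem IsGeneralABMetric.isOpen {S : Set ℝ} (hF : IsGeneralABMetric a β φ S) : IsOpen S := by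
  rcases hF.regular_or_singular with h | h
  · rw [h]; exact isOpen_univ
  · rw [h.1]; exact isOpen_Ioi

theorem IsGeneralABMetric.smoothOn {S : Set ℝ} (hF : IsGeneralABMetric a β φ S) :
    SmoothOn φ (innerSet a β S) := hF.smooth.mono (innerSet_subset_valueSet S)

theorem exists_chart_point (x : M) : ∃ e ∈ IsManifold.maximalAtlas (𝓡 n) ∞ M, ∃ p ∈ e.target,
    e.symm p = x :=
  ⟨chartAt (E n) x, IsManifold.chart_mem_maximalAtlas x, chartAt (E n) x x,
    (chartAt (E n) x).map_source (mem_chart_source _ x),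
        (chartAt (E n) x).left_inv (mem_chart_source _ x)⟩

/-- Strong convexity, evaluated on the component of the dual of `β` that is orthogonal to `y` with
respect to the fundamental tensor. -/
theorem cvx_pos (hn : 2 ≤ n) (hc : ∀ x, c x ≠ 0) (hβ : IsClosedConformal a β c) {S : Set ℝ}
    (hF : IsGeneralABMetric a β φ S) {u s : ℝ} (h : (u, s) ∈ innerSet a β S) : 0 < cvx φ u s := by
  obtain ⟨x, hx⟩ := h.1
  obtain ⟨e, he, p, hp, hpx⟩ := exists_chart_point (n := n) x
  have hu : u = bsq a β (e.symm p) := by rw [hpx]; exact hx.symm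
  obtain ⟨y, hy, hys⟩ := exists_sv_eq (a := a) (β := β) he hp hn (s := s)
      (by rw [← hu]; exact h.2.2)
  have hpd := hF.convex e he p hp y ((vec_mem_dom_iff he hp S).2 ⟨hy, by rw [hys]; exact h.2.1⟩)
  have hO := isOpen_innerSet hc hβ hF.isOpen
  have hφ := hF.smoothOn
  have hpos := hF.pos _ (innerSet_subset_valueSet S h)
  simp only at hpos
  have h0 := ip_self_pos (a := a) he hp hy
  have hr := Real.sqrt_pos.2 h0
  have hN : ip a e p y y = √(ip a e p y y) ^ 2 := (Real.sq_sqrt h0.le).symm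
  have ht : lin β e p y = s * √(ip a e p y y) := by
    rw [← hys, sv]; field_simp
  set r := √(ip a e p y y) with hrdef
  -- The derivative of `F` in the direction of the dual of `β` is `s φ + (u - s²) φ_s`, so `ζ` is
  -- orthogonal to `y` with respect to the fundamental tensor. The factor `φ` clears a denominator.
  set κ := -(s * φ u s + (u - s ^ 2) * d2 φ u s) / r with hκ
  set ζ : E n := κ • y + φ u s • sharp a β e p with hζ
  have hus : 0 < u - s ^ 2 := sub_pos.2 h.2.2
  have hζ0 : ζ ≠ 0 := by
    intro h1
    have e1 : ip a e p ζ y = 0 := by rw [h1]; simp [ip]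
    have e2 : lin β e p ζ = 0 := by rw [h1]; simp [lin]
    have e3 : ip a e p ζ y = κ * r ^ 2 + φ u s * (s * r) := by
      rw [hζ, ip_comb_left, ip_sharp he hp, hN, ht]
    have e4 : lin β e p ζ = κ * (s * r) + φ u s * u := by
      rw [hζ, lin_comb, ht, ← bsq_eq_lin he hp, ← hu]
    rw [e1] at e3; rw [e2] at e4
    have e5 : κ * r = - (φ u s * s) := by
      have : r * (κ * r + φ u s * s) = 0 := by linarith
      rcases mul_eq_zero.1 this with h | h
      · exact absurd h hr.ne'
      · linarith
    have : φ u s * (u - s ^ 2) = 0 := by linear_combination -e4 - s * e5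
    rcases mul_eq_zero.1 this with h | h
    · exact hpos.ne' h
    · exact hus.ne' h
  have hquad := hpd.dotProduct_mulVec_pos (x := ζ) (by simpa using hζ0)
  have hval : star (ζ : Fin n → ℝ) ⬝ᵥ (fund (genAB a β φ) e p y).mulVec ζ
      = φ u s ^ 3 * (u - s ^ 2) * cvx φ u s := by
    have hm : (bsq a β (e.symm p), sv a β e p y) ∈ innerSet a β S := by rw [hys, ← hu]; exact h
    have hmv := fund_mulVec he hp y hO hφ hy hm ζ
    rw [hys, ← hu] at hmv
    simp only [dotProduct, star_trivial, hmv]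
    have c1 : ∑ j, coeffB β e j p * ζ j = κ * (s * r) + φ u s * u := by
      have h2 : lin β e p (sharp a β e p) = u := by rw [← bsq_eq_lin he hp, hu]
      have h1 := lin_comb (β := β) (e := e) (p := p) y (sharp a β e p) κ (φ u s)
      rwa [ht, h2] at h1
    have c2 : ∑ j, low a e p y j * ζ j = κ * r ^ 2 + φ u s * (s * r) := by
      rw [← ip_eq_low, ip_comm (a := a) (e := e), hζ, ip_comb_left, ip_sharp he hp, hN, ht]
    have c3 : ∑ i, (∑ j, coeffA a e p i j * ζ j) * ζ i
        = κ ^ 2 * r ^ 2 + 2 * κ * φ u s * (s * r) + φ u s ^ 2 * u := by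
      have h1 : ∑ i, (∑ j, coeffA a e p i j * ζ j) * ζ i = ip a e p ζ ζ := (ip_eq_low _ _ _).symm
      rw [h1, hζ, ip_comb, ip_comm (a := a) (e := e) (p := p) y (sharp a β e p), ← bsq_eq_ip he hp,
          ip_sharp he hp, hN, ht, ← hu]
    rw [c1, c2]
    have expand : ∀ (A : Fin n → ℝ) (k1 k2 k3 : ℝ),
        ∑ i, ζ i * (k1 * low a e p y i + k2 * A i + k3 * coeffB β e i p)
        = k1 * (∑ j, low a e p y j * ζ j) + k2 * (∑ i, A i * ζ i)
          + k3 * ∑ j, coeffB β e j p * ζ j := by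
      intro A k1 k2 k3
      simp only [Finset.mul_sum, ← Finset.sum_add_distrib]
      refine Finset.sum_congr rfl fun i _ => ?_
      ring
    rw [expand fun i => ∑ j, coeffA a e p i j * ζ j, c1, c2, c3, d2_dN (hφ.pow 2) hO h, dN,
        d2_sq hO hφ h, d2_d2_sq hO hφ h, hN, Real.sqrt_sq hr.le, hκ, cvx]
    field_simp
    ring
  rw [hval] at hquad
  exact pos_of_mul_pos_right hquad (by positivity)

/-- The two linear equations for the coefficients of the spray, from the equations
`φ_ss - 2 φ_u + 2 s φ_us = 2 R (φ - s φ_s + (u - s²) φ_ss)` and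
`φ_s + 2 s φ_u = 2 R (s φ + (u - s²) φ_s) + 2 P φ`. -/
theorem spray_system {O : Set (ℝ × ℝ)} (hO : IsOpen O) (hφ : SmoothOn φ O) {u s P R : ℝ}
    (h : (u, s) ∈ O) {g : ℝ → ℝ → ℝ} (hg : g = fun u s => φ u s ^ 2)
    (h1 : d2 (d2 φ) u s - 2 * d1 φ u s + 2 * s * d1 (d2 φ) u s = 2 * R * cvx φ u s)
    (h2 : d2 φ u s + 2 * s * d1 φ u s
      = 2 * R * (s * φ u s + (u - s ^ 2) * d2 φ u s) + 2 * P * φ u s) :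
    2 * s * d1 g u s - s ^ 2 * d1 (d2 g) u s + (d2 g u s - s * d2 (d2 g) u s) / 2 =
      P * (2 * g u s - s * d2 g u s) + 2 * R * (u - s ^ 2) * ((d2 g u s - s * d2 (d2 g) u s) / 2) ∧
    2 * s * d1 (d2 g) u s + d2 (d2 g) u s - 2 * d1 g u s =
      2 * P * d2 g u s + 2 * R * (2 * g u s + (u - s ^ 2) * d2 (d2 g) u s) := by
  subst hg
  rw [d1_sq hO hφ h, d2_sq hO hφ h, d2_d2_sq hO hφ h, d1_d2_sq hO hφ h]
  rw [cvx] at h1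
  constructor
  · linear_combination (φ u s - s * d2 φ u s) * h2 - s * φ u s * h1
  · linear_combination 2 * φ u s * h1 + 2 * d2 φ u s * h2

/-- The geodesic coefficients of a general `(α, β)`-metric when `b_{i|j} = c a_ij`. -/
theorem spray_genAB (hc : ∀ x, c x ≠ 0) (hβ : IsClosedConformal a β c) {S : Set ℝ}
    (hF : IsGeneralABMetric a β φ S) (he : e ∈ IsManifold.maximalAtlas (𝓡 n) ∞ M) {p : E n}
    (hp : p ∈ e.target) {y : E n} {u s P R : ℝ} (hu : bsq a β (e.symm p) = u)
    (hs : sv a β e p y = s) (hy : y ≠ 0) (h : (u, s) ∈ innerSet a β S)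
    (h1 : d2 (d2 φ) u s - 2 * d1 φ u s + 2 * s * d1 (d2 φ) u s = 2 * R * cvx φ u s)
    (h2 : d2 φ u s + 2 * s * d1 φ u s
      = 2 * R * (s * φ u s + (u - s ^ 2) * d2 φ u s) + 2 * P * φ u s) (i : Fin n) :
    spray (genAB a β φ) e i p y = alphaSpray a e p y i +
      c (e.symm p) * √(ip a e p y y) * P * y i
      + c (e.symm p) * ip a e p y y * R * sharp a β e p i := by
  have hO := isOpen_innerSet hc hβ hF.isOpen
  obtain ⟨hY, hB⟩ := spray_system hO hF.smoothOn h rfl h1 h2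
  have hdom : vec e p y ∈ dom a β S (e.symm p) :=
    (vec_mem_dom_iff he hp S).2 ⟨hy, by rw [hs]; exact h.2.1⟩
  exact spray_eq he hp y hβ hO hF.smoothOn hy (by rw [hu, hs]; exact h) rfl hu.symm hs.symm
    (hF.convex e he p hp y hdom).det_pos.ne' hY hB i

theorem Rf_spec (hn : 2 ≤ n) (hc : ∀ x, c x ≠ 0) (hβ : IsClosedConformal a β c) {S : Set ℝ}
    (hF : IsGeneralABMetric a β φ S) {u s : ℝ} (h : (u, s) ∈ innerSet a β S) :
    d2 (d2 φ) u s - 2 * d1 φ u s + 2 * s * d1 (d2 φ) u s = 2 * Rf φ u s * cvx φ u s := by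
  have := (cvx_pos hn hc hβ hF h).ne'
  rw [Rf]; field_simp

theorem Pf_spec {S : Set ℝ}
    (hF : IsGeneralABMetric a β φ S) {u s : ℝ} (h : (u, s) ∈ innerSet a β S) :
    d2 φ u s + 2 * s * d1 φ u s
      = 2 * Rf φ u s * (s * φ u s + (u - s ^ 2) * d2 φ u s) + 2 * Pf φ u s * φ u s := by
  have : φ u s ≠ 0 := (hF.pos _ (innerSet_subset_valueSet S h)).ne'
  rw [Pf]; field_simp; ring

end

/-! ### Isotropic Berwald curvature along lines -/

section Quadratic

/-- `f` agrees on `I` with a polynomial of degree at most two. -/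
def QuadOn (I : Set ℝ) (f : ℝ → ℝ) : Prop :=
  ∃ k₀ k₁ k₂ : ℝ, ∀ r ∈ I, f r = k₀ + k₁ * r + k₂ * r ^ 2

variable {I : Set ℝ} {f g : ℝ → ℝ}

theorem QuadOn.add (hf : QuadOn I f) (hg : QuadOn I g) : QuadOn I fun r => f r + g r := by
  obtain ⟨a, b, c, h⟩ := hf
  obtain ⟨a', b', c', h'⟩ := hg
  exact ⟨a + a', b + b', c + c', fun r hr => by simp only [h r hr, h' r hr]; ring⟩

theorem QuadOn.const_mul (hf : QuadOn I f) (k : ℝ) : QuadOn I fun r => k * f r := by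
  obtain ⟨a, b, c, h⟩ := hf
  exact ⟨k * a, k * b, k * c, fun r hr => by simp only [h r hr]; ring⟩

theorem QuadOn.sum {ι : Type*} {t : Finset ι} {f : ι → ℝ → ℝ} (hf : ∀ i ∈ t, QuadOn I (f i)) :
    QuadOn I fun r => ∑ i ∈ t, f i r := by
  classical
  induction t using Finset.induction_on with
  | empty => exact ⟨0, 0, 0, fun r _ => by simp⟩
  | insert i t hi ih =>
    simp only [Finset.sum_insert hi]
    exact (hf i (Finset.mem_insert_self _ _)).add
      (ih fun j hj => hf j (Finset.mem_insert_of_mem hj))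

theorem QuadOn.congr (hf : QuadOn I f) (h : ∀ r ∈ I, g r = f r) : QuadOn I g := by
  obtain ⟨a, b, c, h'⟩ := hf
  exact ⟨a, b, c, fun r hr => by rw [h r hr, h' r hr]⟩

theorem QuadOn.mono {J : Set ℝ} (hf : QuadOn I f) (h : J ⊆ I) : QuadOn J f := by
  obtain ⟨a, b, c, h'⟩ := hf
  exact ⟨a, b, c, fun r hr => h' r (h hr)⟩

theorem QuadOn.mul_linear (x d x' d' : ℝ) : QuadOn I fun r => (x + r * d) * (x' + r * d') :=
  ⟨x * x', x * d' + d * x', d * d', fun r _ => by ring⟩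

/-- Quadratic polynomials that agree for `r > 0` agree everywhere. -/
theorem QuadOn.eq_of_pos (hf : QuadOn Set.univ f) {k₀ k₁ k₂ : ℝ}
    (h : ∀ r, 0 < r → f r = k₀ + k₁ * r + k₂ * r ^ 2) (r : ℝ) : f r = k₀ + k₁ * r + k₂ * r ^ 2 := by
  obtain ⟨a, b, c, h'⟩ := hf
  have e1 := h 1 one_pos
  have e2 := h 2 two_pos
  have e3 := h 3 three_pos
  rw [h' _ trivial] at e1 e2 e3 ⊢
  obtain rfl : c = k₂ := by linarith
  obtain rfl : b = k₁ := by linarith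
  obtain rfl : a = k₀ := by linarith
  rfl

theorem exists_const_of_hasDerivAt_zero (hI : IsOpen I) (hI' : I.OrdConnected)
    (h : ∀ r ∈ I, HasDerivAt f 0 r) : ∃ k, ∀ r ∈ I, f r = k :=
  hI.exists_is_const_of_deriv_eq_zero hI'.isPreconnected
    (fun r hr => (h r hr).differentiableAt.differentiableWithinAt) (fun r hr => (h r hr).deriv)

theorem QuadOn.of_hasDerivAt (hI : IsOpen I) (hI' : I.OrdConnected) {f₁ f₂ : ℝ → ℝ}
    (h0 : ∀ r ∈ I, HasDerivAt f (f₁ r) r) (h1 : ∀ r ∈ I, HasDerivAt f₁ (f₂ r) r)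
    (h2 : ∀ r ∈ I, HasDerivAt f₂ 0 r) : QuadOn I f := by
  obtain ⟨k₂, hk₂⟩ := exists_const_of_hasDerivAt_zero hI hI' h2
  obtain ⟨k₁, hk₁⟩ := exists_const_of_hasDerivAt_zero (f := fun r => f₁ r - k₂ * r) hI hI'
    fun r hr => by
      have := (h1 r hr).sub ((hasDerivAt_id r).const_mul k₂)
      rw [hk₂ r hr, mul_one, sub_self] at this
      exact this
  obtain ⟨k₀, hk₀⟩ := exists_const_of_hasDerivAt_zero
    (f := fun r => f r - k₁ * r - k₂ / 2 * r ^ 2) hI hI' fun r hr => by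
      have := ((h0 r hr).sub ((hasDerivAt_id r).const_mul k₁)).sub
        ((hasDerivAt_pow 2 r).const_mul (k₂ / 2))
      have e : f₁ r - k₁ * 1 - k₂ / 2 * ((2 : ℕ) * r ^ (2 - 1)) = 0 := by
        have := hk₁ r hr
        norm_num
        linarith
      rw [e] at this
      exact this
  refine ⟨k₀, k₁, k₂ / 2, fun r hr => ?_⟩
  have := hk₀ r hr
  linarith

end Quadratic

section Line
variable {n : ℕ} {W : Set (E n)} {f : E n → ℝ}

theorem fderiv_eq_sum_pd (y d : E n) : fderiv ℝ f y d = ∑ j, d j * pd j f y := by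
  have hd : d = ∑ j, d j • EuclideanSpace.single j (1 : ℝ) := by
    ext i
    simp [Finset.sum_apply, Pi.single_apply]
  conv_lhs => rw [hd]
  rw [map_sum]
  exact Finset.sum_congr rfl fun j _ => by rw [map_smul, smul_eq_mul, pd]

theorem hasDerivAt_line (hW : IsOpen W) (hf : ContDiffOn ℝ ∞ f W) {y d : E n} {r : ℝ}
    (hr : y + r • d ∈ W) :
    HasDerivAt (fun r : ℝ => f (y + r • d)) (∑ j, d j * pd j f (y + r • d)) r := by
  have h1 : HasFDerivAt f (fderiv ℝ f (y + r • d)) (y + r • d) :=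
    ((hf.contDiffAt (hW.mem_nhds hr)).differentiableAt (by simp)).hasFDerivAt
  have h2 : HasDerivAt (fun r : ℝ => y + r • d) d r := by
    simpa using ((hasDerivAt_id r).smul_const d).const_add y
  rw [← fderiv_eq_sum_pd]
  exact h1.comp_hasDerivAt r h2

theorem contDiffOn_pd (hW : IsOpen W) (hf : ContDiffOn ℝ ∞ f W) (j : Fin n) :
    ContDiffOn ℝ ∞ (pd j f) W :=
  (hf.fderiv_of_isOpen hW (by simp)).clm_apply contDiffOn_const

theorem hasDerivAt_line₂ (hW : IsOpen W) (hf : ContDiffOn ℝ ∞ f W) {y d : E n} {r : ℝ}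
    (hr : y + r • d ∈ W) :
    HasDerivAt (fun r : ℝ => ∑ j, d j * pd j f (y + r • d))
      (∑ j, ∑ k, d j * d k * pd k (pd j f) (y + r • d)) r := by
  refine HasDerivAt.fun_sum fun j _ => ?_
  have := (hasDerivAt_line hW (contDiffOn_pd hW hf j) hr).const_mul (d j)
  simpa only [Finset.mul_sum, mul_assoc] using this

theorem hasDerivAt_line₃ (hW : IsOpen W) (hf : ContDiffOn ℝ ∞ f W) {y d : E n} {r : ℝ}
    (hr : y + r • d ∈ W) :
    HasDerivAt (fun r : ℝ => ∑ j, ∑ k, d j * d k * pd k (pd j f) (y + r • d))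
      (∑ j, ∑ k, ∑ l, d j * d k * d l * pd l (pd k (pd j f)) (y + r • d)) r := by
  refine HasDerivAt.fun_sum fun j _ => HasDerivAt.fun_sum fun k _ => ?_
  have := (hasDerivAt_line hW (contDiffOn_pd hW (contDiffOn_pd hW hf j) k) hr).const_mul (d j * d k)
  simpa only [Finset.mul_sum, mul_assoc] using this

end Line

section Smooth
variable {n : ℕ} {M : Type*} [TopologicalSpace M] [ChartedSpace (E n) M] [IsManifold (𝓡 n) ∞ M]
variable {a : RMetric n M} {β : OneForm n M} {e : OpenPartialHomeomorph M (E n)} {φ : ℝ → ℝ → ℝ}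
  {S : Set ℝ}

/-- The coordinates `(p, y)` of the vectors in the domain of `F`. -/
def domLoc (a : RMetric n M) (β : OneForm n M) (e : OpenPartialHomeomorph M (E n)) (S : Set ℝ) :
    Set (E n × E n) :=
  {q | q.1 ∈ e.target ∧ vec e q.1 q.2 ∈ dom a β S (e.symm q.1)}

section
variable (he : e ∈ IsManifold.maximalAtlas (𝓡 n) ∞ M)
include he

theorem contDiffOn_ip : ContDiffOn ℝ ∞ (fun q : E n × E n => ip a e q.1 q.2 q.2)
    (e.target ×ˢ Set.univ) := by
  unfold ip
  refine ContDiffOn.sum fun i _ => ContDiffOn.sum fun j _ => ?_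
  refine (((contDiffOn_coeffA a he i j).comp contDiffOn_fst fun _ hq => hq.1).mul ?_).mul ?_
  · exact ContDiff.contDiffOn (by fun_prop)
  · exact ContDiff.contDiffOn (by fun_prop)

theorem contDiffOn_lin : ContDiffOn ℝ ∞ (fun q : E n × E n => lin β e q.1 q.2)
    (e.target ×ˢ Set.univ) := by
  unfold lin
  refine ContDiffOn.sum fun i _ => ?_
  refine ((contDiffOn_coeffB β he i).comp contDiffOn_fst fun _ hq => hq.1).mul ?_
  exact ContDiff.contDiffOn (by fun_prop)

theorem contDiffOn_sqrt_ip : ContDiffOn ℝ ∞ (fun q : E n × E n => √(ip a e q.1 q.2 q.2))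
    (e.target ×ˢ {0}ᶜ) :=
  ((contDiffOn_ip he).mono (Set.prod_mono_right (Set.subset_univ _))).sqrt
    fun _ hq => (ip_self_pos he hq.1 hq.2).ne'

theorem contDiffOn_sv : ContDiffOn ℝ ∞ (fun q : E n × E n => sv a β e q.1 q.2)
    (e.target ×ˢ {0}ᶜ) :=
  ((contDiffOn_lin he).mono (Set.prod_mono_right (Set.subset_univ _))).div
    (contDiffOn_sqrt_ip he) fun _ hq => (Real.sqrt_pos.2 (ip_self_pos he hq.1 hq.2)).ne'

theorem domLoc_subset : domLoc a β e S ⊆ e.target ×ˢ {0}ᶜ :=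
  fun _ hq => ⟨hq.1, ((vec_mem_dom_iff he hq.1 S).1 hq.2).1⟩

theorem isOpen_domLoc (hS : IsOpen S) : IsOpen (domLoc a β e S) := by
  have h := (contDiffOn_sv (a := a) (β := β) he).continuousOn.isOpen_inter_preimage
    (e.open_target.prod isOpen_compl_singleton) hS
  refine (?_ : domLoc a β e S = _) ▸ h
  ext q
  constructor
  · intro hq
    exact ⟨domLoc_subset he hq, ((vec_mem_dom_iff he hq.1 S).1 hq.2).2⟩
  · intro hq
    exact ⟨hq.1.1, (vec_mem_dom_iff he hq.1.1 S).2 ⟨hq.1.2, hq.2⟩⟩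

theorem contDiffOn_loc (hF : IsGeneralABMetric a β φ S) :
    ContDiffOn ℝ ∞ (fun q : E n × E n => loc (genAB a β φ) e q.1 q.2) (domLoc a β e S) := by
  simp only [loc_genAB]
  refine ((contDiffOn_sqrt_ip he).mono (domLoc_subset he)).mul ?_
  have h : ContDiffOn ℝ ∞ (fun q : E n × E n => (bsq a β (e.symm q.1), sv a β e q.1 q.2))
      (domLoc a β e S) :=
    ((contDiffOn_bsq he).comp contDiffOn_fst fun q hq => hq.1).prodMk
      ((contDiffOn_sv he).mono (domLoc_subset he))
  refine hF.smooth.comp h fun q hq => ⟨⟨_, rfl⟩, ?_, ?_⟩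
  · exact ((vec_mem_dom_iff he hq.1 S).1 hq.2).2
  · exact sv_sq_le he hq.1 ((vec_mem_dom_iff he hq.1 S).1 hq.2).1

theorem contDiffOn_spray (hF : IsGeneralABMetric a β φ S) (i : Fin n) :
    ContDiffOn ℝ ∞ (fun q : E n × E n => spray (genAB a β φ) e i q.1 q.2) (domLoc a β e S) := by
  have hO := isOpen_domLoc (a := a) (β := β) he hF.isOpen
  have h0 := (contDiffOn_loc he hF).pow 2
  have h1 := fun l => contDiffOn_pd_right (G := fun p y => loc (genAB a β φ) e p y ^ 2) hO h0 l
  have h2 := fun i j => contDiffOn_pd_right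
    (G := fun p y => pd i (fun v => loc (genAB a β φ) e p v ^ 2) y) hO (h1 i) j
  have h3 := fun k l => contDiffOn_pd_left
    (G := fun p y => pd l (fun v => loc (genAB a β φ) e p v ^ 2) y) hO (h1 l) k
  have h4 := fun l => contDiffOn_pd_left (G := fun p y => loc (genAB a β φ) e p y ^ 2) hO h0 l
  unfold spray
  refine contDiffOn_const.mul (ContDiffOn.sum fun l _ => ?_)
  refine (contDiffOn_matrix_inv (A := fun q : E n × E n => fund (genAB a β φ) e q.1 q.2)
    (fun i j => contDiffOn_const.mul (h2 i j)) ?_ i l).mul (ContDiffOn.sub ?_ (h4 l))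
  · exact fun q hq => (hF.convex e he q.1 hq.1 q.2 hq.2).det_pos.ne'
  · exact ContDiffOn.sum fun k _ => (h3 k l).mul (ContDiff.contDiffOn (by fun_prop))

variable {p : E n} (hp : p ∈ e.target)
include hp

theorem isOpen_dom_fibre (hS : IsOpen S) : IsOpen {y | vec e p y ∈ dom a β S (e.symm p)} := by
  have : {y | vec e p y ∈ dom a β S (e.symm p)} = (fun y => (p, y)) ⁻¹' domLoc a β e S := by
    ext y; exact ⟨fun h => ⟨hp, h⟩, fun h => h.2⟩
  rw [this]
  exact (isOpen_domLoc he hS).preimage (by fun_prop)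

theorem contDiffOn_loc_fibre (hF : IsGeneralABMetric a β φ S) :
    ContDiffOn ℝ ∞ (loc (genAB a β φ) e p) {y | vec e p y ∈ dom a β S (e.symm p)} :=
  (contDiffOn_loc he hF).comp (f := fun y => (p, y)) (ContDiff.contDiffOn (by fun_prop))
    fun _ hy => ⟨hp, hy⟩

theorem contDiffOn_spray_fibre (hF : IsGeneralABMetric a β φ S) (i : Fin n) :
    ContDiffOn ℝ ∞ (spray (genAB a β φ) e i p) {y | vec e p y ∈ dom a β S (e.symm p)} :=
  (contDiffOn_spray he hF i).comp (f := fun y => (p, y)) (ContDiff.contDiffOn (by fun_prop))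
    fun _ hy => ⟨hp, hy⟩

omit he hp in
/-- The tensor of isotropic Berwald curvature contracted with `d ⊗ d ⊗ d`. -/
theorem sum_isotropic (d : Fin n → ℝ) (L₂ : Fin n → Fin n → ℝ) (L₃ : Fin n → Fin n → Fin n → ℝ)
    (t z : ℝ) (i : Fin n) :
    ∑ j, ∑ k, ∑ l, d j * d k * d l * (t * (L₂ j k * (if i = l then 1 else 0)
      + L₂ j l * (if i = k then 1 else 0) + L₂ l k * (if i = j then 1 else 0) + L₃ j k l * z)) =
    t * ((∑ j, ∑ k, ∑ l, d j * d k * d l * L₃ j k l) * z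
      + 3 * ((∑ j, ∑ k, d j * d k * L₂ j k) * d i)) := by
  have s1 : ∑ j, ∑ k, ∑ l, d j * d k * d l * (L₂ j k * (if i = l then 1 else 0)) =
      (∑ j, ∑ k, d j * d k * L₂ j k) * d i := by
    simp only [Finset.sum_mul, mul_ite, mul_one, mul_zero, Finset.sum_ite_eq, Finset.mem_univ,
      if_true]
    exact Finset.sum_congr rfl fun j _ => Finset.sum_congr rfl fun k _ => by ring
  have s2 : ∑ j, ∑ k, ∑ l, d j * d k * d l * (L₂ j l * (if i = k then 1 else 0)) =
      (∑ j, ∑ k, d j * d k * L₂ j k) * d i := by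
    simp only [Finset.sum_mul]
    refine Finset.sum_congr rfl fun j _ => ?_
    rw [Finset.sum_comm]
    simp only [mul_ite, mul_one, mul_zero, Finset.sum_ite_eq, Finset.mem_univ, if_true]
    exact Finset.sum_congr rfl fun k _ => by ring
  have s3 : ∑ j, ∑ k, ∑ l, d j * d k * d l * (L₂ l k * (if i = j then 1 else 0)) =
      (∑ j, ∑ k, d j * d k * L₂ j k) * d i := by
    have h : ∀ j, ∑ k, ∑ l, d j * d k * d l * (L₂ l k * (if i = j then 1 else 0)) =
        if i = j then ∑ k, ∑ l, d j * d k * d l * L₂ l k else 0 := by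
      intro j
      split_ifs <;> simp
    simp only [h, Finset.sum_ite_eq, Finset.mem_univ, if_true, Finset.sum_mul]
    rw [Finset.sum_comm]
    exact Finset.sum_congr rfl fun j _ => Finset.sum_congr rfl fun k _ => by ring
  have s4 : ∑ j, ∑ k, ∑ l, d j * d k * d l * (L₃ j k l * z) =
      (∑ j, ∑ k, ∑ l, d j * d k * d l * L₃ j k l) * z := by
    simp only [Finset.sum_mul, mul_assoc]
  have h : ∀ j k l, d j * d k * d l * (t * (L₂ j k * (if i = l then 1 else 0)
      + L₂ j l * (if i = k then 1 else 0) + L₂ l k * (if i = j then 1 else 0) + L₃ j k l * z)) =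
      t * (d j * d k * d l * (L₂ j k * (if i = l then 1 else 0))
        + d j * d k * d l * (L₂ j l * (if i = k then 1 else 0))
        + d j * d k * d l * (L₂ l k * (if i = j then 1 else 0))
        + d j * d k * d l * (L₃ j k l * z)) := fun j k l => by ring
  simp only [h, ← Finset.mul_sum, Finset.sum_add_distrib, s1, s2, s3, s4]
  ring

/-- Isotropic Berwald curvature says that the third derivatives of `Gⁱ - τ F yⁱ` vanish. -/
theorem quadOn_spray {τ : M → ℝ} (hF : IsGeneralABMetric a β φ S)
    (hτ : IsIsotropicBerwald (dom a β S) (genAB a β φ) τ) (y d : E n) {I : Set ℝ} (hI : IsOpen I)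
    (hI' : I.OrdConnected) (hW : ∀ r ∈ I, vec e p (y + r • d) ∈ dom a β S (e.symm p)) (i : Fin n) :
    QuadOn I fun r => spray (genAB a β φ) e i p (y + r • d)
      - τ (e.symm p) * (loc (genAB a β φ) e p (y + r • d) * (y i + r * d i)) := by
  have hO := isOpen_dom_fibre (a := a) (β := β) he hp hF.isOpen
  have hG := contDiffOn_spray_fibre he hp hF i
  have hL := contDiffOn_loc_fibre he hp hF
  have hlin : ∀ r, HasDerivAt (fun r : ℝ => y i + r * d i) (d i) r := fun r => by
    simpa using ((hasDerivAt_id r).mul_const (d i)).const_add (y i)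
  refine QuadOn.of_hasDerivAt hI hI'
    (fun r hr => (hasDerivAt_line hO hG (hW r hr)).sub
      (((hasDerivAt_line hO hL (hW r hr)).mul (hlin r)).const_mul _))
    (fun r hr => (hasDerivAt_line₂ hO hG (hW r hr)).sub
      ((((hasDerivAt_line₂ hO hL (hW r hr)).mul (hlin r)).add
        ((hasDerivAt_line hO hL (hW r hr)).mul_const (d i))).const_mul _))
    (fun r hr => ?_)
  have h := (hasDerivAt_line₃ hO hG (hW r hr)).sub
      (((((hasDerivAt_line₃ hO hL (hW r hr)).mul (hlin r)).add
        ((hasDerivAt_line₂ hO hL (hW r hr)).mul_const (d i))).add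
          ((hasDerivAt_line₂ hO hL (hW r hr)).mul_const (d i))).const_mul (τ (e.symm p)))
  refine h.congr_deriv ?_
  have hB := fun j k l => hτ e he p hp _ (hW r hr) j i k l
  simp only [berwald, isoTensor] at hB
  simp only [hB]
  rw [sum_isotropic (fun j => d j)
    (fun j k => pd k (pd j (loc (genAB a β φ) e p)) (y + r • d))
    (fun j k l => pd l (pd k (pd j (loc (genAB a β φ) e p))) (y + r • d))]
  simp only [PiLp.add_apply, PiLp.smul_apply, smul_eq_mul]
  ring

omit he hp in
theorem quadOn_alphaSpray (y d : E n) (I : Set ℝ) (i : Fin n) :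
    QuadOn I fun r => alphaSpray a e p (y + r • d) i := by
  unfold alphaSpray alphaSprayLow
  refine QuadOn.sum fun l _ => (QuadOn.const_mul
      (QuadOn.sum fun i _ => QuadOn.sum fun j _ => ?_) _).const_mul _
  generalize (2 * pd i (fun q => coeffA a e q l j) p - pd l (fun q => coeffA a e q i j) p) = k
  simp only [PiLp.add_apply, PiLp.smul_apply, smul_eq_mul, mul_assoc]
  exact ((QuadOn.mul_linear (y i) (d i) (y j) (d j)).const_mul k)

/-- Along a line of interior vectors, `α (P - σ φ) ⟨z, y⟩ + α² R ⟨z, b⟩` is quadratic, where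
`σ = τ / c`. -/
theorem quadOn_interior {τ c : M → ℝ} (hn : 2 ≤ n) (hc : ∀ x, c x ≠ 0)
    (hβ : IsClosedConformal a β c) (hF : IsGeneralABMetric a β φ S)
    (hτ : IsIsotropicBerwald (dom a β S) (genAB a β φ) τ) (y d : E n) {I J : Set ℝ} (hI : IsOpen I)
    (hI' : I.OrdConnected) (hW : ∀ r ∈ I, vec e p (y + r • d) ∈ dom a β S (e.symm p)) (hJ : J ⊆ I)
    {u : ℝ} (hu : u = bsq a β (e.symm p)) {s N : ℝ → ℝ}
    (hs : ∀ r ∈ J, sv a β e p (y + r • d) = s r)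
    (hN : ∀ r ∈ J, ip a e p (y + r • d) (y + r • d) = N r)
    (hJ' : ∀ r ∈ J, (u, s r) ∈ innerSet a β S) (z : E n) :
    QuadOn J fun r => √(N r) * (Pf φ u (s r) - τ (e.symm p) / c (e.symm p) * φ u (s r)) *
      ip a e p z (y + r • d) + N r * Rf φ u (s r) * lin β e p z := by
  have h1 : ∀ i, QuadOn J fun r => low a e p z i * (c (e.symm p))⁻¹ *
      ((spray (genAB a β φ) e i p (y + r • d)
      - τ (e.symm p) * (loc (genAB a β φ) e p (y + r • d) * (y i + r * d i))) +
      (-1) * alphaSpray a e p (y + r • d) i) := fun i =>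
    (((quadOn_spray he hp hF hτ y d hI hI' hW i).mono hJ).add
      ((quadOn_alphaSpray y d J i).const_mul (-1))).const_mul _
  have h2 := QuadOn.sum (t := Finset.univ) fun i _ => h1 i
  refine h2.congr fun r hr => ?_
  have hy : y + r • d ≠ 0 := ((vec_mem_dom_iff he hp S).1 (hW r (hJ hr))).1
  have hsp := fun i => spray_genAB hc hβ hF he hp hu.symm (hs r hr) hy (hJ' r hr)
    (Rf_spec hn hc hβ hF (hJ' r hr)) (Pf_spec hF (hJ' r hr)) i
  simp only [hsp, loc_genAB, hs r hr, hN r hr, ← hu]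
  have hcx := hc (e.symm p)
  rw [ip_eq_low, ← ip_sharp (a := a) he hp, ip_comm, ip_eq_low, Finset.mul_sum, Finset.mul_sum,
    ← Finset.sum_add_distrib]
  refine Finset.sum_congr rfl fun i _ => ?_
  simp only [PiLp.add_apply, PiLp.smul_apply, smul_eq_mul]
  field_simp
  ring

end

variable {c τ : M → ℝ}

/-- The coefficients `P`, `R` of the spray for `s > 0`, from the line `b + r v` with `v` a unit
vector orthogonal to the dual `b` of `β`. Symmetry under `r ↦ -r` determines the parities of the
two quadratic polynomials. -/
theorem exists_spray_coeff_of_pos (hn : 2 ≤ n) (hc : ∀ x, c x ≠ 0)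
    (hβ : IsClosedConformal a β c) (hF : IsGeneralABMetric a β φ S)
    (hτ : IsIsotropicBerwald (dom a β S) (genAB a β φ) τ) {x : M} {u : ℝ} (hux : u = bsq a β x)
    (hu : 0 < u) : ∃ D k₀ k₂ : ℝ, ∀ s, 0 < s → s ^ 2 < u →
      Pf φ u s = τ x / c x * φ u s + D * s ∧ Rf φ u s = k₀ + k₂ * s ^ 2 := by
  obtain ⟨e, he, p, hp, rfl⟩ := exists_chart_point (n := n) x
  obtain ⟨v, hv0, hv1⟩ := exists_unit_orthogonal (a := a) (β := β) he hp hn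
  set B := sharp a β e p with hB
  have hBB : ip a e p B B = u := by rw [hux, bsq_eq_ip he hp]
  have hlB : lin β e p B = u := by rw [hux, bsq_eq_lin (a := a) he hp]
  have hBv : ip a e p B v = 0 := by rw [hB, ip_sharp he hp, hv0]
  have hNr : ∀ r : ℝ, ip a e p (B + r • v) (B + r • v) = u + r ^ 2 := fun r => by
    have := ip_comb (a := a) (e := e) (p := p) B v 1 r
    rw [one_smul, hBB, hBv, hv1] at this
    rw [this]; ring
  have hlr : ∀ r : ℝ, lin β e p (B + r • v) = u := fun r => by
    have := lin_comb (β := β) (e := e) (p := p) B v 1 r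
    rw [one_smul, hlB, hv0] at this
    rw [this]; ring
  have hNpos : ∀ r : ℝ, 0 < u + r ^ 2 := fun r => by positivity
  have hs : ∀ r : ℝ, sv a β e p (B + r • v) = u / √(u + r ^ 2) := fun r => by
    rw [sv, hNr, hlr]
  have hposS : ∀ s : ℝ, 0 < s → s ∈ S := fun s hs => by
    rcases hF.regular_or_singular with h | h
    · rw [h]; trivial
    · rw [h.1]; exact hs
  have hspos : ∀ r : ℝ, 0 < u / √(u + r ^ 2) := fun r => div_pos hu (Real.sqrt_pos.2 (hNpos r))
  have hW : ∀ r ∈ Set.univ, vec e p (B + r • v) ∈ dom a β S (e.symm p) := fun r _ => by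
    rw [vec_mem_dom_iff he hp]
    refine ⟨fun h => ?_, ?_⟩
    · have := hNr r
      rw [h] at this
      simp only [ip, PiLp.zero_apply, mul_zero, Finset.sum_const_zero] at this
      exact (hNpos r).ne this
    · rw [hs]; exact hposS _ (hspos r)
  have hin : ∀ r ∈ ({0}ᶜ : Set ℝ), (u, u / √(u + r ^ 2)) ∈ innerSet a β S := fun r hr => by
    refine ⟨⟨_, hux.symm⟩, hposS _ (hspos r), ?_⟩
    have hr2 : 0 < r ^ 2 := by have : r ≠ 0 := hr; positivity
    show (u / √(u + r ^ 2)) ^ 2 < u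
    rw [div_pow, Real.sq_sqrt (hNpos r).le, div_lt_iff₀ (hNpos r)]
    nlinarith
  have quad := fun z => quadOn_interior he hp hn hc hβ hF hτ B v isOpen_univ
    Set.ordConnected_univ hW (Set.subset_univ _) hux (fun r _ => hs r) (fun r _ => hNr r) hin z
  obtain ⟨c0, k₁, c2, hK⟩ := quad v
  obtain ⟨e0, e1, e2, hR⟩ := quad B
  -- The value of `β / α` on the line is even in `r`, so the first polynomial is odd and the second
  -- one is even.
  refine ⟨k₁ / u, e2 / u, (e0 / u - k₁ - e2) / u ^ 2, fun s hs0 hsu => ?_⟩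
  -- The parameter of the line at which `β / α` takes the value `s`.
  set r := √(u * (u - s ^ 2)) / s with hr
  have hus : 0 < u - s ^ 2 := sub_pos.2 hsu
  have hr0 : r ≠ 0 := (div_pos (Real.sqrt_pos.2 (mul_pos hu hus)) hs0).ne'
  have hr2 : r ^ 2 = u * (u - s ^ 2) / s ^ 2 := by
    rw [hr, div_pow, Real.sq_sqrt (mul_pos hu hus).le]
  have hN : u + r ^ 2 = (u / s) ^ 2 := by rw [hr2]; field_simp; ring
  have hsq : √(u + r ^ 2) = u / s := by rw [hN, Real.sqrt_sq (div_pos hu hs0).le]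
  have hsr : u / (u / s) = s := by field_simp
  have ev : ∀ r : ℝ, ip a e p v (B + r • v) = r := fun r => by
    have h1 := ip_comb_left (a := a) (e := e) (p := p) B v v 1 r
    rw [one_smul, hBv, hv1] at h1
    rw [ip_comm, h1]; ring
  have eB : ∀ r : ℝ, ip a e p B (B + r • v) = u := fun r => by rw [hB, ip_sharp he hp, hlr]
  have hK1 := hK r hr0
  have hK2 := hK (-r) (neg_ne_zero.2 hr0)
  have hR1 := hR r hr0
  have hR2 := hR (-r) (neg_ne_zero.2 hr0)
  simp only [ev, eB, hv0, hlB, neg_sq, hsq, hsr] at hK1 hK2 hR1 hR2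
  generalize hXP : Pf φ u s - τ (e.symm p) / c (e.symm p) * φ u s = X at hK1 hK2 hR1 hR2 ⊢
  have h1 : u / s * X = k₁ := by
    apply mul_right_cancel₀ hr0
    linarith
  have hX : X = k₁ / u * s := by rw [← h1]; field_simp
  refine ⟨by linarith, ?_⟩
  rw [h1, hN, hr2] at hR1
  rw [h1, hN, hr2] at hR2
  have h2 : k₁ * u + (u / s) ^ 2 * Rf φ u s * u = e0 + e2 * (u * (u - s ^ 2) / s ^ 2) := by linarith
  field_simp at h2 ⊢
  linear_combination h2

/-- The formulas of `exists_spray_coeff_of_pos` persist for `s ≤ 0` if such vectors belong to the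
domain: along the line `v + r b` all values of `s` occur, and a quadratic polynomial is determined
by its values for `r > 0`. -/
theorem exists_spray_coeff (hn : 2 ≤ n) (hc : ∀ x, c x ≠ 0)
    (hβ : IsClosedConformal a β c) (hF : IsGeneralABMetric a β φ S)
    (hτ : IsIsotropicBerwald (dom a β S) (genAB a β φ) τ) {x : M} {u : ℝ} (hux : u = bsq a β x)
    (hu : 0 < u) : ∃ D k₀ k₂ : ℝ, ∀ s ∈ S, s ^ 2 < u →
      Pf φ u s = τ x / c x * φ u s + D * s ∧ Rf φ u s = k₀ + k₂ * s ^ 2 := by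
  obtain ⟨D, k₀, k₂, H⟩ := exists_spray_coeff_of_pos hn hc hβ hF hτ hux hu
  refine ⟨D, k₀, k₂, ?_⟩
  rcases hF.regular_or_singular with hS | ⟨hS, -⟩
  swap
  · intro s hs; rw [hS] at hs; exact H s hs
  subst hS
  intro s _ hsu
  obtain ⟨e, he, p, hp, rfl⟩ := exists_chart_point (n := n) x
  obtain ⟨v, hv0, hv1⟩ := exists_unit_orthogonal (a := a) (β := β) he hp hn
  set B := sharp a β e p with hB
  have hBB : ip a e p B B = u := by rw [hux, bsq_eq_ip he hp]
  have hlB : lin β e p B = u := by rw [hux, bsq_eq_lin (a := a) he hp]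
  have hBv : ip a e p B v = 0 := by rw [hB, ip_sharp he hp, hv0]
  have hvB : ip a e p v B = 0 := by rw [ip_comm, hBv]
  have hNr : ∀ r : ℝ, ip a e p (v + r • B) (v + r • B) = 1 + r ^ 2 * u := fun r => by
    have := ip_comb (a := a) (e := e) (p := p) v B 1 r
    rw [one_smul, hBB, hvB, hv1] at this
    rw [this]; ring
  have hlr : ∀ r : ℝ, lin β e p (v + r • B) = r * u := fun r => by
    have := lin_comb (β := β) (e := e) (p := p) v B 1 r
    rw [one_smul, hlB, hv0] at this
    rw [this]; ring
  have hNpos : ∀ r : ℝ, 0 < 1 + r ^ 2 * u := fun r => by positivity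
  have hs : ∀ r : ℝ, sv a β e p (v + r • B) = r * u / √(1 + r ^ 2 * u) := fun r => by
    rw [sv, hNr, hlr]
  have hW : ∀ r ∈ Set.univ, vec e p (v + r • B) ∈ dom a β Set.univ (e.symm p) := fun r _ => by
    rw [vec_mem_dom_iff he hp]
    refine ⟨fun h => ?_, trivial⟩
    have := hNr r
    rw [h] at this
    simp only [ip, PiLp.zero_apply, mul_zero, Finset.sum_const_zero] at this
    exact (hNpos r).ne this
  have hlt : ∀ r : ℝ, (r * u / √(1 + r ^ 2 * u)) ^ 2 < u := fun r => by
    rw [div_pow, Real.sq_sqrt (hNpos r).le, div_lt_iff₀ (hNpos r)]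
    nlinarith
  have hin : ∀ r ∈ (Set.univ : Set ℝ), (u, r * u / √(1 + r ^ 2 * u)) ∈ innerSet a β Set.univ :=
    fun r _ => ⟨⟨_, hux.symm⟩, trivial, hlt r⟩
  have quad := fun z => quadOn_interior he hp hn hc hβ hF hτ v B isOpen_univ
    Set.ordConnected_univ hW (Set.subset_univ _) hux (fun r _ => hs r) (fun r _ => hNr r) hin z
  have ev : ∀ r : ℝ, ip a e p v (v + r • B) = 1 := fun r => by
    have h1 := ip_comb_left (a := a) (e := e) (p := p) v B v 1 r
    rw [one_smul, hBv, hv1] at h1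
    rw [ip_comm, h1]; ring
  have eB : ∀ r : ℝ, ip a e p B (v + r • B) = r * u := fun r => by rw [hB, ip_sharp he hp, hlr]
  have hq : ∀ r : ℝ, √(1 + r ^ 2 * u) ^ 2 = 1 + r ^ 2 * u := fun r => Real.sq_sqrt (hNpos r).le
  have hq0 : ∀ r : ℝ, 0 < √(1 + r ^ 2 * u) := fun r => Real.sqrt_pos.2 (hNpos r)
  have K := (quad v).eq_of_pos (k₀ := 0) (k₁ := D * u) (k₂ := 0) fun r hr => by
    have h := (H _ (div_pos (mul_pos hr hu) (hq0 r)) (hlt r)).1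
    have := (hq0 r).ne'
    simp only [h, ev, hv0]
    field_simp
    ring
  have R := (quad B).eq_of_pos (k₀ := k₀ * u) (k₁ := 0) (k₂ := D * u ^ 2 + k₀ * u ^ 2 + k₂ * u ^ 3)
    fun r hr => by
    have h := H _ (div_pos (mul_pos hr hu) (hq0 r)) (hlt r)
    have h0 := (hq0 r).ne'
    have h3 := (hNpos r).ne'
    simp only [h.1, h.2, eB, hlB, div_pow, hq]
    field_simp
    ring
  have hus : 0 < u - s ^ 2 := sub_pos.2 hsu
  -- The parameter of the line at which `β / α` takes the value `s`.
  set r := s / √(u * (u - s ^ 2)) with hr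
  have hr2 : r ^ 2 = s ^ 2 / (u * (u - s ^ 2)) := by
    rw [hr, div_pow, Real.sq_sqrt (mul_pos hu hus).le]
  have hN : 1 + r ^ 2 * u = u / (u - s ^ 2) := by rw [hr2]; field_simp; ring
  have hsr : r * u / √(1 + r ^ 2 * u) = s := by
    rw [hN, hr, Real.sqrt_div hu.le, Real.sqrt_mul hu.le]
    have h1 := (Real.sqrt_pos.2 hus).ne'
    have h2 := (Real.sqrt_pos.2 hu).ne'
    field_simp
    rw [Real.sq_sqrt hu.le]
  have hK := K r
  have hR := R r
  simp only [ev, eB, hv0, hlB, hsr] at hK hR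
  have h0 := (hq0 r).ne'
  have hD : Pf φ u s - τ (e.symm p) / c (e.symm p) * φ u s = D * s := by
    have : s = r * u / √(1 + r ^ 2 * u) := hsr.symm
    generalize Pf φ u s - τ (e.symm p) / c (e.symm p) * φ u s = X at *
    rw [this]; field_simp; linarith
  refine ⟨by linarith, ?_⟩
  rw [hD] at hR
  have h4 : √(1 + r ^ 2 * u) * s = r * u := by
    rw [← hsr] ; field_simp
  have h5 : s ^ 2 * (1 + r ^ 2 * u) = r ^ 2 * u ^ 2 := by
    rw [hN, hr2]; field_simp
  have h6 : (1 + r ^ 2 * u) * u * (Rf φ u s - (k₀ + k₂ * s ^ 2)) = 0 := by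
    linear_combination hR - D * r * u * h4 - k₂ * u * h5
  have h7 := mul_eq_zero.1 h6
  have h8 := (mul_pos (hNpos r) hu).ne'
  rcases h7 with h7 | h7
  · exact absurd h7 h8
  · linarith

end Smooth

/-! ### The reduced equations and quadratic relations -/

/-- The pairs `(u, s)` with `u ∈ I`, `s ∈ S` and `s² < u`. -/
def strictPairs (I S : Set ℝ) : Set (ℝ × ℝ) := {q | q.1 ∈ I ∧ q.2 ∈ S ∧ q.2 ^ 2 < q.1}

/-- The pairs `(u, s)` with `u ∈ I`, `s ∈ S` and `s² ≤ u`. -/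
def pairs (I S : Set ℝ) : Set (ℝ × ℝ) := {q | q.1 ∈ I ∧ q.2 ∈ S ∧ q.2 ^ 2 ≤ q.1}

/-- The quantity `φ - s φ_s`. -/
def wf (φ : ℝ → ℝ → ℝ) (u s : ℝ) : ℝ := φ u s - s * d2 φ u s

/-- The form to which isotropic Berwald curvature reduces: `P = σ φ + D s` and `R = k₀ + k₂ s²`,
with coefficients depending on `u` only, inserted into the equations of the spray coefficients. -/
structure Reduced (I S : Set ℝ) (φ : ℝ → ℝ → ℝ) (σ D k₀ k₂ : ℝ → ℝ) : Prop where
  isOpen : IsOpen I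
  ordConnected : I.OrdConnected
  pos_left : ∀ u ∈ I, 0 < u
  regular_or_singular : S = Set.univ ∨ S = Set.Ioi 0
  smooth : SmoothOn φ (pairs I S)
  pos : ∀ q ∈ pairs I S, 0 < φ q.1 q.2
  cvx_pos : ∀ u s, (u, s) ∈ strictPairs I S → 0 < cvx φ u s
  eq₁ : ∀ u s, (u, s) ∈ strictPairs I S → d2 (d2 φ) u s - 2 * d1 φ u s + 2 * s * d1 (d2 φ) u s
    = 2 * (k₀ u + k₂ u * s ^ 2) * cvx φ u s
  eq₂ : ∀ u s, (u, s) ∈ strictPairs I S → d2 φ u s + 2 * s * d1 φ u s =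
    2 * (k₀ u + k₂ u * s ^ 2) * (s * φ u s + (u - s ^ 2) * d2 φ u s)
      + 2 * (σ u * φ u s + D u * s) * φ u s

theorem strictPairs_subset (I S : Set ℝ) : strictPairs I S ⊆ pairs I S :=
  fun _ h => ⟨h.1, h.2.1, h.2.2.le⟩

namespace Reduced
variable {I S : Set ℝ} {φ : ℝ → ℝ → ℝ} {σ D k₀ k₂ : ℝ → ℝ} (H : Reduced I S φ σ D k₀ k₂)
include H

theorem isOpen_S : IsOpen S := by
  rcases H.regular_or_singular with h | h <;> rw [h]
  · exact isOpen_univ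
  · exact isOpen_Ioi

theorem ordConnected_S : S.OrdConnected := by
  rcases H.regular_or_singular with h | h <;> rw [h]
  · exact Set.ordConnected_univ
  · exact Set.ordConnected_Ioi

theorem mem_S {s : ℝ} (hs : 0 < s) : s ∈ S := by
  rcases H.regular_or_singular with h | h <;> rw [h]
  · trivial
  · exact hs

theorem isOpen_strictPairs : IsOpen (strictPairs I S) := by
  have h : strictPairs I S = (Prod.fst ⁻¹' I) ∩ (Prod.snd ⁻¹' S) ∩ {q | q.2 ^ 2 < q.1} := by
    ext q; simp only [strictPairs, Set.mem_ofPred_eq, Set.mem_inter_iff, Set.mem_preimage,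
        and_assoc]
  rw [h]
  exact ((H.isOpen.preimage continuous_fst).inter (H.isOpen_S.preimage continuous_snd)).inter
    (isOpen_lt (by fun_prop) (by fun_prop))

theorem smooth' : SmoothOn φ (strictPairs I S) := H.smooth.mono (strictPairs_subset I S)

theorem pos' {u s : ℝ} (h : (u, s) ∈ strictPairs I S) : 0 < φ u s :=
  H.pos _ (strictPairs_subset I S h)

omit H in
theorem slice_eq (u : ℝ) : {s | s ∈ S ∧ s ^ 2 < u} = S ∩ Set.Ioo (-√u) √u := by
  ext s; simp only [Set.mem_ofPred_eq, Set.mem_inter_iff, Set.mem_Ioo, Real.sq_lt]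

theorem isOpen_slice (u : ℝ) : IsOpen {s | s ∈ S ∧ s ^ 2 < u} := by
  rw [slice_eq]; exact H.isOpen_S.inter isOpen_Ioo

theorem ordConnected_slice (u : ℝ) : Set.OrdConnected {s | s ∈ S ∧ s ^ 2 < u} := by
  rw [slice_eq]; exact H.ordConnected_S.inter Set.ordConnected_Ioo

section
variable {u s : ℝ} (h : (u, s) ∈ strictPairs I S)
include h

theorem hasDerivAt_s : HasDerivAt (φ u) (d2 φ u s) s :=
  (H.smooth'.smoothAt H.isOpen_strictPairs h).hasDerivAt_right

theorem hasDerivAt_u : HasDerivAt (fun u => φ u s) (d1 φ u s) u :=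
  (H.smooth'.smoothAt H.isOpen_strictPairs h).hasDerivAt_left

theorem hasDerivAt_ss : HasDerivAt (d2 φ u) (d2 (d2 φ) u s) s :=
  ((H.smooth'.d2 H.isOpen_strictPairs).smoothAt H.isOpen_strictPairs h).hasDerivAt_right

theorem hasDerivAt_us : HasDerivAt (d1 φ u) (d1 (d2 φ) u s) s := by
  have h1 := ((H.smooth'.d1 H.isOpen_strictPairs).smoothAt H.isOpen_strictPairs h).hasDerivAt_right
  have h2 := H.smooth'.d1_d2_comm H.isOpen_strictPairs h
  simp only at h2
  rwa [h2]

theorem hasDerivAt_wf : HasDerivAt (wf φ u) (-(s * d2 (d2 φ) u s)) s := by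
  have := (H.hasDerivAt_s h).sub ((hasDerivAt_id s).mul (H.hasDerivAt_ss h))
  refine this.congr_deriv ?_
  simp only [id]; ring

theorem eventually_mem : ∀ᶠ r in nhds s, (u, r) ∈ strictPairs I S :=
  (H.isOpen_strictPairs.preimage (by fun_prop : Continuous fun r : ℝ => (u, r))).mem_nhds h

theorem eventually_mem_left : ∀ᶠ v in nhds u, (v, s) ∈ strictPairs I S :=
  (H.isOpen_strictPairs.preimage (by fun_prop : Continuous fun r : ℝ => (r, s))).mem_nhds h

/-- The `s`-derivative of the second equation, combined with the first one. -/
theorem two_mul_d1 : 2 * d1 φ u s = 2 * k₂ u * s * (s * φ u s + (u - s ^ 2) * d2 φ u s)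
    + 2 * σ u * φ u s * d2 φ u s + D u * φ u s + D u * s * d2 φ u s := by
  have hL := (H.hasDerivAt_ss h).add (((hasDerivAt_id s).const_mul 2).mul (H.hasDerivAt_us h))
  have hs := hasDerivAt_id s
  have hR := ((((hs.pow 2).const_mul (k₂ u)).const_add (k₀ u)).const_mul 2).mul
    ((hs.mul (H.hasDerivAt_s h)).add (((hs.pow 2).const_sub u).mul (H.hasDerivAt_ss h)))
    |>.add (((((H.hasDerivAt_s h).const_mul (σ u)).add (hs.const_mul (D u))).const_mul 2).mul
      (H.hasDerivAt_s h))
  have hev := (H.eventually_mem h).mono fun r hr => H.eq₂ u r hr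
  have := (hR.congr_of_eventuallyEq hev).unique hL
  simp only [id, Pi.pow_apply, Pi.mul_apply, Pi.add_apply] at this
  have e1 := H.eq₁ u s h
  rw [cvx] at e1
  linear_combination (-1 / 2) * this - (1 / 2) * e1

theorem mul_d2_eq : d2 φ u s * (1 - 2 * k₀ u * u) =
    (2 * σ u * φ u s + (D u + 2 * k₀ u) * s) * wf φ u s := by
  have e1 := H.two_mul_d1 h
  have e2 := H.eq₂ u s h
  rw [wf]
  linear_combination e2 - s * e1

end

/-- `φ_s` extends continuously to the boundary `|s| = √u`. -/
theorem exists_continuousOn_d2 {u l r : ℝ} (hu : u ∈ I) (hlr : l < r)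
    (hS : Set.Icc l r ⊆ S) (hl : -√u ≤ l) (hr : r ≤ √u) :
    ∃ ψ : ℝ → ℝ, ContinuousOn ψ (Set.Icc l r) ∧
      ∀ s ∈ Set.Icc l r, s ^ 2 < u → ψ s = d2 φ u s := by
  have hu0 := H.pos_left u hu
  have hmem : ∀ s ∈ Set.Icc l r, (u, s) ∈ pairs I S := fun s hs => by
    refine ⟨hu, hS hs, ?_⟩
    exact (Real.sq_le hu0.le).2 ⟨hl.trans hs.1, hs.2.trans hr⟩
  have hc : ContDiffOn ℝ ∞ (φ u) (Set.Icc l r) :=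
    H.smooth.comp (f := fun s : ℝ => (u, s)) (ContDiff.contDiffOn (by fun_prop)) hmem
  have hud := uniqueDiffOn_Icc hlr
  refine ⟨derivWithin (φ u) (Set.Icc l r), hc.continuousOn_derivWithin hud (by simp), ?_⟩
  intro s hs hsu
  exact (H.hasDerivAt_s ⟨hu, hS hs, hsu⟩).hasDerivWithinAt.derivWithin (hud s hs)

/-- Convexity makes `(φ - s φ_s) √(u - s²)` decrease to `0` as `s ↑ √u`. -/
theorem wf_pos {u s : ℝ} (h : (u, s) ∈ strictPairs I S) (hs : 0 < s) : 0 < wf φ u s := by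
  have hu0 := H.pos_left u h.1
  have hsu : s < √u := (Real.lt_sqrt hs.le).2 h.2.2
  have hS : Set.Icc s √u ⊆ S := fun r hr => H.mem_S (hs.trans_le hr.1)
  obtain ⟨ψ, hψ, hψ'⟩ := H.exists_continuousOn_d2 h.1 hsu hS
      (by linarith [Real.sqrt_nonneg u]) le_rfl
  have hφ : ContinuousOn (φ u) (Set.Icc s √u) := by
    refine H.smooth.continuousOn.comp (f := fun s : ℝ => (u, s)) (by fun_prop) fun r hr => ?_
    exact ⟨h.1, hS hr, (Real.le_sqrt (hs.le.trans hr.1) hu0.le).1 hr.2⟩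
  have hin : ∀ r ∈ Set.Icc s √u, r < √u → (u, r) ∈ strictPairs I S := fun r hr hr' =>
    ⟨h.1, hS hr, (Real.lt_sqrt (hs.le.trans hr.1)).1 hr'⟩
  have hanti : StrictAntiOn (fun r => (φ u r - r * ψ r) * √(u - r ^ 2)) (Set.Icc s √u) := by
    refine strictAntiOn_of_deriv_neg (convex_Icc _ _) (by fun_prop) fun r hr => ?_
    rw [interior_Icc] at hr
    have hr' := hin r (Set.Ioo_subset_Icc_self hr) hr.2
    have hpos : 0 < u - r ^ 2 := sub_pos.2 hr'.2.2
    have hd : HasDerivAt (fun r => wf φ u r * √(u - r ^ 2))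
        (-(r * cvx φ u r) / √(u - r ^ 2)) r := by
      have h1 : HasDerivAt (fun r : ℝ => u - r ^ 2) (-(2 * r)) r := by
        simpa using (hasDerivAt_pow 2 r).const_sub u
      refine ((H.hasDerivAt_wf hr').mul (h1.sqrt hpos.ne')).congr_deriv ?_
      have hq := (Real.sqrt_pos.2 hpos).ne'
      have hq2 := Real.sq_sqrt hpos.le
      rw [cvx, wf]
      field_simp
      rw [hq2]
      ring
    have hev : (fun r => (φ u r - r * ψ r) * √(u - r ^ 2)) =ᶠ[nhds r]
        fun r => wf φ u r * √(u - r ^ 2) := by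
      filter_upwards [isOpen_Ioo.mem_nhds hr] with t ht
      have ht' := Set.Ioo_subset_Icc_self ht
      rw [hψ' t ht' (hin t ht' ht.2).2.2, wf]
    rw [hev.deriv_eq, hd.deriv]
    have hr0 : 0 < r := hs.trans hr.1
    have := H.cvx_pos u r hr'
    exact div_neg_of_neg_of_pos (neg_neg_of_pos (mul_pos hr0 this)) (Real.sqrt_pos.2 hpos)
  have h1 := hanti (Set.left_mem_Icc.2 hsu.le) (Set.right_mem_Icc.2 hsu.le) hsu
  simp only [Real.sq_sqrt hu0.le, sub_self, Real.sqrt_zero, mul_zero] at h1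
  rw [hψ' s (Set.left_mem_Icc.2 hsu.le) h.2.2] at h1
  exact pos_of_mul_pos_left h1 (Real.sqrt_nonneg _)

end Reduced

/-- A relation `m φ² + 2 C s φ = A + B s²` holds for all `s ∈ S` with `s² < u`. -/
def RelAt (S : Set ℝ) (f : ℝ → ℝ) (u : ℝ) (v : ℝ × ℝ × ℝ × ℝ) : Prop :=
  ∀ s ∈ S, s ^ 2 < u →
    v.1 * f s ^ 2 + 2 * v.2.1 * s * f s = v.2.2.1 + v.2.2.2 * s ^ 2

namespace Reduced
variable {I S : Set ℝ} {φ : ℝ → ℝ → ℝ} {σ D k₀ k₂ : ℝ → ℝ} (H : Reduced I S φ σ D k₀ k₂)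
include H

theorem exists_s_pos {u : ℝ} (hu : u ∈ I) : (u, √u / 2) ∈ strictPairs I S ∧ 0 < √u / 2 := by
  have hu0 := H.pos_left u hu
  have h := Real.sqrt_pos.2 hu0
  refine ⟨⟨hu, H.mem_S (by positivity), ?_⟩, by positivity⟩
  simp only [div_pow, Real.sq_sqrt hu0.le]
  linarith

/-- The solutions `φ` that are linear in `s` are excluded by convexity. -/
theorem relAt_zero {u m C B : ℝ} (hu : u ∈ I) (h : RelAt S (φ u) u (m, C, 0, B)) :
    m = 0 ∧ C = 0 ∧ B = 0 := by
  have hu0 := H.pos_left u hu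
  set b := √u with hb
  have hbpos : 0 < b := Real.sqrt_pos.2 hu0
  have hin : ∀ s, 0 < s → s < b → (u, s) ∈ strictPairs I S := fun s h0 h1 =>
    ⟨hu, H.mem_S h0, (Real.lt_sqrt h0.le).1 h1⟩
  have hd : ∀ s ∈ Set.Ioo 0 b, HasDerivAt (fun s => φ u s / s) (-wf φ u s / s ^ 2) s :=
    fun s hs => by
      refine ((H.hasDerivAt_s (hin s hs.1 hs.2)).div (hasDerivAt_id s) hs.1.ne').congr_deriv ?_
      simp only [id, wf]; ring
  have hrel : ∀ s ∈ Set.Ioo 0 b, m * (φ u s / s) ^ 2 + 2 * C * (φ u s / s) = B := fun s hs => by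
    have h1 := h s (H.mem_S hs.1) (hin s hs.1 hs.2).2.2
    have := hs.1.ne'
    simp only at h1
    field_simp
    linear_combination h1
  have hrel' : ∀ s ∈ Set.Ioo 0 b, m * (φ u s / s) + C = 0 := fun s hs => by
    have h1 := (((hd s hs).pow 2).const_mul m).add ((hd s hs).const_mul (2 * C))
    have hev : (fun s => m * (φ u s / s) ^ 2 + 2 * C * (φ u s / s)) =ᶠ[nhds s] fun _ => B := by
      filter_upwards [isOpen_Ioo.mem_nhds hs] with t ht using hrel t ht
    have h2 := (((hasDerivAt_const s B).congr_of_eventuallyEq hev)).unique h1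
    have hw := (H.wf_pos (hin s hs.1 hs.2) hs.1).ne'
    have h3 : (m * (φ u s / s) + C) * (-wf φ u s / s ^ 2) = 0 := by
      norm_num at h2
      linear_combination (-1 / 2) * h2
    have hs0 := hs.1.ne'
    exact (mul_eq_zero.1 h3).resolve_right (by simp [hw, hs0])
  have hmid : b / 2 ∈ Set.Ioo 0 b := ⟨by positivity, by linarith⟩
  have hm : m = 0 := by
    have h1 := ((hd _ hmid).const_mul m).add_const C
    have hev : (fun s => m * (φ u s / s) + C) =ᶠ[nhds (b / 2)] fun _ => 0 := by
      filter_upwards [isOpen_Ioo.mem_nhds hmid] with t ht using hrel' t ht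
    have h2 := (((hasDerivAt_const (b / 2) (0 : ℝ)).congr_of_eventuallyEq hev)).unique h1
    have hw := (H.wf_pos (hin _ hmid.1 hmid.2) hmid.1).ne'
    have hs0 := hmid.1.ne'
    exact (mul_eq_zero.1 h2.symm).resolve_right (by simp [hw, hs0])
  have hC : C = 0 := by have := hrel' _ hmid; rw [hm] at this; linarith
  refine ⟨hm, hC, ?_⟩
  have := hrel _ hmid
  rw [hm, hC] at this
  linarith

/-- Where `1 - 2 k₀ u` vanishes, so do `σ` and `D + 2 k₀`. -/
theorem eq_zero_of_coeff_zero {u : ℝ} (hu : u ∈ I) (hp : 1 - 2 * k₀ u * u = 0) :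
    σ u = 0 ∧ D u + 2 * k₀ u = 0 := by
  have hu0 := H.pos_left u hu
  have hpt : ∀ s, 0 < s → (u, s) ∈ strictPairs I S → 2 * σ u * φ u s + (D u + 2 * k₀ u) * s
      = 0 := by
    intro s hs h
    have h1 := H.mul_d2_eq h
    rw [hp, mul_zero] at h1
    exact (mul_eq_zero.1 h1.symm).resolve_right (H.wf_pos h hs).ne'
  obtain ⟨h, h0⟩ := H.exists_s_pos hu
  set s := √u / 2
  have h1 : HasDerivAt (fun s => 2 * σ u * φ u s + (D u + 2 * k₀ u) * s)
      (2 * σ u * d2 φ u s + (D u + 2 * k₀ u) * 1) s :=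
    ((H.hasDerivAt_s h).const_mul _).add ((hasDerivAt_id s).const_mul _)
  have hev : (fun s => 2 * σ u * φ u s + (D u + 2 * k₀ u) * s) =ᶠ[nhds s] fun _ => 0 := by
    filter_upwards [H.eventually_mem h, lt_mem_nhds h0] with t ht ht' using hpt t ht' ht
  have h2 := ((hasDerivAt_const s (0 : ℝ)).congr_of_eventuallyEq hev).unique h1
  have h3 := hpt s h0 h
  have hw := H.wf_pos h h0
  rw [wf] at hw
  have h4 : σ u * (φ u s - s * d2 φ u s) = 0 := by linear_combination (1 / 2) * h3 + (1 / 2) * s *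
      h2
  have h5 := (mul_eq_zero.1 h4).resolve_right hw.ne'
  refine ⟨h5, ?_⟩
  rw [h5] at h2; linarith

/-- The equation `(1 - 2 k₀ u) φ_s = (2 σ φ + (D + 2 k₀) s) (φ - s φ_s)` integrates to a quadratic
relation, in which `m` is the constant of integration. -/
theorem exists_relAt {u : ℝ} (hu : u ∈ I) :
    ∃ m, RelAt S (φ u) u (m, -2 * σ u, 1 - 2 * k₀ u * u, D u + 2 * k₀ u) := by
  obtain ⟨m, hm⟩ := exists_const_of_hasDerivAt_zero
    (f := fun s => ((1 - 2 * k₀ u * u) + (D u + 2 * k₀ u) * s ^ 2 + 4 * σ u * (s * φ u s)) /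
        φ u s ^ 2)
    (H.isOpen_slice u) (H.ordConnected_slice u) fun s hs => by
      have h : (u, s) ∈ strictPairs I S := ⟨hu, hs.1, hs.2⟩
      have hφ := (H.pos' h).ne'
      have hd := H.hasDerivAt_s h
      have h1 := ((((hasDerivAt_pow 2 s).const_mul (D u + 2 * k₀ u)).const_add
          (1 - 2 * k₀ u * u)).add
        (((hasDerivAt_id s).mul hd).const_mul (4 * σ u))).div (hd.pow 2) (pow_ne_zero 2 hφ)
      refine h1.congr_deriv ?_
      have h2 := H.mul_d2_eq h
      rw [wf] at h2
      rw [div_eq_zero_iff]; left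
      simp only [id, Pi.pow_apply, Pi.mul_apply, Pi.add_apply]
      norm_num
      linear_combination (-2) * φ u s * h2
  refine ⟨m, fun s hs hsu => ?_⟩
  have h1 := hm s ⟨hs, hsu⟩
  have hφ := (H.pos' ⟨hu, hs, hsu⟩).ne'
  simp only at h1 ⊢
  rw [div_eq_iff (pow_ne_zero 2 hφ)] at h1
  linear_combination -h1

end Reduced

/-! ### Characteristics and the transport of relations -/

theorem exists_antideriv {I : Set ℝ} (hI : IsOpen I) (hI' : I.OrdConnected) {k : ℝ → ℝ}
    (hk : ContinuousOn k I) : ∃ T : ℝ → ℝ, ∀ u ∈ I, HasDerivAt T (k u) u := by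
  rcases I.eq_empty_or_nonempty with rfl | ⟨u₀, h₀⟩
  · exact ⟨0, fun u hu => hu.elim⟩
  refine ⟨fun u => ∫ x in u₀..u, k x, fun u hu => ?_⟩
  exact intervalIntegral.integral_hasDerivAt_right
    ((hk.mono (hI'.uIcc_subset h₀ hu)).intervalIntegrable)
    (hk.stronglyMeasurableAtFilter hI u hu) (hk.continuousAt (hI.mem_nhds hu))

/-- A solution of a homogeneous linear equation `f' = k f` that vanishes at a point vanishes. -/
theorem eq_zero_of_hasDerivAt_mul {I : Set ℝ} (hI : IsOpen I) (hI' : I.OrdConnected) {k f : ℝ → ℝ}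
    (hk : ContinuousOn k I) (hf : ∀ u ∈ I, HasDerivAt f (k u * f u) u) {u₀ : ℝ} (h₀ : u₀ ∈ I)
    (hz : f u₀ = 0) : ∀ u ∈ I, f u = 0 := by
  obtain ⟨K, hK⟩ := exists_antideriv hI hI' hk
  obtain ⟨q, hq⟩ := exists_const_of_hasDerivAt_zero (f := fun u => f u * Real.exp (-K u)) hI hI'
    fun u hu => ((hf u hu).mul (hK u hu).neg.exp).congr_deriv (by ring)
  have h1 := hq u₀ h₀
  simp only [hz, zero_mul] at h1
  intro u hu
  have h2 := hq u hu
  rw [← h1] at h2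
  exact (mul_eq_zero.1 h2).resolve_right (Real.exp_ne_zero _)

/-- The characteristics `s² = u / (1 + κ e^T)` of the transport equation for `φ`. -/
def charCurve (T : ℝ → ℝ) (κ ε u : ℝ) : ℝ := ε * √(u / (1 + κ * Real.exp (T u)))

theorem charCurve_sq {T : ℝ → ℝ} {κ ε u : ℝ} (hκ : 0 ≤ κ) (hε : ε ^ 2 = 1) (hu : 0 < u) :
    charCurve T κ ε u ^ 2 = u / (1 + κ * Real.exp (T u)) := by
  rw [charCurve, mul_pow, hε, one_mul, Real.sq_sqrt (by positivity)]

theorem charCurve_ne_zero {T : ℝ → ℝ} {κ ε u : ℝ} (hκ : 0 ≤ κ) (hε : ε ^ 2 = 1) (hu : 0 < u) :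
    charCurve T κ ε u ≠ 0 := by
  intro h
  have h2 : 0 < charCurve T κ ε u ^ 2 := by rw [charCurve_sq hκ hε hu]; positivity
  rw [h] at h2
  simp at h2

/-- Every `s ≠ 0` with `s² ≤ u` lies on a characteristic. -/
theorem charCurve_eq {T : ℝ → ℝ} {ε u s : ℝ} (hε : 0 < ε * s) (hε' : ε ^ 2 = 1) (hu : 0 < u) :
    charCurve T ((u / s ^ 2 - 1) * Real.exp (-T u)) ε u = s := by
  have hs : s ≠ 0 := by rintro rfl; simp at hε
  rw [charCurve, mul_assoc, ← Real.exp_add]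
  simp only [neg_add_cancel, Real.exp_zero, mul_one, add_sub_cancel]
  have h1 : u / (u / s ^ 2) = (ε * s) ^ 2 := by rw [mul_pow, hε']; field_simp
  rw [h1, Real.sqrt_sq hε.le, ← mul_assoc, ← sq, hε', one_mul]

/-- The quantity `φ u e^{-T/2} / s`, constant along characteristics where `1 - 2 k₀ u = 0`. -/
def charInt (φ : ℝ → ℝ → ℝ) (T : ℝ → ℝ) (u s : ℝ) : ℝ := φ u s * u * Real.exp (-T u / 2) / s

namespace Reduced
variable {I S : Set ℝ} {φ : ℝ → ℝ → ℝ} {σ D k₀ k₂ : ℝ → ℝ} (H : Reduced I S φ σ D k₀ k₂)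
include H

theorem Rf_eq {u s : ℝ} (h : (u, s) ∈ strictPairs I S) : Rf φ u s = k₀ u + k₂ u * s ^ 2 := by
  have := (H.cvx_pos u s h).ne'
  rw [Rf, H.eq₁ u s h]; field_simp

theorem smoothOn_Rf : SmoothOn (Rf φ) (strictPairs I S) := by
  have hO := H.isOpen_strictPairs
  have h1 := H.smooth'.d1 hO
  have h2 := H.smooth'.d2 hO
  have h22 := h2.d2 hO
  have h12 := h2.d1 hO
  have hs : ContDiffOn ℝ ∞ (fun q : ℝ × ℝ => q.2) (strictPairs I S) := contDiffOn_snd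
  have hu : ContDiffOn ℝ ∞ (fun q : ℝ × ℝ => q.1) (strictPairs I S) := contDiffOn_fst
  unfold Rf cvx
  refine ((h22.sub (contDiffOn_const.mul h1)).add ((contDiffOn_const.mul hs).mul h12)).div
    (contDiffOn_const.mul ((H.smooth'.sub (hs.mul h2)).add ((hu.sub (hs.pow 2)).mul h22))) ?_
  intro q hq
  exact mul_ne_zero two_ne_zero (H.cvx_pos q.1 q.2 hq).ne'

theorem smoothAt_left {f : ℝ → ℝ → ℝ} (hf : SmoothOn f (strictPairs I S)) {u s : ℝ}
    (h : (u, s) ∈ strictPairs I S) : ContDiffAt ℝ ∞ (fun v => f v s) u :=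
  (hf.smoothAt H.isOpen_strictPairs h).comp (f := fun v : ℝ => (v, s)) u
    (ContDiff.contDiffAt (by fun_prop))

theorem contDiffOn_k₂ : ContDiffOn ℝ ∞ k₂ I := by
  intro u hu
  obtain ⟨h, h0⟩ := H.exists_s_pos hu
  set s := √u / 2
  have h' : (u, s / 2) ∈ strictPairs I S := ⟨hu, H.mem_S (by positivity), by
    have := h.2.2; simp only at this ⊢; nlinarith⟩
  refine ContDiffAt.contDiffWithinAt (ContDiffAt.congr_of_eventuallyEq
    (f := fun v => (Rf φ v s - Rf φ v (s / 2)) / (3 / 4 * s ^ 2))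
    (((H.smoothAt_left H.smoothOn_Rf h).sub (H.smoothAt_left H.smoothOn_Rf h')).div_const _) ?_)
  filter_upwards [H.eventually_mem_left h, H.eventually_mem_left h'] with v hv hv'
  rw [H.Rf_eq hv, H.Rf_eq hv', eq_div_iff (by positivity)]
  ring

theorem contDiffOn_k₀ : ContDiffOn ℝ ∞ k₀ I := by
  intro u hu
  obtain ⟨h, h0⟩ := H.exists_s_pos hu
  set s := √u / 2
  refine ContDiffAt.contDiffWithinAt (ContDiffAt.congr_of_eventuallyEq
    (f := fun v => Rf φ v s - k₂ v * s ^ 2)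
    ((H.smoothAt_left H.smoothOn_Rf h).sub
      ((H.contDiffOn_k₂.contDiffAt (H.isOpen.mem_nhds hu)).mul contDiffAt_const)) ?_)
  filter_upwards [H.eventually_mem_left h] with v hv
  rw [H.Rf_eq hv]; ring

theorem exists_T : ∃ T : ℝ → ℝ, ∀ u ∈ I, HasDerivAt T (2 * k₂ u * u) u :=
  exists_antideriv H.isOpen H.ordConnected
    ((continuousOn_const.mul H.contDiffOn_k₂.continuousOn).mul continuousOn_id)

theorem charCurve_mem {T : ℝ → ℝ} {κ ε u : ℝ} (hκ : 0 < κ) (hε : ε ^ 2 = 1) (hεS : ε ∈ S)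
    (hu : u ∈ I) : (u, charCurve T κ ε u) ∈ strictPairs I S := by
  have hu0 := H.pos_left u hu
  refine ⟨hu, ?_, ?_⟩
  · rcases H.regular_or_singular with h | h
    · rw [h]; trivial
    · rw [h] at hεS ⊢
      exact mul_pos hεS (Real.sqrt_pos.2 (by positivity))
  · simp only [charCurve_sq hκ.le hε hu0]
    rw [div_lt_iff₀ (by positivity)]
    have : 0 < κ * Real.exp (T u) := by positivity
    nlinarith

/-- Where `1 - 2 k₀ u` vanishes, `σ = 0` and `D = -1 / u`, so the equation for `φ_u` is a linear
transport equation. -/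
theorem hasDerivAt_charInt {T : ℝ → ℝ} (hT : ∀ u ∈ I, HasDerivAt T (2 * k₂ u * u) u) {κ ε u : ℝ}
    (hκ : 0 < κ) (hε : ε ^ 2 = 1) (hεS : ε ∈ S) (hu : u ∈ I) (hp : 1 - 2 * k₀ u * u = 0) :
    HasDerivAt (fun u => charInt φ T u (charCurve T κ ε u)) 0 u := by
  have hu0 := H.pos_left u hu
  have hmem := H.charCurve_mem (T := T) hκ hε hεS hu
  have hsq := charCurve_sq (T := T) hκ.le hε hu0
  have hs0 := charCurve_ne_zero (T := T) hκ.le hε hu0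
  have hEpos : 0 < 1 + κ * Real.exp (T u) := by positivity
  obtain ⟨hσ, hq⟩ := H.eq_zero_of_coeff_zero hu hp
  have hk₀ : k₀ u = 1 / (2 * u) := by field_simp; linarith
  have hD : D u = -1 / u := by rw [hk₀] at hq; field_simp at hq ⊢; linarith
  have hQ : HasDerivAt (fun u => u / (1 + κ * Real.exp (T u)))
      ((1 * (1 + κ * Real.exp (T u)) - u * (κ * (Real.exp (T u) * (2 * k₂ u * u))))
        / (1 + κ * Real.exp (T u)) ^ 2) u :=
    (hasDerivAt_id u).div (((hT u hu).exp.const_mul κ).const_add 1) hEpos.ne'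
  have hs : HasDerivAt (charCurve T κ ε)
      (charCurve T κ ε u / (2 * u) - k₂ u * charCurve T κ ε u * (u - charCurve T κ ε u ^ 2)) u := by
    refine ((hQ.sqrt (by positivity)).const_mul ε).congr_deriv ?_
    have h1 : ε * √(u / (1 + κ * Real.exp (T u))) = charCurve T κ ε u := rfl
    have h2 : 0 < √(u / (1 + κ * Real.exp (T u))) := Real.sqrt_pos.2 (by positivity)
    have h3 : √(u / (1 + κ * Real.exp (T u))) ^ 2 = u / (1 + κ * Real.exp (T u)) :=
      Real.sq_sqrt (by positivity)
    rw [hsq, ← h1]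
    set r := √(u / (1 + κ * Real.exp (T u)))
    set X := κ * Real.exp (T u) with hX
    have h4 : κ * (Real.exp (T u) * (2 * k₂ u * u)) = X * (2 * k₂ u * u) := by rw [hX]; ring
    rw [h4]
    field_simp
    rw [h3]
    field_simp
    ring
  have hφ := (H.smooth'.smoothAt H.isOpen_strictPairs hmem).hasDerivAt_comp (hasDerivAt_id u) hs
  have hexp : HasDerivAt (fun u => Real.exp (-T u / 2))
      (Real.exp (-T u / 2) * (-(2 * k₂ u * u) / 2)) u :=
    ((hT u hu).neg.div_const 2).exp
  have hfin := ((hφ.mul (hasDerivAt_id u)).mul hexp).div hs hs0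
  refine hfin.congr_deriv ?_
  have h3 := H.two_mul_d1 hmem
  rw [hσ, hD] at h3
  simp only [id, Pi.mul_apply] at h3 ⊢
  rw [div_eq_zero_iff]; left
  set s := charCurve T κ ε u
  set f := φ u s
  set fs := d2 φ u s
  have h3' : d1 φ u s = k₂ u * s * (s * f + (u - s ^ 2) * fs) - f / (2 * u) - s * fs / (2 * u) := by
    field_simp at h3 ⊢
    linear_combination (1 / 1) * h3
  rw [h3']
  field_simp
  ring

theorem charInt_const {T : ℝ → ℝ} (hT : ∀ u ∈ I, HasDerivAt T (2 * k₂ u * u) u) {κ ε u₀ u₁ : ℝ}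
    (hκ : 0 < κ) (hε : ε ^ 2 = 1) (hεS : ε ∈ S) (h₀ : u₀ ∈ I) (h₁ : u₁ ∈ I)
    (hp : ∀ u ∈ Set.uIcc u₀ u₁, 1 - 2 * k₀ u * u = 0) :
    charInt φ T u₁ (charCurve T κ ε u₁) = charInt φ T u₀ (charCurve T κ ε u₀) := by
  have h := (convex_uIcc u₀ u₁).norm_image_sub_le_of_norm_hasDerivWithin_le (C := 0)
    (f := fun u => charInt φ T u (charCurve T κ ε u)) (f' := fun _ => 0)
    (fun u hu => (H.hasDerivAt_charInt hT hκ hε hεS (H.ordConnected.uIcc_subset h₀ h₁ hu)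
      (hp u hu)).hasDerivWithinAt) (by simp) Set.left_mem_uIcc Set.right_mem_uIcc
  rw [zero_mul, norm_le_zero_iff, sub_eq_zero] at h
  exact h

theorem continuousOn_slice {u : ℝ} (hu : u ∈ I) :
    ContinuousOn (φ u) {s | s ∈ S ∧ s ^ 2 ≤ u} :=
  H.smooth.continuousOn.comp (f := fun s : ℝ => (u, s)) (by fun_prop) fun _ hs => ⟨hu, hs.1, hs.2⟩

/-- Where `1 - 2 k₀ u` vanishes, a relation is carried from `u₀` to `u₁` along the characteristics:
`φ / s` is multiplied by a factor common to all characteristics, and `1 / s²` undergoes an affine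
map. -/
theorem relAt_transport {u₀ u₁ : ℝ} (h₀ : u₀ ∈ I) (h₁ : u₁ ∈ I)
    (hp : ∀ u ∈ Set.uIcc u₀ u₁, 1 - 2 * k₀ u * u = 0) {v : ℝ × ℝ × ℝ × ℝ} (hv : v ≠ 0)
    (hrel : RelAt S (φ u₀) u₀ v) : ∃ w ≠ 0, RelAt S (φ u₁) u₁ w := by
  obtain ⟨T, hT⟩ := H.exists_T
  have hu₀ := H.pos_left u₀ h₀
  have hu₁ := H.pos_left u₁ h₁
  obtain ⟨m, C, A, B⟩ := v
  obtain ⟨x₀, hx₀⟩ : ∃ x, x = Real.exp (-T u₀ / 2) := ⟨_, rfl⟩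
  obtain ⟨x₁, hx₁⟩ : ∃ x, x = Real.exp (-T u₁ / 2) := ⟨_, rfl⟩
  have hx₀p : 0 < x₀ := hx₀ ▸ Real.exp_pos _
  have hx₁p : 0 < x₁ := hx₁ ▸ Real.exp_pos _
  obtain ⟨l, hl⟩ : ∃ l, l = u₁ * x₁ / (u₀ * x₀) := ⟨_, rfl⟩
  have hlp : 0 < l := by rw [hl]; positivity
  have hE : Real.exp (T u₀) * Real.exp (-T u₁) = x₁ ^ 2 / x₀ ^ 2 := by
    rw [hx₀, hx₁, ← Real.exp_nat_mul, ← Real.exp_nat_mul, ← Real.exp_add, ← Real.exp_sub]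
    congr 1; push_cast; ring
  -- The relation at `u₀` with `φ(u₀, t) = l φ(u₁, s) t / s` and
  -- `u₀ / t² = 1 + (u₁ / s² - 1) (x₁ / x₀)²` inserted, where `t` and `s` lie on one characteristic.
  set w : ℝ × ℝ × ℝ × ℝ := (m * l ^ 2, C * l, A * u₁ * (x₁ ^ 2 / x₀ ^ 2) / u₀,
    B + A * (1 - x₁ ^ 2 / x₀ ^ 2) / u₀) with hw
  have hne : ∀ s ∈ S, s ≠ 0 → s ^ 2 < u₁ →
      w.1 * φ u₁ s ^ 2 + 2 * w.2.1 * s * φ u₁ s = w.2.2.1 + w.2.2.2 * s ^ 2 := by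
    intro s hs hs0 hsu
    obtain ⟨ε, hε, hεs, hεS⟩ : ∃ ε : ℝ, ε ^ 2 = 1 ∧ 0 < ε * s ∧ ε ∈ S := by
      rcases lt_or_gt_of_ne hs0 with h | h
      · refine ⟨-1, by norm_num, by linarith, ?_⟩
        rcases H.regular_or_singular with h' | h'
        · rw [h']; trivial
        · rw [h'] at hs; exact absurd hs (not_lt.2 h.le)
      · exact ⟨1, by norm_num, by linarith, H.mem_S one_pos⟩
    set κ := (u₁ / s ^ 2 - 1) * Real.exp (-T u₁) with hκ
    have hκp : 0 < κ := by
      refine mul_pos (sub_pos.2 ?_) (Real.exp_pos _)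
      rw [lt_div_iff₀ (by positivity)]; linarith
    have h1 := H.charInt_const hT hκp hε hεS h₀ h₁ hp
    have h2 : charCurve T κ ε u₁ = s := charCurve_eq hεs hε hu₁
    have h3 := charCurve_sq (T := T) hκp.le hε hu₀
    have h4 := charCurve_ne_zero (T := T) hκp.le hε hu₀
    have h5 := H.charCurve_mem (T := T) hκp hε hεS h₀
    have h6 := hrel _ h5.2.1 h5.2.2
    rw [h2, charInt, charInt, ← hx₀, ← hx₁] at h1
    set t := charCurve T κ ε u₀
    simp only at h6 ⊢
    have h7 : φ u₀ t = l * φ u₁ s / s * t := by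
      rw [hl]; field_simp at h1 ⊢; linear_combination -h1
    have h8 : κ * Real.exp (T u₀) = (u₁ / s ^ 2 - 1) * (x₁ ^ 2 / x₀ ^ 2) := by
      rw [hκ, ← hE]; ring
    rw [h8] at h3
    have h9 : 0 < 1 + (u₁ / s ^ 2 - 1) * (x₁ ^ 2 / x₀ ^ 2) := by
      rw [← h8]; positivity
    have h10 : t ^ 2 * (1 + (u₁ / s ^ 2 - 1) * (x₁ ^ 2 / x₀ ^ 2)) = u₀ := by
      rw [h3, div_mul_cancel₀ _ h9.ne']
    rw [h7] at h6
    have h11 : t ^ 2 * (m * (l * φ u₁ s / s) ^ 2 + 2 * C * (l * φ u₁ s / s)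
        - A / u₀ * (1 + (u₁ / s ^ 2 - 1) * (x₁ ^ 2 / x₀ ^ 2)) - B) = 0 := by
      have : A = A / u₀ * u₀ := by field_simp
      linear_combination h6 + this - A / u₀ * h10
    have h12 := (mul_eq_zero.1 h11).resolve_left (pow_ne_zero 2 h4)
    have h13 : u₁ / s ^ 2 * s ^ 2 = u₁ := by field_simp
    have h14 : φ u₁ s / s * s = φ u₁ s := by field_simp
    rw [← h14]
    linear_combination s ^ 2 * h12 + A / u₀ * (x₁ ^ 2 / x₀ ^ 2) * h13
  refine ⟨w, ?_, ?_⟩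
  · intro h0
    apply hv
    simp only [hw, Prod.mk_eq_zero] at h0 ⊢
    obtain ⟨e1, e2, e3, e4⟩ := h0
    have hm : m = 0 := by simpa [hlp.ne'] using e1
    have hC : C = 0 := by simpa [hlp.ne'] using e2
    have hA : A = 0 := by simpa [hu₀.ne', hu₁.ne', hx₀p.ne', hx₁p.ne'] using e3
    rw [hA] at e4
    exact ⟨hm, hC, hA, by simpa using e4⟩
  · intro s hs hsu
    by_cases hs0 : s = 0
    -- No characteristic reaches `s = 0`, where the relation holds by continuity.
    · subst hs0
      have hmem : (u₁, (0 : ℝ)) ∈ strictPairs I S := ⟨h₁, hs, hsu⟩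
      have hc := (H.hasDerivAt_s hmem).continuousAt
      have hev : ∀ᶠ r in nhdsWithin (0 : ℝ) {0}ᶜ,
          w.1 * φ u₁ r ^ 2 + 2 * w.2.1 * r * φ u₁ r = w.2.2.1 + w.2.2.2 * r ^ 2 := by
        filter_upwards [nhdsWithin_le_nhds (H.eventually_mem hmem),
            self_mem_nhdsWithin] with r hr hr0
        exact hne r hr.2.1 hr0 hr.2.2
      have hl : Filter.Tendsto (fun r => w.1 * φ u₁ r ^ 2 + 2 * w.2.1 * r * φ u₁ r)
          (nhdsWithin (0 : ℝ) {0}ᶜ)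
          (nhds (w.1 * φ u₁ 0 ^ 2 + 2 * w.2.1 * 0 * φ u₁ 0)) :=
        (ContinuousAt.tendsto (by fun_prop)).mono_left nhdsWithin_le_nhds
      have hr : Filter.Tendsto (fun r => w.2.2.1 + w.2.2.2 * r ^ 2) (nhdsWithin (0 : ℝ) {0}ᶜ)
          (nhds (w.2.2.1 + w.2.2.2 * 0 ^ 2)) :=
        (ContinuousAt.tendsto (by fun_prop)).mono_left nhdsWithin_le_nhds
      exact tendsto_nhds_unique (hl.congr' hev) hr
    · exact hne s hs hs0 hsu

end Reduced

/-! ### The dichotomy and the normalized relation -/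

theorem RelAt.smul {S : Set ℝ} {f : ℝ → ℝ} {u : ℝ} {v : ℝ × ℝ × ℝ × ℝ} (h : RelAt S f u v) (r : ℝ) :
    RelAt S f u (r • v) := by
  intro s hs hsu
  have := h s hs hsu
  simp only [Prod.smul_fst, Prod.smul_snd, smul_eq_mul]
  linear_combination r * this

theorem RelAt.sub {S : Set ℝ} {f : ℝ → ℝ} {u : ℝ} {v w : ℝ × ℝ × ℝ × ℝ} (h : RelAt S f u v)
    (h' : RelAt S f u w) : RelAt S f u (v - w) := by
  intro s hs hsu
  have h1 := h s hs hsu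
  have h2 := h' s hs hsu
  simp only [Prod.fst_sub, Prod.snd_sub]
  linear_combination h1 - h2

theorem eq_right_of_eqOn_Ico {f g : ℝ → ℝ} {l r : ℝ} (hlr : l < r)
    (hf : ContinuousOn f (Set.Icc l r))
    (hg : ContinuousOn g (Set.Icc l r)) (h : ∀ x ∈ Set.Ico l r, f x = g x) : f r = g r :=
  (show Set.EqOn f g (Set.Ico l r) from h).of_subset_closure hf hg Set.Ico_subset_Icc_self
    (by rw [closure_Ico hlr.ne]) (Set.right_mem_Icc.2 hlr.le)

namespace Reduced
variable {I S : Set ℝ} {φ : ℝ → ℝ → ℝ} {σ D k₀ k₂ : ℝ → ℝ} (H : Reduced I S φ σ D k₀ k₂)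
include H

/-- Relations scaled to unit length have convergent subsequences, so they survive limits in `u`. -/
theorem exists_relAt_of_mem_closure {u : ℝ} (hu : u ∈ I)
    (h : u ∈ closure {v ∈ I | ∃ w ≠ 0, RelAt S (φ v) v w}) : ∃ w ≠ 0, RelAt S (φ u) u w := by
  obtain ⟨x, hx, hxu⟩ := mem_closure_iff_seq_limit.1 h
  choose hxI w hw hrel using hx
  set v : ℕ → ℝ × ℝ × ℝ × ℝ := fun k => (‖w k‖⁻¹) • w k with hv
  have hvs : ∀ k, v k ∈ Metric.sphere (0 : ℝ × ℝ × ℝ × ℝ) 1 := fun k => by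
    rw [mem_sphere_zero_iff_norm, hv, norm_smul, norm_inv, norm_norm,
      inv_mul_cancel₀ (norm_ne_zero_iff.2 (hw k))]
  obtain ⟨z, hz, ρ, hρ, hlim⟩ := (isCompact_sphere (0 : ℝ × ℝ × ℝ × ℝ) 1).tendsto_subseq hvs
  refine ⟨z, fun h0 => ?_, fun s hs hsu => ?_⟩
  · rw [h0] at hz; simp at hz
  have hx' : Filter.Tendsto (fun k => x (ρ k)) Filter.atTop (nhds u) := hxu.comp hρ.tendsto_atTop
  have hmem : (u, s) ∈ strictPairs I S := ⟨hu, hs, hsu⟩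
  have hφ : Filter.Tendsto (fun k => φ (x (ρ k)) s) Filter.atTop (nhds (φ u s)) :=
    (H.hasDerivAt_u hmem).continuousAt.tendsto.comp hx'
  have hev : ∀ᶠ k in Filter.atTop, (v (ρ k)).1 * φ (x (ρ k)) s ^ 2
      + 2 * (v (ρ k)).2.1 * s * φ (x (ρ k)) s = (v (ρ k)).2.2.1 + (v (ρ k)).2.2.2 * s ^ 2 := by
    filter_upwards [hx'.eventually (H.eventually_mem_left hmem)] with k hk
    exact (hrel (ρ k)).smul _ s hk.2.1 hk.2.2
  have h1 : Filter.Tendsto (fun k => (v (ρ k)).1) Filter.atTop (nhds z.1) :=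
    (continuous_fst.tendsto z).comp hlim
  have h2 : Filter.Tendsto (fun k => (v (ρ k)).2.1) Filter.atTop (nhds z.2.1) :=
    ((by fun_prop : Continuous fun z : ℝ × ℝ × ℝ × ℝ => z.2.1).tendsto z).comp hlim
  have h3 : Filter.Tendsto (fun k => (v (ρ k)).2.2.1) Filter.atTop (nhds z.2.2.1) :=
    ((by fun_prop : Continuous fun z : ℝ × ℝ × ℝ × ℝ => z.2.2.1).tendsto z).comp hlim
  have h4 : Filter.Tendsto (fun k => (v (ρ k)).2.2.2) Filter.atTop (nhds z.2.2.2) :=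
    ((by fun_prop : Continuous fun z : ℝ × ℝ × ℝ × ℝ => z.2.2.2).tendsto z).comp hlim
  exact tendsto_nhds_unique_of_eventuallyEq
    ((h1.mul (hφ.pow 2)).add (((h2.const_mul 2).mul_const s).mul hφ)) (h3.add (h4.mul_const _)) hev

/-- Either `1 - 2 k₀ u` vanishes identically, or a quadratic relation between `φ` and `s` holds at
every `u`: such relations survive limits, and are transported where `1 - 2 k₀ u` vanishes. -/
theorem coeff_zero_or_relAt : (∀ u ∈ I, 1 - 2 * k₀ u * u = 0) ∨
    ∀ u ∈ I, ∃ w ≠ 0, RelAt S (φ u) u w := by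
  by_cases hall : ∀ u ∈ I, 1 - 2 * k₀ u * u = 0
  · exact Or.inl hall
  right
  push Not at hall
  obtain ⟨u₀, h₀, hp₀⟩ := hall
  have hne : ∀ u ∈ I, 1 - 2 * k₀ u * u ≠ 0 → ∃ w ≠ 0, RelAt S (φ u) u w := fun u hu hp => by
    obtain ⟨m, hm⟩ := H.exists_relAt hu
    refine ⟨_, fun h => hp ?_, hm⟩
    simp only [Prod.mk_eq_zero] at h
    exact h.2.2.1
  intro u₁ h₁
  by_cases hp₁ : 1 - 2 * k₀ u₁ * u₁ = 0
  swap
  · exact hne u₁ h₁ hp₁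
  -- Let `u` be a point nearest to `u₁` in the closure of the points between `u₀` and `u₁` where
  -- `1 - 2 k₀ u` does not vanish. A relation holds at `u`, and `1 - 2 k₀ v` vanishes for `v`
  -- between `u` and `u₁`.
  set K := {u ∈ Set.uIcc u₀ u₁ | 1 - 2 * k₀ u * u ≠ 0} with hK
  have hsub : Set.uIcc u₀ u₁ ⊆ I := H.ordConnected.uIcc_subset h₀ h₁
  have hKc : closure K ⊆ Set.uIcc u₀ u₁ := closure_minimal (fun u hu => hu.1) isClosed_Icc
  have hcomp : IsCompact (closure K) := isCompact_uIcc.of_isClosed_subset isClosed_closure hKc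
  obtain ⟨u, hu, hmin⟩ := hcomp.exists_isMinOn ⟨u₀, subset_closure ⟨Set.left_mem_uIcc, hp₀⟩⟩
    (f := fun u => |u - u₁|) (by fun_prop)
  have huI := hsub (hKc hu)
  have hrel : ∃ w ≠ 0, RelAt S (φ u) u w := by
    refine H.exists_relAt_of_mem_closure huI (closure_mono ?_ hu)
    exact fun v hv => ⟨hsub hv.1, hne v (hsub hv.1) hv.2⟩
  have hcloser : ∀ t ∈ Set.Ioc (0 : ℝ) 1, u ≠ u₁ →
      1 - 2 * k₀ (u + t * (u₁ - u)) * (u + t * (u₁ - u)) = 0 := fun t ht hne' => by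
    by_contra hp
    have hmem : u + t * (u₁ - u) ∈ K := by
      refine ⟨?_, hp⟩
      have : u + t * (u₁ - u) ∈ segment ℝ u u₁ :=
          ⟨1 - t, t, by linarith [ht.2], ht.1.le, by ring, by
        simp only [smul_eq_mul]; ring⟩
      rw [segment_eq_uIcc] at this
      exact Set.uIcc_subset_uIcc (hKc hu) Set.right_mem_uIcc this
    have h1 := hmin (subset_closure hmem)
    simp only [Set.mem_ofPred_eq] at h1
    have h2 : u + t * (u₁ - u) - u₁ = (1 - t) * (u - u₁) := by ring
    rw [h2, abs_mul, abs_of_nonneg (by linarith [ht.2] : (0 : ℝ) ≤ 1 - t)] at h1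
    have h3 : 0 < |u - u₁| := abs_pos.2 (sub_ne_zero.2 hne')
    have := ht.1
    nlinarith
  have hpu : 1 - 2 * k₀ u * u = 0 := by
    by_cases huu : u = u₁
    · rw [huu]; exact hp₁
    have hc : ContinuousAt (fun v => 1 - 2 * k₀ v * v) u := by
      have := (H.contDiffOn_k₀.continuousOn).continuousAt (H.isOpen.mem_nhds huI)
      fun_prop
    have hpath : Filter.Tendsto (fun t : ℝ => u + t * (u₁ - u)) (nhdsWithin 0 (Set.Ioi 0))
        (nhds u) := by
      have : ContinuousAt (fun t : ℝ => u + t * (u₁ - u)) 0 := by fun_prop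
      simpa using this.tendsto.mono_left nhdsWithin_le_nhds
    have h1 := hc.tendsto.comp hpath
    refine tendsto_nhds_unique_of_eventuallyEq h1 (tendsto_const_nhds (x := (0 : ℝ))) ?_
    filter_upwards [Ioc_mem_nhdsGT (zero_lt_one' ℝ)] with t ht using hcloser t ht huu
  obtain ⟨w, hw, hr⟩ := hrel
  refine H.relAt_transport huI h₁ (fun v hv => ?_) hw hr
  rw [← segment_eq_uIcc] at hv
  obtain ⟨x, y, hx, hy, hxy, rfl⟩ := hv
  have hx' : x = 1 - y := by linarith
  by_cases huu : u = u₁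
  · subst huu
    have : x • u + y • u = u := by rw [← add_smul, hxy, one_smul]
    rw [this]; exact hp₁
  rcases hy.eq_or_lt with hy0 | hy0
  · subst hy0
    have : x • u + (0 : ℝ) • u₁ = u := by rw [hx']; simp
    rw [this]; exact hpu
  · have : x • u + y • u₁ = u + y * (u₁ - u) := by rw [hx']; simp only [smul_eq_mul]; ring
    rw [this]
    exact hcloser y ⟨hy0, by linarith⟩ huu

/-- The constant term of a relation is nonzero by `relAt_zero`, so it can be normalized to `1`. -/
theorem exists_normalized (hrel : ∀ u ∈ I, ∃ w ≠ 0, RelAt S (φ u) u w) :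
    ∃ m C B : ℝ → ℝ, ∀ u ∈ I, RelAt S (φ u) u (m u, C u, 1, B u) := by
  have h : ∀ u, ∃ m C B : ℝ, u ∈ I → RelAt S (φ u) u (m, C, 1, B) := fun u => by
    by_cases hu : u ∈ I
    · obtain ⟨⟨m, C, A, B⟩, hw, hr⟩ := hrel u hu
      by_cases hA : A = 0
      · subst hA
        obtain ⟨h1, h2, h3⟩ := H.relAt_zero hu hr
        exact absurd (by rw [h1, h2, h3]; rfl) hw
      · refine ⟨A⁻¹ * m, A⁻¹ * C, A⁻¹ * B, fun _ => ?_⟩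
        have := hr.smul A⁻¹
        simpa [hA] using this
    · exact ⟨0, 0, 0, fun h => absurd h hu⟩
  choose m C B h using h
  exact ⟨m, C, B, h⟩

section Normalized
variable {m C B : ℝ → ℝ} (hN : ∀ u ∈ I, RelAt S (φ u) u (m u, C u, 1, B u))
include hN

theorem normalized_deriv {u s : ℝ} (h : (u, s) ∈ strictPairs I S) :
    (m u * φ u s + C u * s) * d2 φ u s = B u * s - C u * φ u s := by
  have hd := H.hasDerivAt_s h
  have h1 := ((hd.pow 2).const_mul (m u)).add (((hasDerivAt_id s).const_mul (2 * C u)).mul hd)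
  have h2 := ((hasDerivAt_pow 2 s).const_mul (B u)).const_add 1
  have hev : (fun r => m u * φ u r ^ 2 + 2 * C u * r * φ u r) =ᶠ[nhds s] fun r =>
      1 + B u * r ^ 2 := by
    filter_upwards [H.eventually_mem h] with r hr using hN u h.1 r hr.2.1 hr.2.2
  have h3 := (h2.congr_of_eventuallyEq hev).unique h1
  norm_num at h3
  linear_combination (-1 / 2) * h3

theorem normalized_mul_wf {u s : ℝ} (h : (u, s) ∈ strictPairs I S) :
    (m u * φ u s + C u * s) * wf φ u s = 1 := by
  have h1 := H.normalized_deriv hN h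
  have h2 := hN u h.1 s h.2.1 h.2.2
  simp only at h2
  rw [wf]
  linear_combination h2 - s * h1

theorem normalized_C {u s : ℝ} (h : (u, s) ∈ strictPairs I S) :
    (m u * d2 φ u s + C u) * wf φ u s ^ 2 = s * d2 (d2 φ) u s := by
  have hd := H.hasDerivAt_s h
  have h1 := ((hd.const_mul (m u)).add ((hasDerivAt_id s).const_mul (C u))).mul (H.hasDerivAt_wf h)
  have hev : (fun r => (m u * φ u r + C u * r) * wf φ u r) =ᶠ[nhds s] fun _ => 1 := by
    filter_upwards [H.eventually_mem h] with r hr using H.normalized_mul_wf hN hr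
  have h2 := ((hasDerivAt_const s (1 : ℝ)).congr_of_eventuallyEq hev).unique h1
  have h3 := H.normalized_mul_wf hN h
  simp only [id, Pi.add_apply] at h2
  linear_combination (-wf φ u s) * h2 + s * d2 (d2 φ) u s * h3

theorem normalized_m {u s : ℝ} (h : (u, s) ∈ strictPairs I S) :
    m u * wf φ u s ^ 3 = wf φ u s - s ^ 2 * d2 (d2 φ) u s := by
  have h1 := H.normalized_C hN h
  have h3 := H.normalized_mul_wf hN h
  have h4 : wf φ u s = φ u s - s * d2 φ u s := rfl
  linear_combination (m u * wf φ u s ^ 2) * h4 + wf φ u s * h3 - s * h1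

/-- The coefficients of the normalized relation are rational expressions in the derivatives of `φ`
at a fixed `s`. -/
theorem contDiffOn_normalized : ContDiffOn ℝ ∞ m I ∧ ContDiffOn ℝ ∞ C I ∧ ContDiffOn ℝ ∞ B I := by
  have hO := H.isOpen_strictPairs
  have key : ∀ u ∈ I, ContDiffAt ℝ ∞ m u ∧ ContDiffAt ℝ ∞ C u ∧ ContDiffAt ℝ ∞ B u := by
    intro u hu
    obtain ⟨h, h0⟩ := H.exists_s_pos hu
    set s := √u / 2
    have hw : ∀ v, (v, s) ∈ strictPairs I S → wf φ v s ≠ 0 := fun v hv => (H.wf_pos hv h0).ne'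
    have hφ := H.smoothAt_left H.smooth' h
    have h2 := H.smoothAt_left (H.smooth'.d2 hO) h
    have h22 := H.smoothAt_left ((H.smooth'.d2 hO).d2 hO) h
    have hwf : ContDiffAt ℝ ∞ (fun v => wf φ v s) u := hφ.sub (contDiffAt_const.mul h2)
    have hev := H.eventually_mem_left h
    have hm : ContDiffAt ℝ ∞ m u := by
      refine ContDiffAt.congr_of_eventuallyEq
        (f := fun v => (wf φ v s - s ^ 2 * d2 (d2 φ) v s) / wf φ v s ^ 3)
            ((hwf.sub (contDiffAt_const.mul h22)).div (hwf.pow 3)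
        (pow_ne_zero 3 (hw u h))) ?_
      filter_upwards [hev] with v hv
      rw [eq_div_iff (pow_ne_zero 3 (hw v hv))]
      exact H.normalized_m hN hv
    have hC : ContDiffAt ℝ ∞ C u := by
      refine ContDiffAt.congr_of_eventuallyEq
        (f := fun v => s * d2 (d2 φ) v s / wf φ v s ^ 2 - m v * d2 φ v s)
            (((contDiffAt_const (c := s).mul h22).div (hwf.pow 2)
        (pow_ne_zero 2 (hw u h))).sub (hm.mul h2)) ?_
      filter_upwards [hev] with v hv
      have h1 := H.normalized_C hN hv
      have := hw v hv
      field_simp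
      linear_combination h1
    refine ⟨hm, hC, ContDiffAt.congr_of_eventuallyEq (f := fun v =>
      (m v * φ v s ^ 2 + 2 * C v * s * φ v s - 1) / s ^ 2) ((((hm.mul (hφ.pow 2)).add
        (((contDiffAt_const.mul hC).mul contDiffAt_const).mul hφ)).sub
          contDiffAt_const).div_const _) ?_⟩
    filter_upwards [hev] with v hv
    have h1 := hN v hv.1 s hv.2.1 hv.2.2
    simp only at h1
    rw [eq_div_iff (by positivity)]
    linear_combination -h1
  exact ⟨fun u hu => (key u hu).1.contDiffWithinAt, fun u hu => (key u hu).2.1.contDiffWithinAt,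
    fun u hu => (key u hu).2.2.contDiffWithinAt⟩

/-- Comparison of the normalized relation with the one obtained by integration in `exists_relAt`. -/
theorem normalized_sigma {u : ℝ} (hu : u ∈ I) :
    (1 - 2 * k₀ u * u) * C u = -2 * σ u ∧ (1 - 2 * k₀ u * u) * B u = D u + 2 * k₀ u := by
  obtain ⟨m', hm'⟩ := H.exists_relAt hu
  have h := ((hN u hu).smul (1 - 2 * k₀ u * u)).sub hm'
  simp only [Prod.smul_mk, smul_eq_mul, mul_one, Prod.mk_sub_mk, sub_self] at h
  obtain ⟨-, h2, h3⟩ := H.relAt_zero hu h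
  exact ⟨by linarith, by linarith⟩

/-- The `u`-derivative of the relation, with `φ_u` eliminated, is a relation without constant term,
so its coefficients vanish by `relAt_zero`. -/
theorem hasDerivAt_normalized {u : ℝ} (hu : u ∈ I) :
    HasDerivAt m (2 * σ u * C u - D u * m u) u ∧
    HasDerivAt C (k₂ u * u * C u - σ u * B u) u := by
  obtain ⟨hm, hC, hB⟩ := H.contDiffOn_normalized hN
  have hI := H.isOpen.mem_nhds hu
  have hm' := ((hm.contDiffAt hI).differentiableAt (by simp)).hasDerivAt
  have hC' := ((hC.contDiffAt hI).differentiableAt (by simp)).hasDerivAt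
  have hB' := ((hB.contDiffAt hI).differentiableAt (by simp)).hasDerivAt
  set m₁ := deriv m u
  set C₁ := deriv C u
  set B₁ := deriv B u
  have key : RelAt S (φ u) u (m₁ - 2 * σ u * C u + D u * m u, C₁ - k₂ u * u * C u + σ u * B u, 0,
      B₁ - 2 * k₂ u * (1 + u * B u) - D u * B u) := by
    intro s hs hsu
    have h : (u, s) ∈ strictPairs I S := ⟨hu, hs, hsu⟩
    have hφ := H.hasDerivAt_u h
    have h1 := (hm'.mul (hφ.pow 2)).add (((hC'.const_mul 2).mul_const s).mul hφ)
    have h2 := (hB'.mul_const (s ^ 2)).const_add 1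
    have hev : (fun v => m v * φ v s ^ 2 + 2 * C v * s * φ v s) =ᶠ[nhds u] fun v =>
        1 + B v * s ^ 2 := by
      filter_upwards [H.eventually_mem_left h] with v hv using hN v hv.1 s hv.2.1 hv.2.2
    have h3 := (h2.congr_of_eventuallyEq hev).unique h1
    have h4 := hN u hu s hs hsu
    have h5 := H.normalized_deriv hN h
    have h6 := H.two_mul_d1 h
    norm_num at h3
    simp only at h4 ⊢
    linear_combination (-1) * h3 - (m u * φ u s + C u * s) * h6 - 2 * k₂ u * s ^ 2 * h4
      - (2 * k₂ u * s * (u - s ^ 2) + 2 * σ u * φ u s + D u * s) * h5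
  obtain ⟨e1, e2, -⟩ := H.relAt_zero hu key
  exact ⟨hm'.congr_deriv (by linarith), hC'.congr_deriv (by linarith)⟩

end Normalized
end Reduced

/-! ### Boundary values and signs of the coefficients -/

namespace Reduced
variable {I S : Set ℝ} {φ : ℝ → ℝ → ℝ} {σ D k₀ k₂ : ℝ → ℝ} (H : Reduced I S φ σ D k₀ k₂)
include H

/-- A boundary value of `s` is approached by the interior values `λ s`, `λ ↑ 1`, along which `φ_s`
stays bounded. -/
theorem exists_continuousOn_ray {u s : ℝ} (h : (u, s) ∈ pairs I S) (hsu : s ^ 2 = u) :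
    (∀ l ∈ Set.Ico (1 / 2 : ℝ) 1, (u, l * s) ∈ strictPairs I S) ∧
    ContinuousOn (fun l => φ u (l * s)) (Set.Icc (1 / 2 : ℝ) 1) ∧
    ∃ ψ : ℝ → ℝ, ContinuousOn ψ (Set.Icc (1 / 2 : ℝ) 1) ∧
      ∀ l ∈ Set.Ico (1 / 2 : ℝ) 1, ψ l = d2 φ u (l * s) := by
  have hu0 := H.pos_left u h.1
  have hs0 : s ≠ 0 := by rintro rfl; simp at hsu; exact hu0.ne hsu
  have hSs : ∀ l : ℝ, 0 < l → l * s ∈ S := fun l hl => by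
    have := h.2.1
    rcases H.regular_or_singular with h' | h'
    · rw [h']; trivial
    · simp only [h', Set.mem_Ioi] at this ⊢; exact mul_pos hl this
  have h1 : ∀ l ∈ Set.Ico (1 / 2 : ℝ) 1, (u, l * s) ∈ strictPairs I S := fun l hl => by
    refine ⟨h.1, hSs l (by linarith [hl.1]), ?_⟩
    simp only [mul_pow, hsu]
    have : l ^ 2 < 1 := by nlinarith [hl.1, hl.2]
    nlinarith
  refine ⟨h1, ?_, ?_⟩
  · refine (H.continuousOn_slice h.1).comp (f := fun l : ℝ => l * s) (by fun_prop) fun l hl => ?_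
    refine ⟨hSs l (by linarith [hl.1]), ?_⟩
    simp only [mul_pow, hsu]
    have : l ^ 2 ≤ 1 := by nlinarith [hl.1, hl.2]
    nlinarith
  · have hsqrt : √u = |s| := by rw [← hsu, Real.sqrt_sq_eq_abs]
    obtain ⟨ψ, hψ, hψ'⟩ : ∃ ψ : ℝ → ℝ, ContinuousOn ψ
        ((fun l : ℝ => l * s) '' Set.Icc (1 / 2 : ℝ) 1) ∧
        ∀ r ∈ (fun l : ℝ => l * s) '' Set.Icc (1 / 2 : ℝ) 1, r ^ 2 < u → ψ r = d2 φ u r := by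
      have himg : ∀ l r : ℝ, (fun l : ℝ => l * s) '' Set.Icc (1 / 2 : ℝ) 1 = Set.Icc l r →
          l < r → -√u ≤ l → r ≤ √u → ∃ ψ : ℝ → ℝ,
          ContinuousOn ψ ((fun l : ℝ => l * s) '' Set.Icc (1 / 2 : ℝ) 1) ∧
        ∀ r ∈ (fun l : ℝ => l * s) '' Set.Icc (1 / 2 : ℝ) 1, r ^ 2 < u → ψ r = d2 φ u r := by
        intro l r hlr h2 h3 h4
        have hS : Set.Icc l r ⊆ S := by
          rw [← hlr]
          rintro _ ⟨t, ht, rfl⟩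
          exact hSs t (by linarith [ht.1])
        rw [hlr]
        exact H.exists_continuousOn_d2 h.1 h2 hS h3 h4
      rcases lt_or_gt_of_ne hs0 with hneg | hpos
      · refine himg (1 * s) (1 / 2 * s) (Set.ext fun r => ⟨?_, fun hr =>
          ⟨r / s, ⟨(le_div_iff_of_neg hneg).2 hr.2, (div_le_iff_of_neg hneg).2 hr.1⟩,
            div_mul_cancel₀ r hs0⟩⟩) ?_ ?_ ?_ <;>
          first | rw [hsqrt, abs_of_neg hneg] | skip
        · rintro ⟨l, hl, rfl⟩
          exact ⟨mul_le_mul_of_nonpos_right hl.2 hneg.le, mul_le_mul_of_nonpos_right hl.1 hneg.le⟩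
        all_goals linarith
      · refine himg (1 / 2 * s) (1 * s) (Set.image_mul_right_Icc (by norm_num) hpos.le) ?_ ?_ ?_ <;>
          first | rw [hsqrt, abs_of_pos hpos] | skip
        all_goals linarith
    refine ⟨fun l => ψ (l * s), hψ.comp (by fun_prop) (fun l hl => ⟨l, hl, rfl⟩), fun l hl => ?_⟩
    exact hψ' _ ⟨l, Set.Ico_subset_Icc_self hl, rfl⟩ (h1 l hl).2.2

section Normalized
variable {m C B : ℝ → ℝ} (hN : ∀ u ∈ I, RelAt S (φ u) u (m u, C u, 1, B u))
include hN

/-- The product with `φ - s φ_s > 0` is `1` for `s > 0`, and there are no zeros. -/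
theorem normalized_pos {u s : ℝ} (h : (u, s) ∈ strictPairs I S) : 0 < m u * φ u s + C u * s := by
  obtain ⟨h₀, hs₀⟩ := H.exists_s_pos h.1
  have hp₀ : 0 < m u * φ u (√u / 2) + C u * (√u / 2) :=
    pos_of_mul_pos_left (by rw [H.normalized_mul_wf hN h₀]; exact one_pos) (H.wf_pos h₀ hs₀).le
  by_contra hneg
  push Not at hneg
  have hc : ContinuousOn (fun s => m u * φ u s + C u * s) {s | s ∈ S ∧ s ^ 2 < u} := by
    have := (H.continuousOn_slice h.1).mono
      (fun s hs => ⟨hs.1, hs.2.le⟩ : {s | s ∈ S ∧ s ^ 2 < u} ⊆ {s | s ∈ S ∧ s ^ 2 ≤ u})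
    fun_prop
  obtain ⟨t, ht, ht0⟩ := (H.ordConnected_slice u).isPreconnected.intermediate_value
    (⟨h.2.1, h.2.2⟩ : s ∈ {s | s ∈ S ∧ s ^ 2 < u}) ⟨h₀.2.1, h₀.2.2⟩ hc ⟨hneg, hp₀.le⟩
  have := H.normalized_mul_wf (s := t) hN ⟨h.1, ht.1, ht.2⟩
  simp only at ht0
  rw [ht0, zero_mul] at this
  exact zero_ne_one this

theorem normalized_rel {u s : ℝ} (h : (u, s) ∈ pairs I S) :
    m u * φ u s ^ 2 + 2 * C u * s * φ u s = 1 + B u * s ^ 2 := by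
  rcases h.2.2.lt_or_eq with hlt | heq
  · exact hN u h.1 s h.2.1 hlt
  obtain ⟨h1, h2, -⟩ := H.exists_continuousOn_ray h heq
  have hl : ContinuousOn (fun l : ℝ => l * s) (Set.Icc (1 / 2 : ℝ) 1) := by fun_prop
  have := eq_right_of_eqOn_Ico (l := 1 / 2) (r := 1)
    (f := fun l => m u * φ u (l * s) ^ 2 + 2 * C u * (l * s) * φ u (l * s))
    (g := fun l => 1 + B u * (l * s) ^ 2) (by norm_num)
    ((continuousOn_const.mul (h2.pow 2)).add ((continuousOn_const.mul hl).mul h2)) (by fun_prop)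
    fun l hl => hN u h.1 _ (h1 l hl).2.1 (h1 l hl).2.2
  simpa using this

/-- The positivity persists up to the boundary since `φ - s φ_s` stays bounded. -/
theorem normalized_pos' {u s : ℝ} (h : (u, s) ∈ pairs I S) : 0 < m u * φ u s + C u * s := by
  rcases h.2.2.lt_or_eq with hlt | heq
  · exact H.normalized_pos hN ⟨h.1, h.2.1, hlt⟩
  obtain ⟨h1, h2, ψ, hψ, hψ'⟩ := H.exists_continuousOn_ray h heq
  have hl : ContinuousOn (fun l : ℝ => l * s) (Set.Icc (1 / 2 : ℝ) 1) := by fun_prop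
  have hy : ContinuousOn (fun l : ℝ => m u * φ u (l * s) + C u * (l * s)) (Set.Icc (1 / 2 : ℝ) 1) :=
    (continuousOn_const.mul h2).add (continuousOn_const.mul hl)
  have e1 := eq_right_of_eqOn_Ico (l := 1 / 2) (r := 1)
    (f := fun l => (m u * φ u (l * s) + C u * (l * s)) * (φ u (l * s) - l * s * ψ l))
    (g := fun _ => 1) (by norm_num) (hy.mul (h2.sub (hl.mul hψ))) continuousOn_const fun l hl => by
      simp only [hψ' l hl]
      exact H.normalized_mul_wf hN (h1 l hl)
  have e2 := eq_right_of_eqOn_Ico (l := 1 / 2) (r := 1)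
    (f := fun l => |m u * φ u (l * s) + C u * (l * s)|)
    (g := fun l => m u * φ u (l * s) + C u * (l * s)) (by norm_num) hy.abs hy
    fun l hl => abs_of_pos (H.normalized_pos hN (h1 l hl))
  simp only [one_mul] at e1 e2
  refine lt_of_le_of_ne ?_ fun h0 => ?_
  · rw [← e2]; exact abs_nonneg _
  · rw [← h0, zero_mul] at e1; exact zero_ne_one e1

theorem normalized_sq {u s : ℝ} (h : (u, s) ∈ pairs I S) :
    (m u * φ u s + C u * s) ^ 2 = m u * (1 + B u * s ^ 2) + C u ^ 2 * s ^ 2 := by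
  have := H.normalized_rel hN h
  linear_combination m u * this

theorem normalized_sqrt {u s : ℝ} (h : (u, s) ∈ pairs I S) :
    √(m u * (1 + B u * s ^ 2) + C u ^ 2 * s ^ 2) = m u * φ u s + C u * s := by
  rw [← H.normalized_sq hN h, Real.sqrt_sq (H.normalized_pos' hN h).le]

/-- The value `m` is the limit of the square in `normalized_sq` as `s ↓ 0`. -/
theorem normalized_m_nonneg {u : ℝ} (hu : u ∈ I) : 0 ≤ m u := by
  have hu0 := Real.sqrt_pos.2 (H.pos_left u hu)
  have hc : Filter.Tendsto (fun s => m u * (1 + B u * s ^ 2) + C u ^ 2 * s ^ 2)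
      (nhdsWithin 0 (Set.Ioi 0))
      (nhds (m u * (1 + B u * 0 ^ 2) + C u ^ 2 * 0 ^ 2)) :=
    (ContinuousAt.tendsto (by fun_prop)).mono_left nhdsWithin_le_nhds
  have := ge_of_tendsto hc (b := 0) (by
    filter_upwards [Ioo_mem_nhdsGT hu0] with s hs
    rw [← H.normalized_sq hN ⟨hu, H.mem_S hs.1,
        (Real.le_sqrt hs.1.le (H.pos_left u hu).le).1 hs.2.le⟩]
    exact sq_nonneg _)
  simpa using this

theorem normalized_C_pos {u : ℝ} (hu : u ∈ I) (hm : m u = 0) : 0 < C u := by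
  obtain ⟨h, h0⟩ := H.exists_s_pos hu
  have := H.normalized_pos hN h
  rw [hm, zero_mul, zero_add] at this
  exact pos_of_mul_pos_left this h0.le

theorem one_add_B_pos {u s : ℝ} (h : (u, s) ∈ pairs I S) (hs : 0 < s) (hC : 0 < C u) :
    0 < 1 + B u * s ^ 2 := by
  have h1 := H.normalized_rel hN h
  have h2 := H.pos _ h
  simp only at h2
  have h3 := H.normalized_pos' hN h
  have : 0 < (m u * φ u s + C u * s) * φ u s + C u * s * φ u s := by positivity
  linarith

/-- `C` solves a homogeneous linear equation, so it has no zeros if it has a nonzero value. -/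
theorem normalized_C_pos_of_exists {u₀ : ℝ} (h₀ : u₀ ∈ I) (hm : m u₀ = 0) {u : ℝ} (hu : u ∈ I) :
    0 < C u := by
  obtain ⟨-, hC, hB⟩ := H.contDiffOn_normalized hN
  have hk : ContinuousOn (fun u => k₂ u * u + (1 - 2 * k₀ u * u) / 2 * B u) I := by
    have h1 := H.contDiffOn_k₀.continuousOn
    have h2 := H.contDiffOn_k₂.continuousOn
    have h3 := hB.continuousOn
    fun_prop
  have hd : ∀ u ∈ I, HasDerivAt C ((k₂ u * u + (1 - 2 * k₀ u * u) / 2 * B u) * C u) u :=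
      fun u hu => by
    refine (H.hasDerivAt_normalized hN hu).2.congr_deriv ?_
    have := (H.normalized_sigma hN hu).1
    linear_combination (-B u / 2) * this
  have hC₀ := H.normalized_C_pos hN h₀ hm
  by_contra hneg
  push Not at hneg
  obtain ⟨t, ht, ht0⟩ := H.ordConnected.isPreconnected.intermediate_value hu h₀ hC.continuousOn
    ⟨hneg, hC₀.le⟩
  exact hC₀.ne' (eq_zero_of_hasDerivAt_mul H.isOpen H.ordConnected hk hd ht ht0 u₀ h₀)

/-- At a zero of `m ≥ 0` the derivative `m' = 2 σ C` vanishes as well. -/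
theorem sigma_eq_zero_of_m {u : ℝ} (hu : u ∈ I) (hm : m u = 0) : σ u = 0 := by
  have hmin : IsLocalMin m u := by
    filter_upwards [H.isOpen.mem_nhds hu] with v hv
    rw [hm]; exact H.normalized_m_nonneg hN hv
  have h := hmin.hasDerivAt_eq_zero (H.hasDerivAt_normalized hN hu).1
  rw [hm] at h
  have hC := (H.normalized_C_pos hN hu hm).ne'
  have : σ u * C u = 0 := by linarith
  exact (mul_eq_zero.1 this).resolve_right hC

omit hN in
theorem continuousOn_D (hσ : ∀ u ∈ I, σ u = 0) : ContinuousOn D I := by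
  intro u hu
  obtain ⟨h, h0⟩ := H.exists_s_pos hu
  set s := √u / 2
  have hO := H.isOpen_strictPairs
  have c1 := (H.smoothAt_left (H.smooth'.d1 hO) h).continuousAt
  have c2 := (H.smoothAt_left (H.smooth'.d2 hO) h).continuousAt
  have c0 := (H.smoothAt_left H.smooth' h).continuousAt
  have ck := H.contDiffOn_k₀.continuousOn.continuousAt (H.isOpen.mem_nhds hu)
  have ck2 := H.contDiffOn_k₂.continuousOn.continuousAt (H.isOpen.mem_nhds hu)
  have hφ := (H.pos' h).ne'
  refine ContinuousAt.continuousWithinAt (ContinuousAt.congr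
      (f := fun v => (d2 φ v s + 2 * s * d1 φ v s -
    2 * (k₀ v + k₂ v * s ^ 2) * (s * φ v s + (v - s ^ 2) * d2 φ v s)) / (2 * s * φ v s)) ?_ ?_)
  · refine ContinuousAt.div (by fun_prop) (by fun_prop) ?_
    exact mul_ne_zero (mul_ne_zero two_ne_zero h0.ne') hφ
  · filter_upwards [H.eventually_mem_left h] with v hv
    have hφ' := (H.pos' hv).ne'
    have h1 := H.eq₂ v s hv
    rw [hσ v hv.1] at h1
    have := h0.ne'
    rw [div_eq_iff (mul_ne_zero (mul_ne_zero two_ne_zero this) hφ')]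
    linear_combination h1

/-- If `σ` vanishes identically, then `m` solves a homogeneous linear equation. -/
theorem m_eq_zero_of_sigma (hσ : ∀ u ∈ I, σ u = 0) {u₀ : ℝ} (h₀ : u₀ ∈ I) (hm : m u₀ = 0) :
    ∀ u ∈ I, m u = 0 := by
  refine eq_zero_of_hasDerivAt_mul H.isOpen H.ordConnected (H.continuousOn_D hσ).neg
    (fun u hu => ?_) h₀ hm
  refine (H.hasDerivAt_normalized hN hu).1.congr_deriv ?_
  rw [hσ u hu]
  simp

end Normalized
end Reduced

/-! ### From functions of `b²` and `s` to metrics -/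

section
variable {n : ℕ} {M : Type*} [TopologicalSpace M] [ChartedSpace (E n) M] [IsManifold (𝓡 n) ∞ M]
variable {a : RMetric n M} {β : OneForm n M} {φ : ℝ → ℝ → ℝ} {S : Set ℝ}

section Forms

theorem form_sq_le (x : M) (y : TangentSpace (𝓡 n) x) :
    β.form x y ^ 2 ≤ bsq a β x * a.inner x y y := by
  obtain ⟨e, he, p, hp, rfl⟩ := exists_chart_point (n := n) x
  obtain ⟨y, rfl⟩ := (vec_bijective he hp).2 y
  rw [form_vec_eq, inner_vec_eq]
  exact lin_sq_le he hp

theorem ratio_sq_le (x : M) {y : TangentSpace (𝓡 n) x} (hy : y ≠ 0) :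
    ratio a β x y ^ 2 ≤ bsq a β x := by
  rw [ratio, div_pow, alpha_sq, div_le_iff₀ (a.pos x y hy)]
  exact form_sq_le x y

theorem contMDiff_comp_bsq {f : ℝ → ℝ} (hf : ContDiffOn ℝ ∞ f (Set.range (bsq a β))) :
    ContMDiff (𝓡 n) 𝓘(ℝ, ℝ) ∞ fun x => f (bsq a β x) :=
  contMDiff_of_charts fun _ he => hf.comp (contDiffOn_bsq he) fun _ _ => ⟨_, rfl⟩

theorem continuous_bsq : Continuous (bsq a β) :=
  (contMDiff_comp_bsq (f := id) contDiffOn_id).continuous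

theorem form_eq (x : M) {y : TangentSpace (𝓡 n) x} (hy : y ≠ 0) :
    β.form x y = ratio a β x y * alpha a x y := by
  rw [ratio, div_mul_cancel₀ _ (alpha_pos a hy).ne']

/-- A Riemannian metric `√(f α² + g β²)` with coefficients depending on `b²`. -/
theorem exists_rmetric_of_bsq {f g : ℝ → ℝ} (hf : ContDiffOn ℝ ∞ f (Set.range (bsq a β)))
    (hg : ContDiffOn ℝ ∞ g (Set.range (bsq a β)))
    (hpos : ∀ u ∈ Set.range (bsq a β), ∀ s, s ^ 2 ≤ u → 0 < f u + g u * s ^ 2) :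
    ∃ h : RMetric n M, ∀ x, ∀ y : TangentSpace (𝓡 n) x, y ≠ 0 → alpha h x y =
      alpha a x y * √(f (bsq a β x) + g (bsq a β x) * ratio a β x y ^ 2) := by
  have key : ∀ x, ∀ v : TangentSpace (𝓡 n) x, v ≠ 0 →
      f (bsq a β x) * a.inner x v v + g (bsq a β x) * β.form x v ^ 2 =
      alpha a x v ^ 2 * (f (bsq a β x) + g (bsq a β x) * ratio a β x v ^ 2) := fun x v hv => by
    rw [form_eq (a := a) x hv, ← alpha_sq]; ring
  obtain ⟨h, hh⟩ := exists_rmetric_add_tensorSquare a β (contMDiff_comp_bsq hf)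
    (contMDiff_comp_bsq hg) fun x v hv => by
      rw [key x v hv]
      exact mul_pos (pow_pos (alpha_pos a hv) 2) (hpos _ ⟨x, rfl⟩ _ (ratio_sq_le x hv))
  refine ⟨h, fun x y hy => ?_⟩
  rw [alpha, hh, key x y hy, Real.sqrt_mul (sq_nonneg _), Real.sqrt_sq (alpha_pos a hy).le]

theorem mem_valueSet {x : M} {y : TangentSpace (𝓡 n) x} (hy : y ∈ dom a β S x) :
    (bsq a β x, ratio a β x y) ∈ valueSet a β S :=
  ⟨⟨x, rfl⟩, hy.2, ratio_sq_le x hy.1⟩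

/-- Here `F` is the Randers metric `√(f α² + g β²) + k β`, with coefficients depending on `b²`. -/
theorem isRanders_of_eq {f g k : ℝ → ℝ} (hf : ContDiffOn ℝ ∞ f (Set.range (bsq a β)))
    (hg : ContDiffOn ℝ ∞ g (Set.range (bsq a β))) (hk : ContDiffOn ℝ ∞ k (Set.range (bsq a β)))
    (hpos : ∀ u ∈ Set.range (bsq a β), ∀ s, s ^ 2 ≤ u → 0 < f u + g u * s ^ 2)
    (hφ : ∀ u s, (u, s) ∈ valueSet a β S → φ u s = √(f u + g u * s ^ 2) + k u * s) :
    IsRanders (dom a β S) (genAB a β φ) := by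
  obtain ⟨h, hh⟩ := exists_rmetric_of_bsq hf hg hpos
  refine ⟨h, β.smulFun _ (contMDiff_comp_bsq hk), fun x y hy => ?_⟩
  have e : (β.smulFun _ (contMDiff_comp_bsq (a := a) (β := β) hk)).form x y
    = k (bsq a β x) * β.form x y := rfl
  rw [e, hh x y hy.1, genAB, hφ _ _ (mem_valueSet hy), form_eq (a := a) x hy.1]
  ring

/-- Here `F` is the Kropina metric `(α² + g β²) / (k β)`, with coefficients depending on `b²`. -/
theorem isKropina_of_eq {g k : ℝ → ℝ}
    (hg : ContDiffOn ℝ ∞ g (Set.range (bsq a β))) (hk : ContDiffOn ℝ ∞ k (Set.range (bsq a β)))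
    (hpos : ∀ u ∈ Set.range (bsq a β), ∀ s, s ^ 2 ≤ u → 0 < 1 + g u * s ^ 2)
    (hφ : ∀ u s, (u, s) ∈ valueSet a β S → k u * s ≠ 0 ∧ φ u s = (1 + g u * s ^ 2) / (k u * s)) :
    IsKropina (dom a β S) (genAB a β φ) := by
  obtain ⟨h, hh⟩ := exists_rmetric_of_bsq (f := fun _ => 1) contDiffOn_const hg hpos
  refine ⟨h, β.smulFun _ (contMDiff_comp_bsq hk), fun x y hy => ?_⟩
  have e : (β.smulFun _ (contMDiff_comp_bsq (a := a) (β := β) hk)).form x y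
    = k (bsq a β x) * β.form x y := rfl
  obtain ⟨h1, h2⟩ := hφ _ _ (mem_valueSet hy)
  have h3 := (alpha_pos a hy.1).ne'
  rw [e, hh x y hy.1, genAB, h2, form_eq (a := a) x hy.1]
  refine ⟨by rw [← mul_assoc]; exact mul_ne_zero h1 h3, ?_⟩
  rw [mul_pow, Real.sq_sqrt (hpos _ ⟨x, rfl⟩ _ (ratio_sq_le x hy.1)).le, ← mul_assoc]
  field_simp

/-- Here `F = h² / (θ + √(θ² + m h²))` with `h² = α² + g β²` and `θ = k β`, the coefficients
depending on `b²`. -/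
theorem isRandersKropina_of_eq {g k m : ℝ → ℝ}
    (hg : ContDiffOn ℝ ∞ g (Set.range (bsq a β))) (hk : ContDiffOn ℝ ∞ k (Set.range (bsq a β)))
    (hm : ContDiffOn ℝ ∞ m (Set.range (bsq a β)))
    (hpos : ∀ u ∈ Set.range (bsq a β), ∀ s, s ^ 2 ≤ u → 0 < 1 + g u * s ^ 2)
    (hm0 : ∀ u ∈ Set.range (bsq a β), 0 ≤ m u) (hm1 : ∃ u ∈ Set.range (bsq a β), m u = 0)
    (hm2 : ∃ u ∈ Set.range (bsq a β), m u ≠ 0)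
    (hφ : ∀ u s, (u, s) ∈ valueSet a β S → (m u = 0 → 0 < k u * s) ∧
      φ u s = (1 + g u * s ^ 2) / (k u * s + √((k u * s) ^ 2 + m u * (1 + g u * s ^ 2)))) :
    IsRandersKropina (dom a β S) (genAB a β φ) := by
  obtain ⟨h, hh⟩ := exists_rmetric_of_bsq (f := fun _ => 1) contDiffOn_const hg hpos
  obtain ⟨_, ⟨x₁, rfl⟩, hx₁⟩ := hm1
  obtain ⟨_, ⟨x₂, rfl⟩, hx₂⟩ := hm2
  refine ⟨h, β.smulFun _ (contMDiff_comp_bsq hk), fun x => m (bsq a β x), contMDiff_comp_bsq hm,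
    fun x => hm0 _ ⟨x, rfl⟩, ⟨x₁, hx₁⟩, ⟨x₂, hx₂⟩, fun x y hy => ?_⟩
  have e : (β.smulFun _ (contMDiff_comp_bsq (a := a) (β := β) hk)).form x y
    = k (bsq a β x) * β.form x y := rfl
  obtain ⟨h1, h2⟩ := hφ _ _ (mem_valueSet hy)
  have h3 := alpha_pos a hy.1
  rw [e, hh x y hy.1, genAB, h2, form_eq (a := a) x hy.1]
  refine ⟨fun h0 => by rw [← mul_assoc]; exact mul_pos (h1 h0) h3, ?_⟩
  beta_reduce
  rw [mul_pow (alpha a x y) (√_), Real.sq_sqrt (hpos _ ⟨x, rfl⟩ _ (ratio_sq_le x hy.1)).le]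
  generalize bsq a β x = u
  generalize ratio a β x y = s
  have e2 : (k u * (s * alpha a x y)) ^ 2 + m u * (alpha a x y ^ 2 * (1 + g u * s ^ 2)) =
      alpha a x y ^ 2 * ((k u * s) ^ 2 + m u * (1 + g u * s ^ 2)) := by ring
  rw [e2, Real.sqrt_mul (sq_nonneg _), Real.sqrt_sq h3.le]
  have e3 : k u * (s * alpha a x y) + alpha a x y * √((k u * s) ^ 2 + m u * (1 + g u * s ^ 2)) =
      alpha a x y * (k u * s + √((k u * s) ^ 2 + m u * (1 + g u * s ^ 2))) := by ring
  rw [e3, sq (alpha a x y), mul_assoc (alpha a x y), mul_div_mul_left _ _ h3.ne', mul_div_assoc]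

end Forms

section Setup
variable {c : M → ℝ}

theorem form_eq_zero_of_bsq {x : M} (h : bsq a β x = 0) : β.form x = 0 := by
  ext y
  have := form_sq_le (a := a) (β := β) x y
  rw [h, zero_mul] at this
  exact pow_eq_zero_iff two_ne_zero |>.1 (le_antisymm this (sq_nonneg _))

/-- The `1`-form `β` does not vanish identically, since its covariant derivative has no zeros. -/
theorem exists_bsq_pos [Nonempty M] (hn : 2 ≤ n) (hc : ∀ x, c x ≠ 0)
    (hβ : IsClosedConformal a β c) :
    ∃ x, 0 < bsq a β x := by
  by_contra hno
  push Not at hno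
  have hz : ∀ x, β.form x = 0 := fun x => form_eq_zero_of_bsq (le_antisymm (hno x) (bsq_nonneg x))
  obtain ⟨e, he, p, hp, -⟩ := exists_chart_point (n := n) (Classical.arbitrary M)
  have h0 : ∀ i, coeffB β e i = fun _ => 0 := fun i => by
    funext q; rw [coeffB, hz]; rfl
  let i : Fin n := ⟨0, by omega⟩
  have h1 := hβ e he p hp i i
  simp only [covDeriv, h0, pd_const, mul_zero, Finset.sum_const_zero, sub_zero] at h1
  have h2 : 0 < coeffA a e p i i := (coeffA_posDef he hp).diag_pos
  exact (mul_ne_zero (hc _) h2.ne') h1.symm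

theorem ordConnected_range_bsq [PreconnectedSpace M] : (Set.range (bsq a β)).OrdConnected :=
  (isPreconnected_range continuous_bsq).ordConnected

theorem pairs_subset_valueSet : pairs (Set.range (bsq a β) ∩ Set.Ioi 0) S ⊆ valueSet a β S :=
  fun _ hq => ⟨hq.1.1, hq.2⟩

theorem strictPairs_subset_innerSet :
    strictPairs (Set.range (bsq a β) ∩ Set.Ioi 0) S ⊆ innerSet a β S :=
  fun _ hq => ⟨hq.1.1, hq.2⟩

/-- Isotropic Berwald curvature gives the reduced equations. A priori `τ / c` depends on the point;
two values at points with the same `b²` would give a relation excluded by `relAt_zero`. -/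
theorem exists_reduced [ConnectedSpace M] (hn : 2 ≤ n) (hc : ∀ x, c x ≠ 0)
    (hβ : IsClosedConformal a β c) (hF : IsGeneralABMetric a β φ S) {τ : M → ℝ}
    (hτ : IsIsotropicBerwald (dom a β S) (genAB a β φ) τ) :
    ∃ σ D k₀ k₂ : ℝ → ℝ, Reduced (Set.range (bsq a β) ∩ Set.Ioi 0) S φ σ D k₀ k₂ ∧
      ∀ x, 0 < bsq a β x → τ x = σ (bsq a β x) * c x := by
  have h : ∀ u, ∃ σ D k₀ k₂ : ℝ, u ∈ Set.range (bsq a β) ∩ Set.Ioi 0 → ∀ s ∈ S, s ^ 2 < u →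
      Pf φ u s = σ * φ u s + D * s ∧ Rf φ u s = k₀ + k₂ * s ^ 2 := fun u => by
    by_cases hu : u ∈ Set.range (bsq a β) ∩ Set.Ioi 0
    · obtain ⟨⟨x, hx⟩, hu0⟩ := hu
      obtain ⟨D, k₀, k₂, h⟩ := exists_spray_coeff hn hc hβ hF hτ hx.symm hu0
      exact ⟨_, D, k₀, k₂, fun _ => h⟩
    · exact ⟨0, 0, 0, 0, fun h => absurd h hu⟩
  choose σ D k₀ k₂ h using h
  have H : Reduced (Set.range (bsq a β) ∩ Set.Ioi 0) S φ σ D k₀ k₂ :=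
    { isOpen := isOpen_range_bsq_pos hc hβ
      ordConnected := ordConnected_range_bsq.inter Set.ordConnected_Ioi
      pos_left := fun u hu => hu.2
      regular_or_singular := hF.regular_or_singular.imp_right fun h => h.1
      smooth := hF.smooth.mono pairs_subset_valueSet
      pos := fun q hq => hF.pos q (pairs_subset_valueSet hq)
      cvx_pos := fun u s hs => cvx_pos hn hc hβ hF (strictPairs_subset_innerSet hs)
      eq₁ := fun u s hs => by
        rw [Rf_spec hn hc hβ hF (strictPairs_subset_innerSet hs), (h u hs.1 s hs.2.1 hs.2.2).2]
      eq₂ := fun u s hs => by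
        have h1 := h u hs.1 s hs.2.1 hs.2.2
        rw [Pf_spec hF (strictPairs_subset_innerSet hs), h1.1, h1.2] }
  refine ⟨σ, D, k₀, k₂, H, fun x hx => ?_⟩
  obtain ⟨D', k₀', k₂', h'⟩ := exists_spray_coeff hn hc hβ hF hτ (x := x) rfl hx
  have hu : bsq a β x ∈ Set.range (bsq a β) ∩ Set.Ioi 0 := ⟨⟨x, rfl⟩, hx⟩
  have hrel : RelAt S (φ (bsq a β x)) (bsq a β x)
      (0, (σ (bsq a β x) - τ x / c x) / 2, 0, D' - D (bsq a β x)) := by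
    intro s hs hsu
    have h1 := (h _ hu s hs hsu).1
    have h2 := (h' s hs hsu).1
    simp only
    linear_combination s * h2 - s * h1
  have h3 := (H.relAt_zero hu hrel).2.1
  have h4 : σ (bsq a β x) = τ x / c x := by linarith
  rw [h4, div_mul_cancel₀ _ (hc x)]

theorem bsq_pos_of_singular (hF : IsGeneralABMetric a β φ S) (hS : S ≠ Set.univ) (x : M) :
    0 < bsq a β x := by
  refine lt_of_le_of_ne (bsq_nonneg x) fun h => ?_
  rcases hF.regular_or_singular with h' | h'
  · exact hS h'
  · exact h'.2 x (form_eq_zero_of_bsq h.symm)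

end Setup

end

/-! ### Randers metrics, Kropina metrics and their gluing -/

namespace Reduced
variable {I S : Set ℝ} {φ : ℝ → ℝ → ℝ} {σ D k₀ k₂ : ℝ → ℝ} (H : Reduced I S φ σ D k₀ k₂)
variable {m C B : ℝ → ℝ} (hN : ∀ u ∈ I, RelAt S (φ u) u (m u, C u, 1, B u))
include H hN

theorem normalized_B {u s : ℝ} (h : (u, s) ∈ strictPairs I S) :
    (m u * d2 φ u s + C u) * d2 φ u s + (m u * φ u s + C u * s) * d2 (d2 φ) u s =
      B u - C u * d2 φ u s := by
  have hd := H.hasDerivAt_s h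
  have h1 := ((hd.const_mul (m u)).add ((hasDerivAt_id s).const_mul (C u))).mul (H.hasDerivAt_ss h)
  have h2 := ((hasDerivAt_id s).const_mul (B u)).sub (hd.const_mul (C u))
  have hev : (fun r => (m u * φ u r + C u * r) * d2 φ u r) =ᶠ[nhds s] fun r =>
      B u * r - C u * φ u r := by
    filter_upwards [H.eventually_mem h] with r hr using H.normalized_deriv hN hr
  have h3 := (h2.congr_of_eventuallyEq hev).unique h1
  simp only [id, Pi.add_apply] at h3
  linear_combination -h3

/-- The coefficients of the normalized relation in the regular case, from the values at `s = 0`. -/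
theorem normalized_at_zero {u : ℝ} (h : (u, 0) ∈ strictPairs I S) :
    0 < m u ∧ φ u 0 ^ 2 = 1 / m u ∧ d2 φ u 0 = -C u / m u ∧
      φ u 0 * d2 (d2 φ) u 0 = (C u ^ 2 + m u * B u) / m u ^ 2 := by
  have hφ := H.pos' h
  have h1 := H.normalized_pos hN h
  have h2 := hN u h.1 0 h.2.1 h.2.2
  have h3 := H.normalized_C hN h
  have h4 := H.normalized_B hN h
  simp only [mul_zero, add_zero, zero_mul] at h1 h2 h3 h4
  have hm : 0 < m u := pos_of_mul_pos_left h1 hφ.le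
  have hw : wf φ u 0 ≠ 0 := by simp [wf, hφ.ne']
  have h5 : m u * d2 φ u 0 + C u = 0 := (mul_eq_zero.1 h3).resolve_right (pow_ne_zero 2 hw)
  refine ⟨hm, ?_, ?_, ?_⟩
  · field_simp; linear_combination h2
  · field_simp; linear_combination h5
  · field_simp
    linear_combination m u * h4 - m u * d2 φ u 0 * h5 - C u * h5

theorem normalized_randers_radicand {u s : ℝ} (h : (u, s) ∈ pairs I S) (hm : 0 < m u) :
    1 / m u + (C u ^ 2 + m u * B u) / m u ^ 2 * s ^ 2 = ((m u * φ u s + C u * s) / m u) ^ 2 := by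
  have := H.normalized_sq hN h
  rw [div_pow, this]
  field_simp
  ring

theorem normalized_randers {u s : ℝ} (h : (u, s) ∈ pairs I S) (hm : 0 < m u) :
    φ u s = √(1 / m u + (C u ^ 2 + m u * B u) / m u ^ 2 * s ^ 2) + -C u / m u * s := by
  rw [H.normalized_randers_radicand hN h hm,
    Real.sqrt_sq (div_pos (H.normalized_pos' hN h) hm).le]
  field_simp
  ring

theorem normalized_randers_pos {u s : ℝ} (hu : u ∈ I) (hs : s ^ 2 ≤ u) (hm : 0 < m u) :
    0 < 1 / m u + (C u ^ 2 + m u * B u) / m u ^ 2 * s ^ 2 := by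
  by_cases hs0 : s = 0
  · subst hs0; simp; exact hm
  have h : (u, |s|) ∈ pairs I S := ⟨hu, H.mem_S (abs_pos.2 hs0), by simpa using hs⟩
  rw [← sq_abs s, H.normalized_randers_radicand hN h hm]
  exact pow_pos (div_pos (H.normalized_pos' hN h) hm) 2

theorem one_add_B_pos' {u s : ℝ} (hu : u ∈ I) (hs : s ^ 2 ≤ u) (hC : 0 < C u) :
    0 < 1 + B u * s ^ 2 := by
  by_cases hs0 : s = 0
  · subst hs0; simp
  have h : (u, |s|) ∈ pairs I S := ⟨hu, H.mem_S (abs_pos.2 hs0), by simpa using hs⟩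
  rw [← sq_abs s]
  exact H.one_add_B_pos hN h (abs_pos.2 hs0) hC

end Reduced

section
variable {n : ℕ} {M : Type*} [TopologicalSpace M] [ChartedSpace (E n) M] [IsManifold (𝓡 n) ∞ M]
variable {a : RMetric n M} {β : OneForm n M} {φ : ℝ → ℝ → ℝ} {S : Set ℝ} {σ D k₀ k₂ m C B : ℝ → ℝ}

theorem range_inter_eq_of_pos (h : ∀ x, 0 < bsq a β x) :
    Set.range (bsq a β) ∩ Set.Ioi 0 = Set.range (bsq a β) :=
  Set.inter_eq_left.2 (by rintro _ ⟨x, rfl⟩; exact h x)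

/-- In the singular case the sign of `m` distinguishes Randers and Kropina metrics. -/
theorem singular_cases (H : Reduced (Set.range (bsq a β)) (Set.Ioi 0) φ σ D k₀ k₂)
    (hN : ∀ u ∈ Set.range (bsq a β), RelAt (Set.Ioi 0) (φ u) u (m u, C u, 1, B u)) :
    IsRanders (dom a β (Set.Ioi 0)) (genAB a β φ) ∨ IsKropina (dom a β (Set.Ioi 0)) (genAB a β φ) ∨
    ((∃ u ∈ Set.range (bsq a β), σ u = 0) ∧ (∃ u ∈ Set.range (bsq a β), σ u ≠ 0) ∧
      IsRandersKropina (dom a β (Set.Ioi 0)) (genAB a β φ)) := by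
  obtain ⟨hm, hC, hB⟩ := H.contDiffOn_normalized hN
  by_cases h0 : ∀ u ∈ Set.range (bsq a β), m u ≠ 0
  · left
    have hmpos : ∀ u ∈ Set.range (bsq a β), 0 < m u := fun u hu =>
      lt_of_le_of_ne (H.normalized_m_nonneg hN hu) (h0 u hu).symm
    exact isRanders_of_eq (f := fun u => 1 / m u) (g := fun u => (C u ^ 2 + m u * B u) / m u ^ 2)
      (k := fun u => -C u / m u) (contDiffOn_const.div hm h0)
      (((hC.pow 2).add (hm.mul hB)).div (hm.pow 2) fun u hu => pow_ne_zero 2 (h0 u hu))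
      (hC.neg.div hm h0) (fun u hu s hs => H.normalized_randers_pos hN hu hs (hmpos u hu))
      fun u s h => H.normalized_randers hN h (hmpos u h.1)
  right
  push Not at h0
  obtain ⟨u₀, hu₀, hm₀⟩ := h0
  have hCpos : ∀ u ∈ Set.range (bsq a β), 0 < C u := fun u hu =>
    H.normalized_C_pos_of_exists hN hu₀ hm₀ hu
  by_cases h1 : ∀ u ∈ Set.range (bsq a β), m u = 0
  · left
    refine isKropina_of_eq (g := B) (k := fun u => 2 * C u) hB (contDiffOn_const.mul hC)
      (fun u hu s hs => H.one_add_B_pos' hN hu hs (hCpos u hu)) fun u s h => ?_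
    have hs : 0 < s := h.2.1
    have hCu := hCpos u h.1
    have h2 := H.normalized_rel hN h
    rw [h1 u h.1] at h2
    refine ⟨by positivity, ?_⟩
    rw [eq_div_iff (by positivity)]
    linear_combination h2
  · right
    have h2 : ∃ u ∈ Set.range (bsq a β), σ u ≠ 0 := by
      by_contra hno
      push Not at hno
      exact h1 (H.m_eq_zero_of_sigma hN hno hu₀ hm₀)
    push Not at h1
    refine ⟨⟨u₀, hu₀, H.sigma_eq_zero_of_m hN hu₀ hm₀⟩, h2,
      isRandersKropina_of_eq hB hC hm (fun u hu s hs => H.one_add_B_pos' hN hu hs (hCpos u hu))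
      (fun u hu => H.normalized_m_nonneg hN hu) ⟨u₀, hu₀, hm₀⟩ h1 fun u s h => ?_⟩
    have hs : 0 < s := h.2.1
    have hCu := hCpos u h.1
    refine ⟨fun _ => mul_pos hCu hs, ?_⟩
    have e : (C u * s) ^ 2 + m u * (1 + B u * s ^ 2)
        = m u * (1 + B u * s ^ 2) + C u ^ 2 * s ^ 2 := by
      ring
    have h3 := H.normalized_pos' hN h
    have h4 : 0 < C u * s := mul_pos hCu hs
    rw [e, H.normalized_sqrt hN h, eq_div_iff (by linarith)]
    have := H.normalized_rel hN h
    linear_combination this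

/-- In the regular case the relation gives a Randers metric. Its coefficients are derivatives of
`φ` at `s = 0`, so they are smooth also at the zeros of `β`. -/
theorem regular_case [ConnectedSpace M] (hF : IsGeneralABMetric a β φ Set.univ)
    (hne : ∃ x, 0 < bsq a β x)
    (H : Reduced (Set.range (bsq a β) ∩ Set.Ioi 0) Set.univ φ σ D k₀ k₂)
    (hN : ∀ u ∈ Set.range (bsq a β) ∩ Set.Ioi 0, RelAt Set.univ (φ u) u (m u, C u, 1, B u)) :
    IsRanders (dom a β Set.univ) (genAB a β φ) := by
  set V := valueSet a β Set.univ with hV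
  set Φ : ℝ × ℝ → ℝ := fun q => φ q.1 q.2 with hΦ
  have hsub : strictPairs (Set.range (bsq a β) ∩ Set.Ioi 0) Set.univ ⊆ V :=
    (strictPairs_subset _ _).trans pairs_subset_valueSet
  have hO := H.isOpen_strictPairs
  -- The set `V` is convex with nonempty interior, so derivatives within `V` are unique also at its
  -- boundary, which contains `(0, 0)` if `β` has a zero.
  have hVc : Convex ℝ V := by
    rintro ⟨u, s⟩ ⟨h1, -, h2⟩ ⟨v, t⟩ ⟨h3, -, h4⟩ x y hx hy hxy
    refine ⟨(ordConnected_range_bsq (a := a) (β := β)).convex h1 h3 hx hy hxy, trivial, ?_⟩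
    simp only [Prod.smul_mk, Prod.mk_add_mk, smul_eq_mul] at h2 h4 ⊢
    have hy' : y = 1 - x := by linarith
    have : 0 ≤ x * y * (s - t) ^ 2 := by positivity
    have e : (x * s + y * t) ^ 2 = x * s ^ 2 + y * t ^ 2 - x * y * (s - t) ^ 2 := by rw [hy']; ring
    rw [e]
    nlinarith [mul_le_mul_of_nonneg_left h2 hx, mul_le_mul_of_nonneg_left h4 hy]
  have hVu : UniqueDiffOn ℝ V := by
    refine uniqueDiffOn_convex hVc ?_
    obtain ⟨x, hx⟩ := hne
    obtain ⟨h, -⟩ := H.exists_s_pos (u := bsq a β x) ⟨⟨x, rfl⟩, hx⟩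
    exact ⟨_, interior_maximal hsub hO h⟩
  have hd : ContDiffOn ℝ ∞ (fun q => fderivWithin ℝ Φ V q (0, 1)) V :=
    (hF.smooth.fderivWithin hVu (by simp)).clm_apply contDiffOn_const
  have hdd : ContDiffOn ℝ ∞ (fun q => fderivWithin ℝ (fun q => fderivWithin ℝ Φ V q (0, 1)) V q
      (0, 1)) V :=
    (hd.fderivWithin hVu (by simp)).clm_apply contDiffOn_const
  have hline : ContDiffOn ℝ ∞ (fun u : ℝ => (u, (0 : ℝ))) (Set.range (bsq a β)) :=
    ContDiff.contDiffOn (by fun_prop)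
  have hlV : Set.MapsTo (fun u : ℝ => (u, (0 : ℝ))) (Set.range (bsq a β)) V := fun u hu => by
    refine ⟨hu, trivial, ?_⟩
    obtain ⟨x, rfl⟩ := hu
    simpa using bsq_nonneg x
  have hnhds : ∀ q ∈ strictPairs (Set.range (bsq a β) ∩ Set.Ioi 0) Set.univ, V ∈ nhds q :=
      fun q hq =>
    Filter.mem_of_superset (hO.mem_nhds hq) hsub
  have hd2 : ∀ q ∈ strictPairs (Set.range (bsq a β) ∩ Set.Ioi 0) Set.univ,
      fderivWithin ℝ Φ V q (0, 1) = d2 φ q.1 q.2 := fun q hq => by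
    rw [fderivWithin_of_mem_nhds (hnhds q hq)]
    exact ((H.smooth'.smoothAt hO hq).d2_eq).symm
  have hd22 : ∀ q ∈ strictPairs (Set.range (bsq a β) ∩ Set.Ioi 0) Set.univ,
      fderivWithin ℝ (fun q => fderivWithin ℝ Φ V q (0, 1)) V q (0, 1) = d2 (d2 φ) q.1 q.2 := by
    intro q hq
    rw [fderivWithin_of_mem_nhds (hnhds q hq)]
    have hev : (fun q => fderivWithin ℝ Φ V q (0, 1)) =ᶠ[nhds q] fun q => d2 φ q.1 q.2 := by
      filter_upwards [hO.mem_nhds hq] with r hr using hd2 r hr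
    rw [hev.fderiv_eq]
    exact (((H.smooth'.d2 hO).smoothAt hO hq).d2_eq).symm
  have hmem0 : ∀ u ∈ Set.range (bsq a β) ∩ Set.Ioi 0,
      (u, (0 : ℝ)) ∈ strictPairs (Set.range (bsq a β) ∩ Set.Ioi 0) Set.univ := fun u hu =>
    ⟨hu, trivial, by simpa using hu.2⟩
  have hcase : ∀ u ∈ Set.range (bsq a β), u = 0 ∨ u ∈ Set.range (bsq a β) ∩ Set.Ioi 0 :=
      fun u hu => by
    obtain ⟨x, rfl⟩ := hu
    rcases (bsq_nonneg (a := a) (β := β) x).eq_or_lt with h | h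
    · exact Or.inl h.symm
    · exact Or.inr ⟨⟨x, rfl⟩, h⟩
  refine isRanders_of_eq (f := fun u => φ u 0 ^ 2)
    (g := fun u => φ u 0 * fderivWithin ℝ (fun q => fderivWithin ℝ Φ V q (0, 1)) V (u, 0) (0, 1))
    (k := fun u => fderivWithin ℝ Φ V (u, 0) (0, 1))
    ((hF.smooth.comp hline hlV).pow 2) ((hF.smooth.comp hline hlV).mul (hdd.comp hline hlV))
    (hd.comp hline hlV) ?_ ?_
  · intro u hu s hs
    rcases hcase u hu with rfl | hu'
    · have : s = 0 := by nlinarith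
      subst this
      have := hF.pos _ (hlV hu)
      simp only at this
      simp; positivity
    · obtain ⟨h1, h2, h3, h4⟩ := H.normalized_at_zero hN (hmem0 u hu')
      rw [hd22 _ (hmem0 u hu'), h2, h4]
      exact H.normalized_randers_pos hN hu' hs h1
  · intro u s h
    rcases hcase u h.1 with rfl | hu'
    · have : s = 0 := by have := h.2.2; simp only at this; nlinarith
      subst this
      have := hF.pos _ h
      simp only at this
      simp [Real.sqrt_sq this.le]
    · obtain ⟨h1, h2, h3, h4⟩ := H.normalized_at_zero hN (hmem0 u hu')
      rw [hd22 _ (hmem0 u hu'), hd2 _ (hmem0 u hu'), h2, h4, h3]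
      exact H.normalized_randers hN ⟨hu', h.2⟩ h1

end

/-! ### The explicit form and the classification -/

namespace Reduced
variable {I S : Set ℝ} {φ : ℝ → ℝ → ℝ} {σ D k₀ k₂ : ℝ → ℝ} (H : Reduced I S φ σ D k₀ k₂)
include H

theorem charCurve_mem_pairs {T : ℝ → ℝ} {κ ε u : ℝ} (hκ : 0 ≤ κ) (hε : ε ^ 2 = 1) (hεS : ε ∈ S)
    (hu : u ∈ I) : (u, charCurve T κ ε u) ∈ pairs I S := by
  have hu0 := H.pos_left u hu
  refine ⟨hu, ?_, ?_⟩
  · rcases H.regular_or_singular with h | h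
    · rw [h]; trivial
    · rw [h] at hεS ⊢
      exact mul_pos hεS (Real.sqrt_pos.2 (by positivity))
  · simp only [charCurve_sq hκ hε hu0]
    rw [div_le_iff₀ (by positivity)]
    have : 0 ≤ κ * Real.exp (T u) := by positivity
    nlinarith

/-- The first integral at an arbitrary point in terms of its values at `u₀`, including the boundary
characteristic `κ = 0`. -/
theorem charInt_eq (hp : ∀ u ∈ I, 1 - 2 * k₀ u * u = 0) {T : ℝ → ℝ}
    (hT : ∀ u ∈ I, HasDerivAt T (2 * k₂ u * u) u) {u₀ u s ε : ℝ} (h₀ : u₀ ∈ I)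
    (h : (u, s) ∈ pairs I S) (hε : ε ^ 2 = 1) (hεs : 0 < ε * s) (hεS : ε ∈ S) :
    charInt φ T u s = charInt φ T u₀ (charCurve T ((u / s ^ 2 - 1) * Real.exp (-T u)) ε u₀) := by
  have hu := H.pos_left u h.1
  have hu₀ := H.pos_left u₀ h₀
  have hs0 : s ≠ 0 := by rintro rfl; simp at hεs
  have hint : ∀ r, (u, r) ∈ strictPairs I S → 0 < ε * r → charInt φ T u r =
      charInt φ T u₀ (charCurve T ((u / r ^ 2 - 1) * Real.exp (-T u)) ε u₀) := fun r hr hεr => by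
    have hr0 : r ≠ 0 := by rintro rfl; simp at hεr
    have hκ : 0 < (u / r ^ 2 - 1) * Real.exp (-T u) := by
      refine mul_pos (sub_pos.2 ?_) (Real.exp_pos _)
      rw [lt_div_iff₀ (by positivity)]
      have := hr.2.2
      simp only at this
      linarith
    rw [← H.charInt_const hT hκ hε hεS h₀ h.1 fun v hv =>
        hp v (H.ordConnected.uIcc_subset h₀ h.1 hv),
      charCurve_eq hεr hε hu]
  rcases h.2.2.lt_or_eq with hlt | heq
  · exact hint s ⟨h.1, h.2.1, hlt⟩ hεs
  obtain ⟨h1, h2, -⟩ := H.exists_continuousOn_ray h heq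
  have hl0 : ∀ l ∈ Set.Icc (1 / 2 : ℝ) 1, l ≠ 0 := fun l hl => by
    have := hl.1; intro h; rw [h] at this; norm_num at this
  have hκc : ContinuousOn (fun l : ℝ => (u / (l * s) ^ 2 - 1) * Real.exp (-T u))
      (Set.Icc (1 / 2) 1) := by
    refine ContinuousOn.mul (ContinuousOn.sub (ContinuousOn.div (by fun_prop) (by fun_prop) ?_)
        (by fun_prop)) (by fun_prop)
    exact fun l hl => pow_ne_zero 2 (mul_ne_zero (hl0 l hl) hs0)
  have hκ0 : ∀ l ∈ Set.Icc (1 / 2 : ℝ) 1, 0 ≤ (u / (l * s) ^ 2 - 1) * Real.exp (-T u) :=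
      fun l hl => by
    refine mul_nonneg (sub_nonneg.2 ?_) (Real.exp_pos _).le
    have hl' := hl0 l hl
    rw [le_div_iff₀ (by positivity), one_mul, mul_pow]
    simp only at heq
    rw [heq]
    have : l ^ 2 ≤ 1 := by nlinarith [hl.1, hl.2]
    nlinarith
  have hcc : ContinuousOn (fun l : ℝ => charCurve T ((u / (l * s) ^ 2 - 1) * Real.exp (-T u)) ε u₀)
      (Set.Icc (1 / 2) 1) := by
    unfold charCurve
    refine continuousOn_const.mul (ContinuousOn.sqrt (ContinuousOn.div continuousOn_const
      (continuousOn_const.add (hκc.mul continuousOn_const)) fun l hl => ?_))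
    have := hκ0 l hl
    positivity
  have hR : ContinuousOn (fun l : ℝ => charInt φ T u₀
      (charCurve T ((u / (l * s) ^ 2 - 1) * Real.exp (-T u)) ε u₀)) (Set.Icc (1 / 2) 1) := by
    unfold charInt
    refine ContinuousOn.div (ContinuousOn.mul (ContinuousOn.mul ?_ continuousOn_const)
      continuousOn_const) hcc fun l hl => charCurve_ne_zero (hκ0 l hl) hε hu₀
    refine (H.continuousOn_slice h₀).comp hcc fun l hl => ?_
    exact (H.charCurve_mem_pairs (hκ0 l hl) hε hεS h₀).2
  have hL : ContinuousOn (fun l : ℝ => charInt φ T u (l * s)) (Set.Icc (1 / 2) 1) := by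
    unfold charInt
    refine ContinuousOn.div (ContinuousOn.mul (ContinuousOn.mul h2 continuousOn_const)
      continuousOn_const) (by fun_prop) fun l hl => mul_ne_zero (hl0 l hl) hs0
  have := eq_right_of_eqOn_Ico (by norm_num) hL hR fun l hl => hint (l * s) (h1 l hl) (by
    have : 0 < l := by linarith [hl.1]
    have := mul_pos this hεs
    linarith [mul_left_comm ε l s])
  simpa using this

end Reduced

/-- For `A = log u - T` and `J = 1 - e^{-T}` the variable `ξ` is `1 / (1 + κ)`. -/
theorem xi_eq {T : ℝ → ℝ} {u s : ℝ} (hu : 0 < u) (hs : s ≠ 0) (hsu : s ^ 2 ≤ u) :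
    xi (fun u => Real.log u - T u) (fun u => 1 - Real.exp (-T u)) u s =
      1 / (1 + (u / s ^ 2 - 1) * Real.exp (-T u)) ∧
    0 < Real.exp (Real.log u - T u) + s ^ 2 * (1 - Real.exp (-T u)) := by
  have e : Real.exp (Real.log u - T u) = u * Real.exp (-T u) := by
    rw [sub_eq_add_neg, Real.exp_add, Real.exp_log hu]
  have hx : 0 < Real.exp (-T u) := Real.exp_pos _
  have h2 : 0 < s ^ 2 := by positivity
  have h3 : 0 < u * Real.exp (-T u) + s ^ 2 * (1 - Real.exp (-T u)) := by nlinarith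
  rw [xi, e]
  refine ⟨?_, h3⟩
  have h4 : 1 + (u / s ^ 2 - 1) * Real.exp (-T u) =
      (u * Real.exp (-T u) + s ^ 2 * (1 - Real.exp (-T u))) / s ^ 2 := by field_simp; ring
  rw [h4, one_div_div]

section
variable {n : ℕ} {M : Type*} [TopologicalSpace M] [ChartedSpace (E n) M] [IsManifold (𝓡 n) ∞ M]
variable {a : RMetric n M} {β : OneForm n M} {φ : ℝ → ℝ → ℝ} {S : Set ℝ} {σ D k₀ k₂ : ℝ → ℝ}

/-- If `1 - 2 k₀ u` vanishes identically then `u φ(u, 0)²` is constant, which excludes `u = 0`. -/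
theorem bsq_ne_zero_of_coeff_zero [ConnectedSpace M] (hF : IsGeneralABMetric a β φ S)
    (hne : ∃ x, 0 < bsq a β x) (H : Reduced (Set.range (bsq a β) ∩ Set.Ioi 0) S φ σ D k₀ k₂)
    (hp : ∀ u ∈ Set.range (bsq a β) ∩ Set.Ioi 0, 1 - 2 * k₀ u * u = 0) (x : M) : 0 < bsq a β x := by
  by_cases hS : S = Set.univ
  swap
  · exact bsq_pos_of_singular hF hS x
  subst hS
  refine lt_of_le_of_ne (bsq_nonneg x) fun hx => ?_
  obtain ⟨x₁, hx₁⟩ := hne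
  have hmem : ∀ u ∈ Set.range (bsq a β) ∩ Set.Ioi 0,
      (u, (0 : ℝ)) ∈ strictPairs (Set.range (bsq a β) ∩ Set.Ioi 0) Set.univ := fun u hu =>
    ⟨hu, trivial, by simpa using hu.2⟩
  obtain ⟨K, hK⟩ := exists_const_of_hasDerivAt_zero (f := fun u => u * φ u 0 ^ 2) H.isOpen
    H.ordConnected fun u hu => by
      have hu0 : 0 < u := hu.2
      have h1 := H.two_mul_d1 (hmem u hu)
      obtain ⟨hσ, hq⟩ := H.eq_zero_of_coeff_zero hu (hp u hu)
      refine ((hasDerivAt_id u).mul ((H.hasDerivAt_u (hmem u hu)).pow 2)).congr_deriv ?_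
      have hD : u * D u = -1 := by linear_combination u * hq + hp u hu
      rw [hσ] at h1
      simp only [id, Pi.pow_apply]
      norm_num
      linear_combination u * φ u 0 * h1 + φ u 0 ^ 2 * hD
  have hsub : Set.Ioc 0 (bsq a β x₁) ⊆ Set.range (bsq a β) ∩ Set.Ioi 0 := fun u hu => by
    refine ⟨(ordConnected_range_bsq (a := a) (β := β)).out ⟨x, hx.symm⟩ ⟨x₁, rfl⟩ ⟨hu.1.le, hu.2⟩,
        hu.1⟩
  have hc : ContinuousOn (fun u => u * φ u 0 ^ 2) (Set.Icc 0 (bsq a β x₁)) := by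
    have hφ : ContinuousOn (fun u => φ u 0) (Set.Icc 0 (bsq a β x₁)) :=
      hF.smooth.continuousOn.comp (f := fun u : ℝ => (u, (0 : ℝ))) (by fun_prop) fun u hu =>
        ⟨(ordConnected_range_bsq (a := a) (β := β)).out ⟨x, hx.symm⟩ ⟨x₁, rfl⟩ hu, trivial,
          by simpa using hu.1⟩
    fun_prop
  have h1 : (0 : ℝ) * φ 0 0 ^ 2 = K :=
    (show Set.EqOn (fun u => u * φ u 0 ^ 2) (fun _ => K) (Set.Ioc 0 (bsq a β x₁)) from
      fun u hu => hK u (hsub hu)).of_subset_closure hc continuousOn_const Set.Ioc_subset_Icc_self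
      (by rw [closure_Ioc hx₁.ne]) (Set.left_mem_Icc.2 hx₁.le)
  have hI : bsq a β x₁ ∈ Set.range (bsq a β) ∩ Set.Ioi 0 := ⟨⟨x₁, rfl⟩, hx₁⟩
  have h2 := hK _ hI
  have h3 := H.pos' (hmem _ hI)
  rw [← h1, zero_mul] at h2
  exact (mul_pos hx₁ (pow_pos h3 2)).ne' h2

/-- If `1 - 2 k₀ u` vanishes identically, the first integral `charInt` is a function of the label
`κ` of the characteristics, that is, of `ξ = 1 / (1 + κ)`. -/
theorem hasExplicitForm_of_coeff_zero (hne : ∀ x, 0 < bsq a β x) [Nonempty M]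
    (H : Reduced (Set.range (bsq a β)) S φ σ D k₀ k₂)
    (hp : ∀ u ∈ Set.range (bsq a β), 1 - 2 * k₀ u * u = 0) :
    HasExplicitForm a β (dom a β S) (genAB a β φ) := by
  obtain ⟨T, hT⟩ := H.exists_T
  set x₀ : M := Classical.arbitrary M
  set u₀ := bsq a β x₀ with hu₀def
  have h₀ : u₀ ∈ Set.range (bsq a β) := ⟨x₀, rfl⟩
  have hu₀ : 0 < u₀ := hne x₀
  set A : ℝ → ℝ := fun u => Real.log u - T u with hA
  set J : ℝ → ℝ := fun u => 1 - Real.exp (-T u) with hJ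
  set C : ℝ → ℝ := fun u => T u / 2 - Real.log u with hC
  have hxi : ∀ ξ ∈ xiSet a β A J, 0 < ξ ∧ 0 ≤ 1 / ξ - 1 := by
    rintro _ ⟨⟨u, s⟩, ⟨⟨x, hx⟩, hs, hsu⟩, rfl⟩
    simp only at hx hs hsu ⊢
    have hu : 0 < u := hx ▸ hne x
    have hs' : 0 < s := hs
    obtain ⟨h1, h2⟩ := xi_eq (T := T) hu hs'.ne' hsu
    have h3 : 0 ≤ (u / s ^ 2 - 1) * Real.exp (-T u) := by
      refine mul_nonneg (sub_nonneg.2 ?_) (Real.exp_pos _).le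
      rw [le_div_iff₀ (by positivity)]; linarith
    rw [hA, hJ, h1, one_div_one_div]
    exact ⟨by positivity, by linarith⟩
  -- The function of `ξ` is the first integral at the fixed value `u₀`; `ε` is the sign of `s`.
  have hΨ : ∀ ε : ℝ, ε ^ 2 = 1 → ε ∈ S → ∃ Ψ : ℝ → ℝ, ContDiffOn ℝ 1 Ψ (xiSet a β A J) ∧
      (∀ ξ ∈ xiSet a β A J, 0 < Ψ ξ) ∧ ∀ u s, (u, s) ∈ pairs (Set.range (bsq a β)) S → 0 < ε * s →
        φ u s = Ψ (xi A J u s) * Real.exp (C u) * (ε * s) := by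
    intro ε hε hεS
    have hε0 : ε ≠ 0 := by rintro rfl; simp at hε
    have hcc : ContDiffOn ℝ 1 (fun ξ : ℝ => charCurve T (1 / ξ - 1) ε u₀) (xiSet a β A J) := by
      unfold charCurve
      have h1 : ContDiffOn ℝ 1 (fun ξ : ℝ => 1 + (1 / ξ - 1) * Real.exp (T u₀)) (xiSet a β A J) :=
        contDiffOn_const.add (((contDiffOn_const.div contDiffOn_id fun ξ hξ => (hxi ξ hξ).1.ne').sub
          contDiffOn_const).mul contDiffOn_const)
      have h2 : ∀ ξ ∈ xiSet a β A J, 0 < 1 + (1 / ξ - 1) * Real.exp (T u₀) := fun ξ hξ => by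
        have := (hxi ξ hξ).2
        positivity
      refine contDiffOn_const.mul ((contDiffOn_const.div h1 fun ξ hξ => (h2 ξ hξ).ne').sqrt
        fun ξ hξ => ?_)
      exact (div_pos hu₀ (h2 ξ hξ)).ne'
    have hmaps : ∀ ξ ∈ xiSet a β A J, (u₀, charCurve T (1 / ξ - 1) ε u₀)
        ∈ pairs (Set.range (bsq a β)) S :=
      fun ξ hξ => H.charCurve_mem_pairs (hxi ξ hξ).2 hε hεS h₀
    have hεpos : ∀ ξ ∈ xiSet a β A J, 0 < ε * charCurve T (1 / ξ - 1) ε u₀ := fun ξ hξ => by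
      have := (hxi ξ hξ).2
      rw [charCurve, ← mul_assoc, ← sq, hε, one_mul]
      positivity
    refine ⟨fun ξ => ε * charInt φ T u₀ (charCurve T (1 / ξ - 1) ε u₀), ?_, ?_, ?_⟩
    · unfold charInt
      refine contDiffOn_const.mul (ContDiffOn.div
          (ContDiffOn.mul (ContDiffOn.mul ?_ contDiffOn_const)
        contDiffOn_const) hcc fun ξ hξ => charCurve_ne_zero (hxi ξ hξ).2 hε hu₀)
      exact (H.smooth.of_le (by simp)).comp (f := fun ξ => (u₀, charCurve T (1 / ξ - 1) ε u₀))
        (contDiffOn_const.prodMk hcc) hmaps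
    · intro ξ hξ
      have h1 := H.pos _ (hmaps ξ hξ)
      have h2 := hεpos ξ hξ
      have h3 : ε * charInt φ T u₀ (charCurve T (1 / ξ - 1) ε u₀) =
          φ u₀ (charCurve T (1 / ξ - 1) ε u₀) * u₀ * Real.exp (-T u₀ / 2) /
            (ε * charCurve T (1 / ξ - 1) ε u₀) := by
        rw [charInt]
        have : charCurve T (1 / ξ - 1) ε u₀ ≠ 0 := fun h => by rw [h] at h2; simp at h2
        field_simp
        rw [hε]
      beta_reduce
      rw [h3]
      simp only at h1
      positivity
    · intro u s h hεs
      have hu : 0 < u := H.pos_left u h.1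
      have hs0 : s ≠ 0 := by rintro rfl; simp at hεs
      have h1 := H.charInt_eq hp hT h₀ h hε hεs hεS
      have h2 := (xi_eq (T := T) hu hs0 h.2.2).1
      beta_reduce
      rw [hA, hJ, h2, one_div_one_div, add_sub_cancel_left, ← h1, charInt, hC]
      have h3 : Real.exp (T u / 2 - Real.log u) = (Real.exp (-T u / 2))⁻¹ / u := by
        rw [Real.exp_sub, Real.exp_log hu, ← Real.exp_neg]; congr 2; ring
      simp only [h3]
      have h4 := (Real.exp_pos (-T u / 2)).ne'
      field_simp
      rw [hε, mul_one]
  have h1S : (1 : ℝ) ∈ S := H.mem_S one_pos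
  obtain ⟨ϕ, hϕ, hϕpos, hϕeq⟩ := hΨ 1 (by norm_num) h1S
  obtain ⟨ψ, hψ, hψpos, hψeq⟩ : ∃ Ψ : ℝ → ℝ, ContDiffOn ℝ 1 Ψ (xiSet a β A J) ∧
      (∀ ξ ∈ xiSet a β A J, 0 < Ψ ξ) ∧ ∀ u s, (u, s) ∈ pairs (Set.range (bsq a β)) S → s < 0 →
        φ u s = Ψ (xi A J u s) * Real.exp (C u) * |s| := by
    rcases H.regular_or_singular with hS | hS
    · obtain ⟨Ψ, h1, h2, h3⟩ := hΨ (-1) (by norm_num) (by rw [hS]; trivial)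
      refine ⟨Ψ, h1, h2, fun u s h hs => ?_⟩
      rw [h3 u s h (by linarith), abs_of_neg hs]; ring
    · refine ⟨ϕ, hϕ, hϕpos, fun u s h hs => ?_⟩
      have := h.2.1
      rw [hS] at this
      exact absurd hs (not_lt.2 (le_of_lt this))
  refine ⟨fun x => (hne x).ne', fun u => 2 * k₂ u, A, J, C, ϕ, ψ,
      contDiffOn_const.mul H.contDiffOn_k₂,
    fun u hu => ?_, ?_, hϕ, hϕpos, hψ, hψpos, fun x y hy => ⟨fun hs => ?_, fun hs => ?_⟩⟩
  · have hu0 := H.pos_left u hu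
    have hexp : Real.exp (A u) = u * Real.exp (-T u) := by
      rw [hA]; simp only; rw [sub_eq_add_neg, Real.exp_add, Real.exp_log hu0]
    refine ⟨((Real.hasDerivAt_log hu0.ne').sub (hT u hu)).congr_deriv (by rw [one_div]; ring),
      ((hT u hu).neg.exp.const_sub 1).congr_deriv (by rw [hexp, Pi.neg_apply]; ring),
      (((hT u hu).div_const 2).sub (Real.hasDerivAt_log hu0.ne')).congr_deriv
          (by rw [one_div]; ring)⟩
  · rintro ⟨u, s⟩ ⟨hu, hs, hsu⟩
    have hs' : 0 < s := hs
    exact (xi_eq (T := T) (H.pos_left u hu) hs'.ne' hsu).2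
  · have h := mem_valueSet hy
    rw [genAB, hϕeq _ _ h (by linarith)]; ring
  · have h := mem_valueSet hy
    rw [genAB, hψeq _ _ h hs]; ring

/-- A metric of isotropic Berwald curvature has the explicit form if `1 - 2 k₀ u` vanishes
identically; otherwise the relation between `φ` and `s` makes it Randers, Kropina or glued.
Riemannian metrics are Randers metrics with vanishing `1`-form. -/
theorem classification_of_isIsotropicBerwald [ConnectedSpace M] (hn : 2 ≤ n) {c : M → ℝ}
    (hc : ∀ x, c x ≠ 0)
    (hβ : IsClosedConformal a β c) (hF : IsGeneralABMetric a β φ S) {τ : M → ℝ}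
    (hτ : IsIsotropicBerwald (dom a β S) (genAB a β φ) τ) :
    IsRanders (dom a β S) (genAB a β φ) ∨ IsKropina (dom a β S) (genAB a β φ) ∨
    (IsBerwald (dom a β S) (genAB a β φ) ∧ HasExplicitForm a β (dom a β S) (genAB a β φ)) ∨
    (S = Set.Ioi 0 ∧ (∃ x, τ x = 0) ∧ (∃ x, τ x ≠ 0) ∧
      IsRandersKropina (dom a β S) (genAB a β φ)) := by
  obtain ⟨σ, D, k₀, k₂, H, hσ⟩ := exists_reduced hn hc hβ hF hτ
  have hne := exists_bsq_pos (a := a) (β := β) hn hc hβ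
  rcases H.coeff_zero_or_relAt with hp | hrel
  · right; right; left
    have hpos := bsq_ne_zero_of_coeff_zero hF hne H hp
    have hτ0 : ∀ x, τ x = 0 := fun x => by
      rw [hσ x (hpos x), (H.eq_zero_of_coeff_zero ⟨⟨x, rfl⟩, hpos x⟩ (hp _ ⟨⟨x, rfl⟩, hpos x⟩)).1,
          zero_mul]
    rw [range_inter_eq_of_pos hpos] at H hp
    refine ⟨fun e he p hp y hy j i k l => ?_, hasExplicitForm_of_coeff_zero hpos H hp⟩
    rw [hτ e he p hp y hy j i k l, hτ0, zero_mul]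
  · obtain ⟨m, C, B, hN⟩ := H.exists_normalized hrel
    rcases hF.regular_or_singular with hS | ⟨hS, -⟩
    · subst hS
      exact Or.inl (regular_case hF hne H hN)
    · subst hS
      have hpos := bsq_pos_of_singular hF (fun h => by
        have : (0 : ℝ) ∈ Set.Ioi (0 : ℝ) := by rw [h]; trivial
        exact lt_irrefl (0 : ℝ) this)
      rw [range_inter_eq_of_pos hpos] at H hN
      rcases singular_cases H hN with h | h | ⟨⟨_, ⟨x, rfl⟩, hx⟩, ⟨_, ⟨x', rfl⟩, hx'⟩, h⟩
      · exact Or.inl h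
      · exact Or.inr (Or.inl h)
      · refine Or.inr (Or.inr (Or.inr ⟨rfl, ⟨x, ?_⟩, ⟨x', ?_⟩, h⟩))
        · rw [hσ x (hpos x), hx, zero_mul]
        · rw [hσ x' (hpos x')]; exact mul_ne_zero hx' (hc x')

end

/-! ### Metrics of the explicit form are Berwald metrics -/

section QuadForm
variable {n : ℕ}

/-- `f` is a quadratic form on `ℝⁿ`. -/
def IsQuadForm (f : E n → ℝ) : Prop :=
  ∃ q : Fin n → Fin n → ℝ, ∀ y, f y = ∑ i, ∑ j, q i j * y i * y j

variable {f g : E n → ℝ}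

theorem IsQuadForm.add (hf : IsQuadForm f) (hg : IsQuadForm g) : IsQuadForm fun y => f y + g y := by
  obtain ⟨q, h⟩ := hf
  obtain ⟨q', h'⟩ := hg
  refine ⟨fun i j => q i j + q' i j, fun y => ?_⟩
  simp only [h, h', ← Finset.sum_add_distrib, add_mul]

theorem IsQuadForm.const_mul (hf : IsQuadForm f) (k : ℝ) : IsQuadForm fun y => k * f y := by
  obtain ⟨q, h⟩ := hf
  refine ⟨fun i j => k * q i j, fun y => ?_⟩
  simp only [h, Finset.mul_sum, mul_assoc]

theorem IsQuadForm.sum {ι : Type*} {t : Finset ι} {f : ι → E n → ℝ}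
    (hf : ∀ i ∈ t, IsQuadForm (f i)) : IsQuadForm fun y => ∑ i ∈ t, f i y := by
  classical
  induction t using Finset.induction_on with
  | empty => exact ⟨fun _ _ => 0, fun y => by simp⟩
  | insert i t hi ih =>
    simp only [Finset.sum_insert hi]
    exact (hf i (Finset.mem_insert_self _ _)).add
      (ih fun j hj => hf j (Finset.mem_insert_of_mem hj))

theorem IsQuadForm.mul_linear (b d : Fin n → ℝ) :
    IsQuadForm fun y => (∑ i, b i * y i) * ∑ j, d j * y j := by
  refine ⟨fun i j => b i * d j, fun y => ?_⟩
  beta_reduce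
  rw [Finset.sum_mul_sum]
  exact Finset.sum_congr rfl fun i _ => Finset.sum_congr rfl fun j _ => by ring

theorem IsQuadForm.pd_pd_pd (hf : IsQuadForm f) (j k l : Fin n) (y : E n) :
    pd l (pd k (pd j f)) y = 0 := by
  obtain ⟨q, h⟩ := hf
  have h1 : pd j f = fun y => ∑ i, (q j i + q i j) * y i := by
    funext y
    have : f = fun y => ∑ i, ∑ j, q i j * y i * y j := funext h
    rw [this, pd_sum (fun i _ => by fun_prop)]
    have e : ∀ i, pd j (fun y : E n => ∑ m, q i m * y i * y m) y =
        ∑ m, (q i m * (if i = j then 1 else 0) * y m + q i m * y i * if m = j then 1 else 0) := by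
      intro i
      rw [pd_sum (fun m _ => by fun_prop)]
      refine Finset.sum_congr rfl fun m _ => ?_
      rw [pd_mul (by fun_prop) (by fun_prop), pd_const_mul (by fun_prop), pd_coord, pd_coord]
    simp only [e, Finset.sum_add_distrib, add_mul]
    congr 1
    · have : ∀ i, ∑ m, q i m * (if i = j then 1 else 0) * y m =
          if i = j then ∑ m, q i m * y m else 0 := fun i => by split_ifs <;> simp
      simp only [this, Finset.sum_ite_eq', Finset.mem_univ, if_true]
    · simp
  have h2 : pd k (pd j f) = fun _ => q j k + q k j := by
    funext y
    rw [h1, pd_sum (fun i _ => by fun_prop)]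
    have e : ∀ i, pd k (fun y : E n => (q j i + q i j) * y i) y =
        (q j i + q i j) * if i = k then 1 else 0 := fun i => by
      rw [pd_const_mul (by fun_prop), pd_coord]
    simp only [e]
    simp
  rw [h2, pd_const]

theorem eventually_quadratic_ne_zero {a b c : ℝ} (h : a ≠ 0 ∨ b ≠ 0 ∨ c ≠ 0) :
    ∀ᶠ r in nhdsWithin (0 : ℝ) {0}ᶜ, a + b * r + c * r ^ 2 ≠ 0 := by
  by_cases ha : a = 0
  · by_cases hb : b = 0
    · filter_upwards [self_mem_nhdsWithin] with r hr
      have hr' : r ≠ 0 := hr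
      have hc : c ≠ 0 := by tauto
      rw [ha, hb, zero_mul, zero_add, zero_add]
      positivity
    · have hc : ContinuousAt (fun r => b + c * r) 0 := by fun_prop
      filter_upwards [self_mem_nhdsWithin, nhdsWithin_le_nhds (hc.eventually_ne
        (by simpa using hb))] with r hr hr2
      rw [ha]
      have : 0 + b * r + c * r ^ 2 = r * (b + c * r) := by ring
      rw [this]
      exact mul_ne_zero hr hr2
  · have hc : ContinuousAt (fun r => a + b * r + c * r ^ 2) 0 := by fun_prop
    exact nhdsWithin_le_nhds (hc.eventually_ne (by simpa using ha))

end QuadForm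

section
variable {n : ℕ} {M : Type*} [TopologicalSpace M] [ChartedSpace (E n) M] [IsManifold (𝓡 n) ∞ M]
variable {a : RMetric n M} {β : OneForm n M} {φ : ℝ → ℝ → ℝ} {S : Set ℝ} {c : M → ℝ}
  {e : OpenPartialHomeomorph M (E n)}

/-- The values of `φ` along a curve on which `ξ` is constant. No derivative of the functions in the
explicit form enters. -/
theorem transport_of_explicit {A J C t : ℝ → ℝ} {O : Set (ℝ × ℝ)} (hO : IsOpen O)
    (hφ : SmoothOn φ O) {u s ε K : ℝ} (h : (u, s) ∈ O) (hu : u ≠ 0) (hε : ε ^ 2 = 1)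
        (hεs : 0 < ε * s)
    (hA : HasDerivAt A (1 / u - u * t u) u) (hJ : HasDerivAt J (t u * Real.exp (A u)) u)
    (hC : HasDerivAt C (u * t u / 2 - 1 / u) u) (hden : 0 < Real.exp (A u) + s ^ 2 * J u)
    (hval : ∀ q ∈ O, 0 < ε * q.2 → xi A J q.1 q.2 = xi A J u s →
      φ q.1 q.2 = K * Real.exp (C q.1) * (ε * q.2)) :
    2 * d1 φ u s = t u * s * (s * φ u s + (u - s ^ 2) * d2 φ u s) - (φ u s + s * d2 φ u s) / u := by
  have hs0 : s ≠ 0 := by rintro rfl; simp at hεs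
  set ξ := xi A J u s with hξ
  have hξ' : ξ = s ^ 2 / (Real.exp (A u) + s ^ 2 * J u) := rfl
  have h1 : 1 - ξ * J u = Real.exp (A u) / (Real.exp (A u) + s ^ 2 * J u) := by
    rw [hξ']; field_simp; ring
  have hξpos : 0 < ξ := by rw [hξ']; positivity
  have h2 : 0 < 1 - ξ * J u := by rw [h1]; positivity
  -- The curves of constant `ξ` are `s² = ξ e^A / (1 - ξ J)`.
  set Q : ℝ → ℝ := fun v => ξ * Real.exp (A v) / (1 - ξ * J v) with hQ
  have hQu : Q u = s ^ 2 := by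
    rw [hQ]; simp only; rw [h1, hξ']; field_simp
  set γ : ℝ → ℝ := fun v => ε * √(Q v) with hγ
  have hγu : γ u = s := by
    have : s ^ 2 = (ε * s) ^ 2 := by rw [mul_pow, hε, one_mul]
    rw [hγ]; simp only
    rw [hQu, this, Real.sqrt_sq hεs.le, ← mul_assoc, ← sq, hε, one_mul]
  have hQd : HasDerivAt Q (s ^ 2 * (1 / u - u * t u + t u * s ^ 2)) u := by
    refine ((hA.exp.const_mul ξ).div ((hJ.const_mul ξ).const_sub 1) h2.ne').congr_deriv ?_
    have e1 : s ^ 2 = ξ * Real.exp (A u) / (1 - ξ * J u) := hQu.symm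
    rw [e1]
    field_simp
    ring
  have hγd : HasDerivAt γ (s / 2 * (1 / u - u * t u + t u * s ^ 2)) u := by
    refine ((hQd.sqrt (by rw [hQu]; positivity)).const_mul ε).congr_deriv ?_
    have e2 : √(Q u) = ε * s := by
      rw [hQu, show s ^ 2 = (ε * s) ^ 2 by rw [mul_pow, hε, one_mul], Real.sqrt_sq hεs.le]
    rw [e2]
    have hε0 : ε ≠ 0 := by rintro rfl; simp at hε
    field_simp
  have hcurve : ∀ᶠ v in nhds u, (v, γ v) ∈ O ∧ 0 < 1 - ξ * J v ∧ 0 < Q v := by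
    have hc : ContinuousAt (fun v => (v, γ v)) u := continuousAt_id.prodMk hγd.continuousAt
    have c1 := hc.preimage_mem_nhds (hO.mem_nhds (by rw [hγu]; exact h))
    have c2 := (continuousAt_const.sub (continuousAt_const.mul hJ.continuousAt) :
      ContinuousAt (fun v => 1 - ξ * J v) u).eventually_const_lt h2
    have c3 := hQd.continuousAt.eventually_const_lt (show 0 < Q u by rw [hQu]; positivity)
    filter_upwards [c1, c2, c3] with v h1 h2 h3 using ⟨h1, h2, h3⟩
  have hev : (fun v => φ v (γ v)) =ᶠ[nhds u] fun v => K * Real.exp (C v) * (ε * γ v) := by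
    filter_upwards [hcurve] with v hv
    have e0 : ε * γ v = √(Q v) := by rw [hγ]; simp only; rw [← mul_assoc, ← sq, hε, one_mul]
    refine hval (v, γ v) hv.1 (by rw [e0]; exact Real.sqrt_pos.2 hv.2.2) ?_
    have e1 : γ v ^ 2 = Q v := by
      rw [hγ]; simp only; rw [mul_pow, hε, one_mul, Real.sq_sqrt hv.2.2.le]
    simp only
    rw [xi, e1]
    have e3 : Real.exp (A v) + Q v * J v = Real.exp (A v) / (1 - ξ * J v) := by
      rw [hQ]; have := hv.2.1.ne'; field_simp; ring
    rw [e3, hQ]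
    have := hv.2.1.ne'
    field_simp
  have hL := (hφ.smoothAt hO (q := (u, γ u)) (by rw [hγu]; exact h)).hasDerivAt_comp
    (x := fun v => v) (hasDerivAt_id u) hγd
  have hR := (hC.exp.const_mul K).mul (hγd.const_mul ε)
  have hd := (hR.congr_of_eventuallyEq hev).unique hL
  have hφu := hval (u, s) h hεs rfl
  simp only [hγu] at hd hφu
  have hk : K * Real.exp (C u) * ε = φ u s / s := by rw [hφu]; field_simp
  have e5 : K * (Real.exp (C u) * (u * t u / 2 - 1 / u)) * (ε * s) +
      K * Real.exp (C u) * (ε * (s / 2 * (1 / u - u * t u + t u * s ^ 2))) =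
      (K * Real.exp (C u) * ε) * (s * (u * t u / 2 - 1 / u) +
        s / 2 * (1 / u - u * t u + t u * s ^ 2)) := by ring
  rw [e5, hk] at hd
  field_simp at hd ⊢
  linear_combination (-1) * hd

/-- The equations of the spray coefficients for `P = -s / u` and `R = 1 / (2 u) + t s² / 2`. -/
theorem spray_equations_of_transport {O : Set (ℝ × ℝ)} (hO : IsOpen O) (hφ : SmoothOn φ O)
    {t : ℝ → ℝ} (hu : ∀ q ∈ O, q.1 ≠ 0)
    (hT : ∀ u s, (u, s) ∈ O → 2 * d1 φ u s =
      t u * s * (s * φ u s + (u - s ^ 2) * d2 φ u s) - (φ u s + s * d2 φ u s) / u) {u s : ℝ}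
    (h : (u, s) ∈ O) :
    d2 (d2 φ) u s - 2 * d1 φ u s + 2 * s * d1 (d2 φ) u s
      = 2 * (1 / (2 * u) + t u * s ^ 2 / 2) * cvx φ u s ∧
    d2 φ u s + 2 * s * d1 φ u s = 2 * (1 / (2 * u) + t u * s ^ 2 / 2) *
      (s * φ u s + (u - s ^ 2) * d2 φ u s) + 2 * (-s / u) * φ u s := by
  have hu0 : u ≠ 0 := hu _ h
  have h0 := hT u s h
  refine ⟨?_, ?_⟩
  · have hd := (hφ.smoothAt hO h).hasDerivAt_right
    have hdd := ((hφ.d2 hO).smoothAt hO h).hasDerivAt_right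
    have hud := ((hφ.d1 hO).smoothAt hO h).hasDerivAt_right
    have hcomm := hφ.d1_d2_comm hO h
    simp only at hcomm
    have hs := hasDerivAt_id s
    have hR := ((hs.const_mul (t u)).mul ((hs.mul hd).add (((hs.pow 2).const_sub u).mul hdd))).sub
      ((hd.add (hs.mul hdd)).div_const u)
    have hc : Continuous fun r : ℝ => (u, r) := by fun_prop
    have hev : (fun r => 2 * d1 φ u r) =ᶠ[nhds s] fun r => t u * r * (r * φ u r +
        (u - r ^ 2) * d2 φ u r) - (φ u r + r * d2 φ u r) / u := by
      filter_upwards [(hO.preimage hc).mem_nhds h] with r hr using hT u r hr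
    have h1 := (hR.congr_of_eventuallyEq hev).unique (hud.const_mul 2)
    simp only [id, Pi.mul_apply, Pi.add_apply, Pi.pow_apply] at h1
    rw [hcomm, cvx]
    norm_num at h1
    field_simp at h1 h0 ⊢
    linear_combination (-s) * h1 - h0
  · field_simp at h0 ⊢
    linear_combination s * h0

/-- The geodesic coefficients are quadratic forms at the vectors with `s ≠ 0` and `s² < b²`. These
are dense in the domain, and the Berwald curvature is continuous. -/
theorem isBerwald_of_explicitForm (hn : 2 ≤ n) (hc : ∀ x, c x ≠ 0) (hβ : IsClosedConformal a β c)
    (hF : IsGeneralABMetric a β φ S) (hE : HasExplicitForm a β (dom a β S) (genAB a β φ)) :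
    IsBerwald (dom a β S) (genAB a β φ) := by
  obtain ⟨hb, t, A, J, C, ϕ, ψ, -, hAJC, hden, -, -, -, -, hval⟩ := hE
  have hbpos : ∀ x, 0 < bsq a β x := fun x => lt_of_le_of_ne (bsq_nonneg x) (hb x).symm
  set O := innerSet a β S ∩ {q | q.2 ≠ 0} with hOdef
  have hOi := isOpen_innerSet hc hβ hF.isOpen
  have hO : IsOpen O := hOi.inter (isOpen_ne_fun continuous_snd continuous_const)
  have hφ : SmoothOn φ O := hF.smoothOn.mono Set.inter_subset_left
  have hu0 : ∀ q ∈ O, 0 < q.1 := by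
    rintro ⟨u, s⟩ ⟨⟨⟨x, rfl⟩, -, -⟩, -⟩; exact hbpos x
  have hvals : ∀ q ∈ O, (0 < q.2 → φ q.1 q.2 = ϕ (xi A J q.1 q.2) * Real.exp (C q.1) * q.2) ∧
      (q.2 < 0 → φ q.1 q.2 = ψ (xi A J q.1 q.2) * Real.exp (C q.1) * |q.2|) := by
    rintro ⟨u, s⟩ ⟨⟨⟨x, hx⟩, hsS, hsu⟩, -⟩
    simp only at hx hsS hsu ⊢
    obtain ⟨e, he, p, hp, rfl⟩ := exists_chart_point (n := n) x
    obtain ⟨y, hy, hys⟩ := exists_sv_eq (a := a) (β := β) he hp hn (s := s) (by rw [hx]; exact hsu)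
    have h := hval _ (vec e p y) ((vec_mem_dom_iff he hp S).2 ⟨hy, by rw [hys]; exact hsS⟩)
    rw [ratio_vec, hys, hx, genAB, ratio_vec, hys, hx] at h
    have hα : alpha a (e.symm p) (vec e p y) ≠ 0 :=
      (alpha_pos a fun h0 => hy ((vec_eq_zero_iff he hp).1 h0)).ne'
    refine ⟨fun hs => mul_left_cancel₀ hα ?_, fun hs => mul_left_cancel₀ hα ?_⟩
    · rw [h.1 hs]; ring
    · rw [h.2 hs]; ring
  have hT : ∀ u s, (u, s) ∈ O → 2 * d1 φ u s =
      t u * s * (s * φ u s + (u - s ^ 2) * d2 φ u s) - (φ u s + s * d2 φ u s) / u := by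
    intro u s h
    obtain ⟨h1, h2, h3⟩ := hAJC u h.1.1
    have hs0 : s ≠ 0 := h.2
    have hd : 0 < Real.exp (A u) + s ^ 2 * J u := by
      have := hden (u, |s|) ⟨h.1.1, abs_pos.2 hs0, by simpa using h.1.2.2.le⟩
      simpa using this
    rcases lt_or_gt_of_ne hs0 with hs | hs
    · refine transport_of_explicit (ε := -1) (K := ψ (xi A J u s)) hO hφ h (hu0 _ h).ne'
        (by norm_num)
        (by linarith) h1 h2 h3 hd fun q hq hq2 hxi => ?_
      rw [(hvals q hq).2 (by linarith), hxi, abs_of_neg (by linarith)]; ring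
    · refine transport_of_explicit (ε := 1) (K := ϕ (xi A J u s)) hO hφ h (hu0 _ h).ne'
        (by norm_num)
        (by linarith) h1 h2 h3 hd fun q hq hq2 hxi => ?_
      rw [(hvals q hq).1 (by linarith), hxi]; ring
  intro e he p hp y hy j i k l
  obtain ⟨u, hu⟩ : ∃ u, u = bsq a β (e.symm p) := ⟨_, rfl⟩
  have hupos : 0 < u := hu ▸ hbpos _
  set W := {y | vec e p y ∈ dom a β S (e.symm p)} with hW
  have hWo : IsOpen W := isOpen_dom_fibre he hp hF.isOpen
  set Q : E n → ℝ := fun y => alphaSpray a e p y i + (-c (e.symm p) / u) * (lin β e p y * y i) +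
    (c (e.symm p) * sharp a β e p i) * ((1 / (2 * u)) * ip a e p y y + (t u / 2) *
        (lin β e p y * lin β e p y))
    with hQ
  have hQq : IsQuadForm Q := by
    have q1 : IsQuadForm fun y => alphaSpray a e p y i := by
      unfold alphaSpray alphaSprayLow
      exact IsQuadForm.sum fun l _ => (IsQuadForm.const_mul ⟨fun i j =>
        2 * pd i (fun q => coeffA a e q l j) p - pd l (fun q => coeffA a e q i j) p, fun _ =>
            rfl⟩ _).const_mul _
    have q2 : IsQuadForm fun y => lin β e p y * y i := by
      obtain ⟨q, hq⟩ := IsQuadForm.mul_linear (fun j => coeffB β e j p)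
          (fun j => if j = i then 1 else 0)
      refine ⟨q, fun y => ?_⟩
      rw [← hq]; simp [lin]
    have q3 : IsQuadForm fun y => lin β e p y * lin β e p y := IsQuadForm.mul_linear _ _
    have q4 : IsQuadForm fun y => ip a e p y y := ⟨coeffA a e p, fun _ => rfl⟩
    exact (q1.add (q2.const_mul _)).add (((q4.const_mul _).add (q3.const_mul _)).const_mul _)
  -- On `W₀` both `s ≠ 0` and `s² < u` hold, so the formula for the geodesic coefficients applies.
  set W₀ := {y ∈ W | lin β e p y ≠ 0 ∧ lin β e p y ^ 2 < u * ip a e p y y} with hW₀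
  have hlinc : Continuous fun y => lin β e p y := by unfold lin; fun_prop
  have hipc : Continuous fun y => ip a e p y y := by unfold ip; fun_prop
  have hW₀o : IsOpen W₀ := hWo.inter ((isOpen_ne_fun hlinc continuous_const).inter
    (isOpen_lt (hlinc.pow 2) (continuous_const.mul hipc)))
  have hspray : ∀ z ∈ W₀, spray (genAB a β φ) e i p z = Q z := by
    rintro z ⟨hz, hz1, hz2⟩
    obtain ⟨hz0, hzS⟩ := (vec_mem_dom_iff he hp S).1 hz
    have hN := ip_self_pos (a := a) he hp hz0
    have hr := Real.sqrt_pos.2 hN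
    have hmem : (u, sv a β e p z) ∈ O := by
      refine ⟨⟨⟨_, hu.symm⟩, hzS, ?_⟩, div_ne_zero hz1 hr.ne'⟩
      simp only [sv]
      rw [div_pow, Real.sq_sqrt hN.le, div_lt_iff₀ hN]
      exact hz2
    obtain ⟨e1, e2⟩ := spray_equations_of_transport hO hφ (fun q hq => (hu0 q hq).ne') hT hmem
    rw [spray_genAB hc hβ hF he hp hu.symm rfl hz0 hmem.1 e1 e2, hQ]
    have e3 : √(ip a e p z z) * (-sv a β e p z / u) = -lin β e p z / u := by
      rw [sv]; field_simp
    have e4 : ip a e p z z * sv a β e p z ^ 2 = lin β e p z ^ 2 := by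
      rw [sv, div_pow, Real.sq_sqrt hN.le]; field_simp
    beta_reduce
    linear_combination c (e.symm p) * z i * e3 + c (e.symm p) * sharp a β e p i * t u / 2 * e4
  have hzero : ∀ z ∈ W₀, berwald (genAB a β φ) e j i k l p z = 0 := fun z hz => by
    have c0 : ∀ z ∈ W₀, spray (genAB a β φ) e i p =ᶠ[nhds z] Q := fun z hz => by
      filter_upwards [hW₀o.mem_nhds hz] with r hr using hspray r hr
    have c1 : ∀ z ∈ W₀, pd j (spray (genAB a β φ) e i p) =ᶠ[nhds z] pd j Q := fun z hz => by
      filter_upwards [hW₀o.mem_nhds hz] with r hr using pd_congr (c0 r hr) j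
    have c2 : ∀ z ∈ W₀, pd k (pd j (spray (genAB a β φ) e i p)) =ᶠ[nhds z] pd k (pd j Q) :=
        fun z hz => by
      filter_upwards [hW₀o.mem_nhds hz] with r hr using pd_congr (c1 r hr) k
    rw [berwald, pd_congr (c2 z hz) l, hQq.pd_pd_pd]
  have hcont : ContinuousOn (berwald (genAB a β φ) e j i k l p) W :=
    (contDiffOn_pd hWo (contDiffOn_pd hWo (contDiffOn_pd hWo
      (contDiffOn_spray_fibre he hp hF i) j) k) l).continuousOn
  -- On a line in the direction of `v` the polynomials `β` and `u α² - β²` do not vanish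
  -- identically, so every vector of the domain is a limit of vectors of `W₀`.
  obtain ⟨v₀, hv0, hv1⟩ := exists_unit_orthogonal (a := a) (β := β) he hp hn
  set v := (1 : ℝ) • v₀ + (1 : ℝ) • sharp a β e p with hv
  have hlv : lin β e p v = u := by
    rw [hv, lin_comb, hv0, ← bsq_eq_lin (a := a) he hp, ← hu]; ring
  have hNv : ip a e p v v = 1 + u := by
    rw [hv, ip_comb, hv1, ← bsq_eq_ip he hp, ip_comm p v₀, ip_sharp he hp, hv0, ← hu]; ring
  have hl : ∀ r : ℝ, lin β e p (y + r • v) = lin β e p y + u * r + 0 * r ^ 2 := fun r => by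
    have := lin_comb (β := β) (e := e) (p := p) y v 1 r
    rw [one_smul, hlv] at this
    rw [this]; ring
  have hg : ∀ r : ℝ, u * ip a e p (y + r • v) (y + r • v) - lin β e p (y + r • v) ^ 2 =
      (u * ip a e p y y - lin β e p y ^ 2) + (2 * u * ip a e p y v - 2 * u * lin β e p y) * r + u *
          r ^ 2 :=
    fun r => by
      have := ip_comb (a := a) (e := e) (p := p) y v 1 r
      rw [one_smul, hNv] at this
      rw [this, hl]; ring
  have hpath : Filter.Tendsto (fun r : ℝ => y + r • v) (nhdsWithin 0 {0}ᶜ) (nhds y) := by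
    have : ContinuousAt (fun r : ℝ => y + r • v) 0 := by fun_prop
    simpa using this.tendsto.mono_left nhdsWithin_le_nhds
  have hlim := (hcont.continuousAt (hWo.mem_nhds hy)).tendsto.comp hpath
  refine tendsto_nhds_unique_of_eventuallyEq hlim (tendsto_const_nhds (x := (0 : ℝ))) ?_
  filter_upwards [hpath.eventually (hWo.mem_nhds hy),
    eventually_quadratic_ne_zero (a := lin β e p y) (b := u) (c := 0) (Or.inr (Or.inl hupos.ne')),
    eventually_quadratic_ne_zero (a := u * ip a e p y y - lin β e p y ^ 2)
      (b := 2 * u * ip a e p y v - 2 * u * lin β e p y) (c := u) (Or.inr (Or.inr hupos.ne'))]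
    with r h1 h2 h3
  rw [← hl] at h2
  rw [← hg] at h3
  refine hzero _ ⟨h1, h2, ?_⟩
  refine lt_of_le_of_ne ?_ fun h => h3 (by rw [h, sub_self])
  rw [hu]; exact lin_sq_le he hp

end

end GenAB

end

theorem theorem1p1 {n : ℕ} (hn : 2 ≤ n) {M : Type*} [TopologicalSpace M] [ChartedSpace (GenAB.E n) M]
    [IsManifold (𝓡 n) ∞ M] [ConnectedSpace M]
    (a : GenAB.RMetric n M) (β : GenAB.OneForm n M) (φ : ℝ → ℝ → ℝ) (S : Set ℝ)
    (hF : GenAB.IsGeneralABMetric a β φ S)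
    (c : M → ℝ) (hc : ∀ x, c x ≠ 0) (hβ : GenAB.IsClosedConformal a β c) :
    (∀ τ : M → ℝ, GenAB.IsIsotropicBerwald (GenAB.dom a β S) (GenAB.genAB a β φ) τ →
      GenAB.IsRiemannian (GenAB.dom a β S) (GenAB.genAB a β φ) ∨
      GenAB.IsRanders (GenAB.dom a β S) (GenAB.genAB a β φ) ∨
      GenAB.IsKropina (GenAB.dom a β S) (GenAB.genAB a β φ) ∨
      (GenAB.IsBerwald (GenAB.dom a β S) (GenAB.genAB a β φ) ∧
        GenAB.HasExplicitForm a β (GenAB.dom a β S) (GenAB.genAB a β φ)) ∨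
      (S = Set.Ioi 0 ∧ (∃ x, τ x = 0) ∧ (∃ x, τ x ≠ 0) ∧
        GenAB.IsRandersKropina (GenAB.dom a β S) (GenAB.genAB a β φ))) ∧
    (GenAB.HasExplicitForm a β (GenAB.dom a β S) (GenAB.genAB a β φ) →
      GenAB.IsBerwald (GenAB.dom a β S) (GenAB.genAB a β φ)) :=
  ⟨fun _ hτ => Or.inr (GenAB.classification_of_isIsotropicBerwald hn hc hβ hF hτ),
    GenAB.isBerwald_of_explicitForm hn hc hβ hF⟩
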